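/- **Setting.** Let $\kappa:\mathbb R^d\times\mathbb R^d\to\mathbb R$ be a positive semidefinite kernel with $\kappa(x,x)=1$ for all $x$, $\mathcal H$ its reproducing kernel Hilbert space, and $\phi(x)=\kappa(x,\cdot)\in\mathcal H$. Let $0\le Y\le U$, $U>0$, and let $(x_t,y_t)_{t=1}^T$ be examples with $x_t\in\mathbb R^d$, $|y_t|\le Y$. For predictions $\hat y_1,\dots,\hat y_T$ and $f\in\mathcal H$ put $\mathrm{Reg}(f)=\sum_{t=1}^T\big[(\hat y_t-y_t)^2-(f(x_t)-y_t)^2\big]$. Let $\lambda_1\ge\dots\ge\lambda_T$ be the eigenvalues of the kernel matrix $(\kappa(x_s,x_t))_{s,t\le T}$. **NONS-ALD** has parameters $\mu>0$, $\alpha$, $U$ and $\eta=\frac1{4(U^2+Y^2)}$. It keeps a buffer $S=\{b_1,\dots,b_j\}$ of instances, an SVD $K_S=V\Sigma V^\top$ of their kernel matrix, the explicit feature map $\phi_j(x)=P_S\phi(x)\in\mathbb R^j$ with $P_S=\Sigma^{-1/2}V^\top\Phi_S^\top$, $\Phi_S=(\phi(b_1),\dots,\phi(b_j))$, a matrix $A\in\mathbb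 R^{j\times j}$ and a vector $\tilde w\in\mathbb R^j$; initially $S=\emptyset$ and $j=0$. In round $t$: 1. $x_t$ is received and $w=\arg\min\{(v-\tilde w)^\top A(v-\tilde w):v\in\mathbb R^j,\ |v^\top\phi_j(x_t)|\le U\}$. 2. Let $\alpha_t=\min_{\beta\in\mathbb R^j}\|\Phi_S\beta-\phi(x_t)\|_{\mathcal H}^2$. If $\alpha_t>\alpha$, then $S'=S\cup\{x_t\}$, $Q=P_{S'}P_S^\top$, and $S$, $j$, $A$, $w$ are replaced by $S'$, $j+1$, $\mu I+Q(A-\mu I)Q^\top$, $Qw$. 3. $\hat y_t=w^\top\phi_j(x_t)$ is predicted and $y_t$ is revealed. 4. With $\nabla=2(\hat y_t-y_t)\phi_j(x_t)$, put $A\leftarrow A+\eta\nabla\nabla^\top$ and then $\tilde w= w-A^{-1}\nabla$. **Cost.** Scalar operations on reals cost one step, an evaluation of $\kappa$ costs $d+1$ steps, an SVD of a symmetric $n\times n$ matrix costs $n^3$ steps; space is the peak number of real memory cells. **Corollary.** Let $p\ge 1$ and $0<c_1\le c_2$. There is a constant $C$ depending only on $p,U,Y,c_1,c_2$ such that the following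 holds for all $T\ge 2$, all $d$, $\kappa$ and all examples as above with $\lambda_i\le R_0\,i^{-p}$ ($1\le i\le T$) for some $R_0$ with $c_1T\le R_0\le c_2T$ (that is, $R_0=\Theta(T)$). Run NONS-ALD with $\mu=T^{\frac1{1+p}}$ and $\alpha=T^{-\frac{4p}{1+p}}$. Whichever SVDs are used, $$\mathrm{Reg}(f)\le C\,T^{\frac1{1+p}}\ln T\qquad\text{for all } f\in\mathcal H \text{ with } \|f\|_{\mathcal H}\le U .$$ NONS-ALD has an explicit implementation (incremental inversion of $A$, closed-form projection) with $$\text{space}\le C\Big(T^{\frac{2(1+5p)}{p(1+p)}}+d\,T^{\frac{1+5p}{p(1+p)}}\Big),$$ $$\text{average per-round time}\le C\Big(T^{\frac{2(1+5p)}{p(1+p)}}+T^{\frac{4(1+5p)}{p(1+p)}-1}+d\,T^{\frac{1+5p}{p(1+p)}}\Big).$$ So for fixed $d$ the space is $O\big(T^{\frac{2(1+5p)}{p(1+p)}}\big)$ and the average per-round time is $O\big(T^{\frac{2(1+5p)}{p(1+p)}}+T^{\frac{4(1+5p)}{p(1+p)}-1}\big)$. If $p\ge 10$, the average per-round time is at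 most $C\big(T^{\frac{2(1+5p)}{p(1+p)}}+d\,T^{\frac{1+5p}{p(1+p)}}\big)$ as well, and for fixed $d$ this bound is $o(T)$. -/

import Mathlib

open Matrix Finset Asymptotics Filter

universe u

noncomputable section

namespace OKR

/-! ## Kernel, feature map, kernel matrix -/

/-- Instances are vectors of `ℝ^d` with the Euclidean norm. -/
abbrev Pt (d : ℕ) := EuclideanSpace ℝ (Fin d)

section Kernel

variable {d : ℕ} (H : Type u) [NormedAddCommGroup H] [InnerProductSpace ℝ H] [CompleteSpace H]
  [RKHS ℝ H (Pt d) ℝ]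

/-- The feature map `φ(x) = κ(x, ·) ∈ H`; it satisfies `⟪f, φ(x)⟫ = f x`. -/
def feat (x : Pt d) : H := RKHS.kerFun H x (1 : ℝ)

/-- The reproducing kernel `κ(x, x')` of `H`, as a real-valued function. -/
def ker (x x' : Pt d) : ℝ := RKHS.kernel H x x' (1 : ℝ)

theorem ker_eq_inner (x x' : Pt d) : ker H x x' = inner ℝ (feat H x') (feat H x) := by
  have h := RKHS.kernel_inner H x x' (1 : ℝ) (1 : ℝ)
  simpa [ker, feat] using h

/-- The kernel matrix `K_n` of the points `b_1, …, b_n`. -/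
def kerMatrix {n : ℕ} (b : Fin n → Pt d) : Matrix (Fin n) (Fin n) ℝ :=
  Matrix.of fun i j => ker H (b i) (b j)

theorem kerMatrix_isHermitian {n : ℕ} (b : Fin n → Pt d) : (kerMatrix H b).IsHermitian := by
  ext i j
  simp only [kerMatrix, Matrix.conjTranspose_apply, Matrix.of_apply, star_trivial, ker_eq_inner]
  exact real_inner_comm _ _

/-- `λ_i ≤ R₀ i^{-p}` for all `1 ≤ i ≤ n`, where `λ_1 ≥ … ≥ λ_n` are the eigenvalues of the kernel
matrix of `b_1, …, b_n`. (`eigenvalues₀` lists them in decreasing order, starting at index `0`.) -/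
def PolyDecay {n : ℕ} (b : Fin n → Pt d) (R₀ p : ℝ) : Prop :=
  ∀ i : Fin (Fintype.card (Fin n)),
    (kerMatrix_isHermitian H b).eigenvalues₀ i ≤ R₀ * ((i : ℕ) + 1 : ℝ) ^ (-p)

/-- The ALD projection error `min_β ‖∑ β_i φ(b_i) - φ(x)‖²`. -/
def aldError {n : ℕ} (b : Fin n → Pt d) (x : Pt d) : ℝ :=
  ⨅ β : Fin n → ℝ, ‖(∑ i, β i • feat H (b i)) - feat H x‖ ^ 2

end Kernel

/-! ## The algorithm NONS-ALD -/

/-- What the learner holds between two rounds: the `size = j` basis instances `S(j)`, an SVD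
`K_{S(j)} = V diag(σ) Vᵀ`, the covariance matrix `A_j`, and the (not yet projected) weights. -/
structure Learner (d : ℕ) where
  size : ℕ
  basis : Fin size → Pt d
  vec : Matrix (Fin size) (Fin size) ℝ
  val : Fin size → ℝ
  cov : Matrix (Fin size) (Fin size) ℝ
  wt : Fin size → ℝ

/-- The learner before the first round: empty basis, zero hypothesis. -/
def Learner.init (d : ℕ) : Learner d where
  size := 0
  basis := Fin.elim0
  vec := 0
  val := 0
  cov := 0
  wt := 0

/-- The parameters: `μ`, the ALD threshold `α`, the bound `U`, and the learning rate `η`. -/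
structure Params where
  μ : ℝ
  α : ℝ
  U : ℝ
  η : ℝ

/-- `V` is orthogonal and `K = V diag(σ) Vᵀ`. -/
def IsSVD {n : ℕ} (K V : Matrix (Fin n) (Fin n) ℝ) (σ : Fin n → ℝ) : Prop :=
  Vᵀ * V = 1 ∧ K = V * Matrix.diagonal σ * Vᵀ

/-- `Σ^{-1/2} Vᵀ`; composed with `Φ_Sᵀ` this is the paper's `P_S^{1/2} : H → ℝ^n`. -/
def halfCoef {n : ℕ} (V : Matrix (Fin n) (Fin n) ℝ) (σ : Fin n → ℝ) :
    Matrix (Fin n) (Fin n) ℝ :=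
  Matrix.diagonal (fun i => (Real.sqrt (σ i))⁻¹) * Vᵀ

/-- The buffer `S ∪ {x}`. -/
def extend {d n : ℕ} (b : Fin n → Pt d) (x : Pt d) : Fin (n + 1) → Pt d :=
  Fin.snoc (α := fun _ => Pt d) b x

section Algorithm

variable {d : ℕ} (H : Type u) [NormedAddCommGroup H] [InnerProductSpace ℝ H] [CompleteSpace H]
  [RKHS ℝ H (Pt d) ℝ]

/-- The explicit Nyström feature `φ_j(x) = P_{S(j)}^{1/2} φ(x) = Σ^{-1/2} Vᵀ Φ_{S(j)}ᵀ φ(x)`. -/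
def Learner.phi (L : Learner d) (x : Pt d) : Fin L.size → ℝ :=
  halfCoef L.vec L.val *ᵥ (fun i => ker H (L.basis i) x)

/-- `Q = P_{S'}^{1/2} (P_S^{1/2})ᵀ`, for the basis `S' = b'` with SVD `(V', σ')` and the basis
`S = b` with SVD `(V, σ)`. -/
def transfer {m n : ℕ} (b' : Fin m → Pt d) (V' : Matrix (Fin m) (Fin m) ℝ) (σ' : Fin m → ℝ)
    (b : Fin n → Pt d) (V : Matrix (Fin n) (Fin n) ℝ) (σ : Fin n → ℝ) :
    Matrix (Fin m) (Fin n) ℝ :=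
  halfCoef V' σ' * (Matrix.of fun i j => ker H (b' i) (b j)) * (halfCoef V σ)ᵀ

/-- `w` is the projection of the current weights onto `{w : |wᵀ φ_j(x)| ≤ U}` in the norm of the
current covariance matrix. -/
def IsProjection (P : Params) (L : Learner d) (x : Pt d) (w : Fin L.size → ℝ) : Prop :=
  |w ⬝ᵥ L.phi H x| ≤ P.U ∧
    ∀ v : Fin L.size → ℝ, |v ⬝ᵥ L.phi H x| ≤ P.U →
      (w - L.wt) ⬝ᵥ (L.cov *ᵥ (w - L.wt)) ≤ (v - L.wt) ⬝ᵥ (L.cov *ᵥ (v - L.wt))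

/-- Entering a new epoch: `x` joins the basis, `A ↦ μ I + Q (A - μ I) Qᵀ` and `w ↦ Q w`, where
`Q = P_{S(j+1)}^{1/2} (P_{S(j)}^{1/2})ᵀ`. Any SVD of the new kernel matrix may be used. -/
def IsExtension (P : Params) (L : Learner d) (x : Pt d) (w : Fin L.size → ℝ)
    (L' : Learner d) : Prop :=
  ∃ (V : Matrix (Fin (L.size + 1)) (Fin (L.size + 1)) ℝ) (σ : Fin (L.size + 1) → ℝ)
    (Q : Matrix (Fin (L.size + 1)) (Fin L.size) ℝ),
    IsSVD (kerMatrix H (extend L.basis x)) V σ ∧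
    Q = transfer H (extend L.basis x) V σ L.basis L.vec L.val ∧
    L' = { size := L.size + 1
           basis := extend L.basis x
           vec := V
           val := σ
           cov := P.μ • 1 + Q * (L.cov - P.μ • 1) * Qᵀ
           wt := Q *ᵥ w }

/-- The gradient `ℓ'(ŷ, y) φ_j(x)` of the square loss. -/
def Learner.grad (L : Learner d) (x : Pt d) (y : ℝ) : Fin L.size → ℝ :=
  (2 * (L.wt ⬝ᵥ L.phi H x - y)) • L.phi H x

/-- The online Newton step `A ↦ A + η ∇ ∇ᵀ`, `w ↦ w - A⁻¹ ∇` (with the new `A`). -/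
def Learner.newton (P : Params) (L : Learner d) (x : Pt d) (y : ℝ) : Learner d :=
  let A : Matrix (Fin L.size) (Fin L.size) ℝ :=
    L.cov + P.η • Matrix.vecMulVec (L.grad H x y) (L.grad H x y)
  { L with cov := A, wt := L.wt - A⁻¹ *ᵥ L.grad H x y }

/-- One round. The weights are projected with respect to the incoming `x`; if the ALD condition
`α_t ≤ α` holds the basis is kept, otherwise it is extended by `x`; then `ŷ = wᵀ φ_j(x)` is
predicted, `y` is revealed, and a Newton step is made. -/
def IsRound (P : Params) (L : Learner d) (x : Pt d) (y yhat : ℝ) (L' : Learner d) : Prop :=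
  ∃ (w : Fin L.size → ℝ) (M : Learner d),
    IsProjection H P L x w ∧
    ((aldError H L.basis x ≤ P.α ∧ M = { L with wt := w }) ∨
      (P.α < aldError H L.basis x ∧ IsExtension H P L x w M)) ∧
    yhat = M.wt ⬝ᵥ M.phi H x ∧
    L' = M.newton H P x y

/-- `st` and `yhat` are the learners and the predictions of NONS-ALD on the examples
`(x_0, y_0), …, (x_{T-1}, y_{T-1})`. -/
def IsNonsAld (P : Params) (T : ℕ) (x : ℕ → Pt d) (y : ℕ → ℝ)
    (st : ℕ → Learner d) (yhat : ℕ → ℝ) : Prop :=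
  st 0 = Learner.init d ∧
    ∀ t < T, IsRound H P (st t) (x t) (y t) (yhat t) (st (t + 1))

/-- `Reg(f) = ∑_t [(ŷ_t - y_t)² - (f(x_t) - y_t)²]`. -/
def regret (T : ℕ) (x : ℕ → Pt d) (y yhat : ℕ → ℝ) (f : H) : ℝ :=
  ∑ t ∈ Finset.range T, ((yhat t - y t) ^ 2 - (f (x t) - y t) ^ 2)

end Algorithm

/-! ## Cost model

A value together with the number of elementary steps spent on it and the number of real-valued
memory cells it took. Scalar operations on reals (arithmetic, square root, comparison, copying)
take one step. One evaluation of the kernel on `ℝ^d` takes `d + 1` steps, and one SVD of a symmetric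
`n × n` matrix takes `n ^ 3` steps. A loop reuses its work space; apart from that no memory is
released within a round. -/

structure Costed (β : Type) where
  result : β
  time : ℕ
  cells : ℕ

namespace Costed

instance : Monad Costed where
  pure a := ⟨a, 0, 0⟩
  bind a f := ⟨(f a.result).result, a.time + (f a.result).time, a.cells + (f a.result).cells⟩

def read (a : ℝ) : Costed ℝ := ⟨a, 1, 1⟩
def add (a b : ℝ) : Costed ℝ := ⟨a + b, 1, 1⟩
def sub (a b : ℝ) : Costed ℝ := ⟨a - b, 1, 1⟩
def mul (a b : ℝ) : Costed ℝ := ⟨a * b, 1, 1⟩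
def div (a b : ℝ) : Costed ℝ := ⟨a / b, 1, 1⟩
def sqrt (a : ℝ) : Costed ℝ := ⟨Real.sqrt a, 1, 1⟩

/-- Branching on a comparison of two reals. -/
def ifLe {β : Type} (a b : ℝ) (yes no : Costed β) : Costed β :=
  if a ≤ b then ⟨yes.result, yes.time + 1, yes.cells⟩ else ⟨no.result, no.time + 1, no.cells⟩

/-- One evaluation of the kernel `κ`. -/
def kernel {d : ℕ} (κ : Pt d → Pt d → ℝ) (x x' : Pt d) : Costed ℝ := ⟨κ x x', d + 1, d + 1⟩

/-- The loop `acc := 0; for i: acc := acc + f i`. -/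
def sum {n : ℕ} (f : Fin n → Costed ℝ) : Costed ℝ where
  result := ∑ i, (f i).result
  time := ∑ i, ((f i).time + 1)
  cells := 1 + Finset.univ.sup fun i => (f i).cells

/-- The loop `for i: v[i] := f i`. -/
def vector {n : ℕ} (f : Fin n → Costed ℝ) : Costed (Fin n → ℝ) where
  result := fun i => (f i).result
  time := ∑ i, ((f i).time + 1)
  cells := n + Finset.univ.sup fun i => (f i).cells

/-- The loop `for i, j: M[i, j] := f i j`. -/
def matrix {m n : ℕ} (f : Fin m → Fin n → Costed ℝ) : Costed (Matrix (Fin m) (Fin n) ℝ) where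
  result := Matrix.of fun i j => (f i j).result
  time := ∑ i, ∑ j, ((f i j).time + 1)
  cells := m * n + Finset.univ.sup fun i => Finset.univ.sup fun j => (f i j).cells

def dot {n : ℕ} (a b : Fin n → ℝ) : Costed ℝ := sum fun i => mul (a i) (b i)

def mulVec {m n : ℕ} (M : Matrix (Fin m) (Fin n) ℝ) (v : Fin n → ℝ) : Costed (Fin m → ℝ) :=
  vector fun i => dot (M i) v

def matMul {m n k : ℕ} (M : Matrix (Fin m) (Fin n) ℝ) (N : Matrix (Fin n) (Fin k) ℝ) :
    Costed (Matrix (Fin m) (Fin k) ℝ) :=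
  matrix fun i j => dot (M i) (fun l => N l j)

/-- The SVD `V diag(σ) Vᵀ` of a symmetric matrix (on other matrices it is never called). -/
def svd {n : ℕ} (K : Matrix (Fin n) (Fin n) ℝ) :
    Costed (Matrix (Fin n) (Fin n) ℝ × (Fin n → ℝ)) :=
  open scoped Classical in
  ⟨if h : K.IsHermitian then ((h.eigenvectorUnitary : Matrix (Fin n) (Fin n) ℝ), h.eigenvalues)
    else (1, 0), n ^ 3, 2 * n ^ 2 + n⟩

end Costed

/-! ## An implementation of NONS-ALD -/

/-- The learner, together with the kernel matrix of its basis, the matrix `Σ^{-1/2} Vᵀ`, and the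
inverse of its covariance matrix. -/
structure Machine (d : ℕ) extends Learner d where
  gram : Matrix (Fin size) (Fin size) ℝ
  half : Matrix (Fin size) (Fin size) ℝ
  inv : Matrix (Fin size) (Fin size) ℝ

/-- A machine that has output the prediction `pred = wtᵀ feature` and waits for the label. -/
structure Pending (d : ℕ) extends Machine d where
  feature : Fin size → ℝ
  pred : ℝ

def Machine.init (d : ℕ) : Machine d where
  toLearner := Learner.init d
  gram := 0
  half := 0
  inv := 0

/-- The number of reals that a machine stores: `size` instances, the matrices `vec`, `cov`, `gram`,
`half`, `inv` and the vectors `val`, `wt`. -/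
def Machine.storage {d : ℕ} (m : Machine d) : ℕ :=
  m.size * d + 5 * m.size ^ 2 + 2 * m.size

section Implementation

open Costed

variable {d : ℕ} (κ : Pt d → Pt d → ℝ) (P : Params)

/-- `sign(z) max(|z| - U, 0)` -/
def overshoot (U z : ℝ) : Costed ℝ :=
  ifLe z U
    (do let b ← add z U
        ifLe 0 b (Costed.read 0) (Costed.read b))
    (sub z U)

/-- The kernel matrix of a basis extended by one instance: `k` is the vector of kernel values
between the old basis and the new instance, and `c` is the kernel value of the new instance. -/
def border {n : ℕ} (G : Matrix (Fin n) (Fin n) ℝ) (k : Fin n → ℝ) (c : ℝ) :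
    Costed (Matrix (Fin (n + 1)) (Fin (n + 1)) ℝ) :=
  Costed.matrix fun i j => Costed.read <|
    Fin.snoc (α := fun _ => Fin (n + 1) → ℝ)
      (fun a => Fin.snoc (α := fun _ => ℝ) (G a) (k a)) (Fin.snoc (α := fun _ => ℝ) k c) i j

/-- Extending the basis by `x`, given `k = (κ(b_i, x))_i`, `c = κ(x, x)` and the projected weights
`w`; then predicting. Since `Qᵀ Q = I`, the inverse of `μ I + Q (A - μ I) Qᵀ` is
`μ⁻¹ (I - Q Qᵀ) + Q A⁻¹ Qᵀ`. -/
def grow (m : Machine d) (x : Pt d) (k : Fin m.size → ℝ) (c : ℝ) (w : Fin m.size → ℝ) :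
    Costed (Pending d) := do
  let G ← border m.gram k c
  let S ← Costed.svd G
  let B ← Costed.matrix fun i j => do
    let r ← Costed.sqrt (S.2 i)
    div (S.1 j i) r
  let X ← matMul (Matrix.of fun i (j : Fin m.size) => G i j.castSucc) m.halfᵀ
  let Q ← matMul B X
  let D ← Costed.matrix fun i j => if i = j then sub (m.cov i j) P.μ else Costed.read (m.cov i j)
  let QD ← matMul Q D
  let QDQ ← matMul QD Qᵀ
  let A ← Costed.matrix fun i j => if i = j then add P.μ (QDQ i j) else Costed.read (QDQ i j)
  let QI ← matMul Q m.inv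
  let QIQ ← matMul QI Qᵀ
  let QQ ← matMul Q Qᵀ
  let I ← Costed.matrix fun i j => do
    let e ← if i = j then sub 1 (QQ i j) else sub 0 (QQ i j)
    let r ← div e P.μ
    add r (QIQ i j)
  let w' ← Costed.mulVec Q w
  let k' ← Costed.vector fun i => Costed.read (Fin.snoc (α := fun _ => ℝ) k c i)
  let φ ← Costed.mulVec B k'
  let ŷ ← dot w' φ
  return { size := m.size + 1, basis := extend m.basis x, vec := S.1, val := S.2, cov := A,
           wt := w', gram := G, half := B, inv := I, feature := φ, pred := ŷ }

/-- First half of a round: receive `x`, project the weights, test the ALD condition, extend the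
basis if the condition fails, and predict. The projection is computed as
`w - m(z) A⁻¹ φ_j(x) / (φ_j(x)ᵀ A⁻¹ φ_j(x))` with `z = wᵀ φ_j(x)` and
`m(z) = sign(z) max(|z| - U, 0)`, and the projection error as `κ(x, x) - kᵀ β` with
`β = K_S⁻¹ k = V Σ⁻¹ Vᵀ k`. -/
def observe (m : Machine d) (x : Pt d) : Costed (Pending d) := do
  let k ← Costed.vector fun i => Costed.kernel κ (m.basis i) x
  let φ ← Costed.mulVec m.half k
  let u ← Costed.mulVec m.inv φ
  let z ← dot m.wt φ
  let q ← dot φ u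
  let e ← overshoot P.U z
  let s ← div e q
  let w ← Costed.vector fun i => do
    let a ← mul s (u i)
    sub (m.wt i) a
  let β ← Costed.mulVec m.halfᵀ φ
  let c ← Costed.kernel κ x x
  let b ← dot k β
  let err ← sub c b
  ifLe err P.α
    (do let ŷ ← dot w φ
        return { m with wt := w, feature := φ, pred := ŷ })
    (grow P m x k c w)

/-- Second half of a round: receive `y` and make the Newton step; `A⁻¹` is updated by the
Sherman-Morrison formula. -/
def learn (p : Pending d) (y : ℝ) : Costed (Machine d) := do
  let r ← sub p.pred y
  let g ← mul 2 r
  let v ← Costed.vector fun i => mul g (p.feature i)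
  let A ← Costed.matrix fun i j => do
    let a ← mul (v i) (v j)
    let b ← mul P.η a
    add (p.cov i j) b
  let u ← Costed.mulVec p.inv v
  let s ← dot v u
  let s' ← mul P.η s
  let den ← add 1 s'
  let I ← Costed.matrix fun i j => do
    let a ← mul (u i) (u j)
    let b ← mul P.η a
    let c ← div b den
    sub (p.inv i j) c
  let h ← Costed.mulVec I v
  let w ← Costed.vector fun i => sub (p.wt i) (h i)
  return { p.toMachine with cov := A, inv := I, wt := w }

variable (x : ℕ → Pt d) (y : ℕ → ℝ)

/-- The machine before round `t` (rounds are numbered from `0`). -/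
def machineAt : ℕ → Machine d
  | 0 => Machine.init d
  | t + 1 => (learn P (observe κ P (machineAt t) (x t)).result (y t)).result

/-- The first half of round `t`. -/
def observeAt (t : ℕ) : Costed (Pending d) := observe κ P (machineAt κ P x y t) (x t)

/-- The second half of round `t`. -/
def learnAt (t : ℕ) : Costed (Machine d) := learn P (observeAt κ P x y t).result (y t)

/-- The prediction of round `t`. -/
def predictionAt (t : ℕ) : ℝ := (observeAt κ P x y t).result.pred

/-- Average number of steps per round over the first `T` rounds. -/
def avgTime (T : ℕ) : ℝ :=
  ((∑ t ∈ Finset.range T, ((observeAt κ P x y t).time + (learnAt κ P x y t).time) : ℕ) : ℝ) / T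

/-- Peak number of memory cells over the first `T` rounds: stored data, the current example, the
four parameters, and the work space of the round. -/
def space (T : ℕ) : ℕ :=
  (Finset.range T).sup fun t =>
    (machineAt κ P x y t).storage + (d + 1) + 4 +
      ((observeAt κ P x y t).cells + (learnAt κ P x y t).cells)

end Implementation

end OKR

end

/-! The regret bound comes from viewing the whole run inside one Euclidean space. Diagonalizing the
kernel matrix of the full sample gives vectors `ψ (x t)` in `ℝ^T` with the right inner products,
whose `i`-th coordinates have squared sum `λ_i` (`exists_represents`). The feature space of a buffer
embeds isometrically, by a matrix `G`, onto the span of the vectors of the buffer. A covariance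
matrix `A` lifts to `μ I + G (A - μ I) Gᵀ`, and weights `w` lift to `G w`. An extension of the
buffer satisfies `G' Q = G`, so it changes neither lift. Hence NONS-ALD is a single run of the
projected online Newton method in `ℝ^T` (`IsRound.newtonRound`), except that gradients use a vector
`q` with `‖ψ (x t) - q‖² ≤ α`.

For such a run the potential `‖v - F‖²_A` telescopes. The curvature of the square loss absorbs the
second-order term `η (g · (w - F))²`, and the terms `g · A⁻¹ g` add up to at most the growth of `log
det A` divided by `η` (`quad_rankOne_le_log_det`). In the eigenbasis of the sample the diagonal of
the last `A` is at most `μ + 4 λ_i + 4 ε_i` with `∑ ε_i ≤ T α`, so Hadamard's inequality bounds the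
growth by `∑ log (1 + 4 λ_i / μ) + 4 T α / μ`. For `μ = T^{1/(1+p)}` the decay of `λ_i` makes the
sum `O(μ log T)`, and `α` is so small that all projection errors contribute `O(μ)`.

The buffer is controlled by a determinant. By the Schur complement each new instance multiplies `det
K_S` by its projection error, so `α^J ≤ det K_S` for a buffer of size `J`. By Cauchy interlacing
`det K_S ≤ ∏ R₀ i^{-p} = R₀^J / (J!)^p`. With `J! ≥ (J/e)^J` this yields `J ≤ e (R₀/α)^{1/p} =
O(T^{(1+5p)/(p(1+p))})` (`IsNonsAld.size_le`).

The implementation caches the Gram matrix, `Σ^{-1/2} Vᵀ` and `A⁻¹`, and updates them by closed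
formulas. A round then costs `O(J² + J d)`, plus `O(J³)` when the buffer grows. The latter happens
at most `J` times, whence the amortized term `J⁴ / T`. -/

namespace OKR

/-! ## Linear algebra -/

section LinearAlgebra

variable {n m : ℕ}

theorem quad_nonneg {A : Matrix (Fin n) (Fin n) ℝ} (hA : A.PosSemidef) (v : Fin n → ℝ) :
    0 ≤ v ⬝ᵥ (A *ᵥ v) := by
  simpa using hA.dotProduct_mulVec_nonneg v

theorem quad_pos {A : Matrix (Fin n) (Fin n) ℝ} (hA : A.PosDef) {v : Fin n → ℝ} (hv : v ≠ 0) :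
    0 < v ⬝ᵥ (A *ᵥ v) := by
  simpa using hA.dotProduct_mulVec_pos hv

theorem transpose_eq_of_posDef {A : Matrix (Fin n) (Fin n) ℝ} (hA : A.PosDef) : Aᵀ = A := by
  simpa [Matrix.conjTranspose_eq_transpose_of_trivial] using hA.isHermitian.eq

theorem dotProduct_mulVec_comm {A : Matrix (Fin n) (Fin n) ℝ} (hA : Aᵀ = A) (v w : Fin n → ℝ) :
    v ⬝ᵥ (A *ᵥ w) = w ⬝ᵥ (A *ᵥ v) := by
  rw [dotProduct_mulVec, ← mulVec_transpose, hA, dotProduct_comm]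

theorem quad_sub {A : Matrix (Fin n) (Fin n) ℝ} (hA : Aᵀ = A) (v w : Fin n → ℝ) :
    (v - w) ⬝ᵥ (A *ᵥ (v - w)) =
      v ⬝ᵥ (A *ᵥ v) - 2 * (w ⬝ᵥ (A *ᵥ v)) + w ⬝ᵥ (A *ᵥ w) := by
  rw [mulVec_sub, dotProduct_sub, sub_dotProduct, sub_dotProduct, dotProduct_mulVec_comm hA v w]
  ring

theorem dotProduct_mulVec_transpose (A : Matrix (Fin m) (Fin n) ℝ) (v : Fin n → ℝ)
    (w : Fin m → ℝ) : (A *ᵥ v) ⬝ᵥ w = v ⬝ᵥ (Aᵀ *ᵥ w) := by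
  rw [mulVec_transpose, dotProduct_comm v, ← dotProduct_mulVec, dotProduct_comm]

theorem vecMulVec_mulVec' (g h v : Fin n → ℝ) : vecMulVec g h *ᵥ v = (h ⬝ᵥ v) • g := by
  ext i
  simp only [mulVec, dotProduct, vecMulVec_apply, Pi.smul_apply, smul_eq_mul, Finset.sum_mul]
  exact Finset.sum_congr rfl fun j _ => by ring

theorem posDef_add_rankOne {A : Matrix (Fin n) (Fin n) ℝ} (hA : A.PosDef) {η : ℝ} (hη : 0 ≤ η)
    (g : Fin n → ℝ) : (A + η • vecMulVec g g).PosDef := by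
  refine hA.add_posSemidef (PosSemidef.smul ?_ hη)
  simpa using posSemidef_vecMulVec_self_star g

/-- **Hadamard's inequality**, in logarithmic form. -/
theorem log_det_le_sum_log_diag {M : Matrix (Fin n) (Fin n) ℝ} (hM : M.PosDef) :
    Real.log M.det ≤ ∑ i, Real.log (M i i) := by
  have hd : ∀ i, 0 < M i i := fun i => hM.diag_pos
  -- Conjugation by `D` normalizes the diagonal to `1`, so the trace becomes `n`; summing `log s ≤ s
  -- - 1` over the eigenvalues gives `log det ≤ trace - n = 0`.
  set D : Matrix (Fin n) (Fin n) ℝ := diagonal fun i => (Real.sqrt (M i i))⁻¹ with hD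
  have hDdet : D.det = ∏ i, (Real.sqrt (M i i))⁻¹ := by rw [hD, det_diagonal]
  have hDpos : D.det ≠ 0 := by
    rw [hDdet]
    exact Finset.prod_ne_zero_iff.mpr fun i _ => inv_ne_zero (Real.sqrt_pos.mpr (hd i)).ne'
  have hN : (D * M * D).PosDef := by
    have := hM.mul_mul_conjTranspose_same (B := D)
      (by
        rw [Matrix.vecMul_injective_iff_isUnit]
        exact (Matrix.isUnit_iff_isUnit_det D).mpr (isUnit_iff_ne_zero.mpr hDpos))
    simpa [hD, conjTranspose_eq_transpose_of_trivial] using this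
  have htr : (D * M * D).trace = n := by
    have : ∀ i, (D * M * D) i i = 1 := by
      intro i
      rw [hD, mul_diagonal, diagonal_mul]
      have h := Real.mul_self_sqrt (hd i).le
      have h0 := (Real.sqrt_pos.mpr (hd i)).ne'
      field_simp
      nlinarith
    simp [trace, this]
  have hlog : Real.log (D * M * D).det ≤ 0 := by
    rw [hN.isHermitian.det_eq_prod_eigenvalues]
    simp only [RCLike.ofReal_real_eq_id, id_eq]
    rw [Real.log_prod (fun i _ => (hN.eigenvalues_pos i).ne')]
    calc ∑ i, Real.log (hN.isHermitian.eigenvalues i)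
        ≤ ∑ i, (hN.isHermitian.eigenvalues i - 1) :=
          Finset.sum_le_sum fun i _ => Real.log_le_sub_one_of_pos (hN.eigenvalues_pos i)
      _ = (D * M * D).trace - n := by
          rw [hN.isHermitian.trace_eq_sum_eigenvalues]; simp
      _ = 0 := by rw [htr, sub_self]
  have hdet : (D * M * D).det = M.det * ∏ i, (M i i)⁻¹ := by
    rw [det_mul, det_mul, hDdet]
    have : ∀ i, (M i i)⁻¹ = (Real.sqrt (M i i))⁻¹ * (Real.sqrt (M i i))⁻¹ := fun i => by
      rw [← mul_inv, Real.mul_self_sqrt (hd i).le]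
    simp_rw [this, Finset.prod_mul_distrib]
    ring
  rw [hdet, Real.log_mul hM.det_pos.ne'
    (Finset.prod_ne_zero_iff.mpr fun i _ => inv_ne_zero (hd i).ne'),
    Real.log_prod (fun i _ => inv_ne_zero (hd i).ne')] at hlog
  simp only [Real.log_inv, Finset.sum_neg_distrib] at hlog
  linarith

/-- Matrix determinant lemma: with `A'` the updated matrix and `v = A'⁻¹ g`, `A = A' (1 - η v gᵀ)`
gives `det A = det A' (1 - η g · v)`, and `log (1 - s) ≤ -s` finishes. This is the elliptical
potential argument. -/
theorem quad_rankOne_le_log_det {A : Matrix (Fin n) (Fin n) ℝ} (hA : A.PosDef) {η : ℝ}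
    (hη : 0 ≤ η) {g v : Fin n → ℝ} (hv : (A + η • vecMulVec g g) *ᵥ v = g) :
    η * (g ⬝ᵥ v) ≤ Real.log (A + η • vecMulVec g g).det - Real.log A.det := by
  set A' := A + η • vecMulVec g g with hA'
  have hpos : 0 < A'.det := (posDef_add_rankOne hA hη g).det_pos
  have hfac : A = A' * (1 + replicateCol Unit (-(η • v)) * replicateRow Unit g) := by
    rw [Matrix.mul_add, Matrix.mul_one, ← Matrix.mul_assoc, ← replicateCol_mulVec, mulVec_neg,
      mulVec_smul, hv, ← vecMulVec_eq, hA']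
    rw [neg_vecMulVec, smul_vecMulVec]
    abel
  have hdet : A.det = A'.det * (1 - η * (g ⬝ᵥ v)) := by
    conv_lhs => rw [hfac]
    rw [det_mul, det_one_add_replicateCol_mul_replicateRow, dotProduct_neg, dotProduct_smul,
      smul_eq_mul]
    ring
  have h1 : 0 < 1 - η * (g ⬝ᵥ v) := by
    have := hA.det_pos
    rw [hdet] at this
    exact pos_of_mul_pos_right this hpos.le
  rw [hdet, Real.log_mul hpos.ne' h1.ne']
  have := Real.log_le_sub_one_of_pos h1
  linarith

/-! ### Orthogonal diagonalizations and interlacing -/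

theorem IsSVD.mul_transpose {K V : Matrix (Fin n) (Fin n) ℝ} {σ : Fin n → ℝ} (h : IsSVD K V σ) :
    V * Vᵀ = 1 := mul_eq_one_comm.mp h.1

theorem IsSVD.transpose_mul_mul {K V : Matrix (Fin n) (Fin n) ℝ} {σ : Fin n → ℝ}
    (h : IsSVD K V σ) : Vᵀ * K * V = diagonal σ := by
  rw [h.2, ← Matrix.mul_assoc, ← Matrix.mul_assoc, h.1, Matrix.one_mul, Matrix.mul_assoc, h.1,
    Matrix.mul_one]

theorem IsSVD.det_eq {K V : Matrix (Fin n) (Fin n) ℝ} {σ : Fin n → ℝ} (h : IsSVD K V σ) :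
    K.det = ∏ i, σ i := by
  rw [h.2, det_mul, det_mul, mul_right_comm, ← det_mul, h.mul_transpose, det_one, one_mul,
    det_diagonal]

theorem IsSVD.nonneg {K V : Matrix (Fin n) (Fin n) ℝ} {σ : Fin n → ℝ} (h : IsSVD K V σ)
    (hK : K.PosSemidef) (i : Fin n) : 0 ≤ σ i := by
  have := hK.conjTranspose_mul_mul_same V
  rw [conjTranspose_eq_transpose_of_trivial, h.transpose_mul_mul, posSemidef_diagonal_iff] at this
  exact this i

theorem IsSVD.pos {K V : Matrix (Fin n) (Fin n) ℝ} {σ : Fin n → ℝ} (h : IsSVD K V σ)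
    (hK : K.PosSemidef) (hdet : K.det ≠ 0) (i : Fin n) : 0 < σ i := by
  refine lt_of_le_of_ne (h.nonneg hK i) fun h0 => hdet ?_
  rw [h.det_eq]
  exact Finset.prod_eq_zero (Finset.mem_univ i) h0.symm

theorem isSVD_eigenvalues {A : Matrix (Fin n) (Fin n) ℝ} (hA : A.IsHermitian) :
    IsSVD A (hA.eigenvectorUnitary : Matrix (Fin n) (Fin n) ℝ) hA.eigenvalues := by
  refine ⟨?_, ?_⟩
  · have := Unitary.coe_star_mul_self hA.eigenvectorUnitary
    simpa [star_eq_conjTranspose, conjTranspose_eq_transpose_of_trivial] using this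
  · have := hA.spectral_theorem
    rw [Unitary.conjStarAlgAut_apply] at this
    simpa [star_eq_conjTranspose, conjTranspose_eq_transpose_of_trivial, Function.comp_def]
      using this

theorem IsSVD.reindex {K V : Matrix (Fin n) (Fin n) ℝ} {σ : Fin n → ℝ} (h : IsSVD K V σ)
    (e : Fin n ≃ Fin n) : IsSVD K (V.submatrix id e) (σ ∘ e) := by
  have hd : diagonal (σ ∘ e) = (diagonal σ).submatrix e e := by
    rw [submatrix_diagonal_equiv]
  refine ⟨?_, ?_⟩
  · rw [transpose_submatrix, ← submatrix_mul _ _ _ id _ Function.bijective_id, h.1,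
      submatrix_one_equiv]
  · rw [hd, transpose_submatrix, submatrix_mul_equiv, submatrix_mul_equiv, ← h.2, submatrix_id_id]

/-- The SVD of a symmetric matrix with the eigenvalues in decreasing order. -/
theorem exists_isSVD_eigenvalues₀ {A : Matrix (Fin n) (Fin n) ℝ} (hA : A.IsHermitian) :
    ∃ V, IsSVD A V fun i => hA.eigenvalues₀ (Fin.cast (Fintype.card_fin n).symm i) := by
  -- `eigenvalues` is `eigenvalues₀` composed with the inverse of this `equivOfCardEq`; reindexing
  -- by `e` undoes the shuffle.
  set e : Fin n ≃ Fin n := (finCongr (Fintype.card_fin n).symm).trans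
    (Fintype.equivOfCardEq (Fintype.card_fin (Fintype.card (Fin n))))
  have h := (isSVD_eigenvalues hA).reindex e
  refine ⟨(hA.eigenvectorUnitary : Matrix (Fin n) (Fin n) ℝ).submatrix id e, ?_⟩
  convert h using 1
  ext i
  simp [Matrix.IsHermitian.eigenvalues, e]

/-- **Cauchy interlacing**: the eigenvalues of a compression are dominated by those of the matrix.-/
theorem eigenvalue_compression_le {K V : Matrix (Fin n) (Fin n) ℝ} {lam : Fin n → ℝ}
    (hK : IsSVD K V lam) {E : Matrix (Fin n) (Fin m) ℝ} (hE : Eᵀ * E = 1)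
    {W : Matrix (Fin m) (Fin m) ℝ} {σ : Fin m → ℝ} (hS : IsSVD (Eᵀ * K * E) W σ)
    (hσ : Antitone σ) {B : ℕ → ℝ} (hB : Antitone B) (hlam : ∀ i, lam i ≤ B i) (k : Fin m) :
    σ k ≤ B k := by
  set N : Matrix (Fin n) (Fin m) ℝ := Vᵀ * E * W with hN
  have hNN : Nᵀ * N = 1 := by
    calc Nᵀ * N = Wᵀ * (Eᵀ * ((V * Vᵀ) * E)) * W := by
          simp only [hN, transpose_mul, transpose_transpose, Matrix.mul_assoc]
      _ = 1 := by rw [hK.mul_transpose, Matrix.one_mul, hE, Matrix.mul_one, hS.1]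
  have hNK : Nᵀ * diagonal lam * N = diagonal σ := by
    calc Nᵀ * diagonal lam * N = Wᵀ * (Eᵀ * (V * diagonal lam * Vᵀ) * E) * W := by
          simp only [hN, transpose_mul, transpose_transpose, Matrix.mul_assoc]
      _ = diagonal σ := by rw [← hK.2, hS.transpose_mul_mul]
  -- Dimension count in the two eigenbases: the conditions `c i = 0` for `i > k` and `(N c) i = 0`
  -- for `i < k` number `m - 1`, so some `c ≠ 0` in `ℝ^m` meets them all. On it the common quadratic
  -- form is at least `σ k ‖c‖²` and at most `B k ‖c‖²`. The antitone `B` spares ordering `lam`, and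
  -- the zero functional in the case `i ≥ n` spares proving `m ≤ n`.
  let f : (Fin m → ℝ) →ₗ[ℝ] ({i : Fin m // k < i} → ℝ) × (Fin k → ℝ) :=
    LinearMap.prod (LinearMap.funLeft ℝ ℝ (fun i => i.1))
      (LinearMap.pi fun i : Fin k =>
        if h : (i : ℕ) < n then (LinearMap.proj ⟨i, h⟩).comp N.mulVecLin else 0)
  have hker : LinearMap.ker f ≠ ⊥ := by
    apply LinearMap.ker_ne_bot_of_finrank_lt
    rw [Module.finrank_prod, Module.finrank_fintype_fun_eq_card, Module.finrank_fintype_fun_eq_card,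
      Module.finrank_fintype_fun_eq_card, Fintype.card_fin, Fintype.card_fin]
    have : Fintype.card {i : Fin m // k < i} = m - 1 - k := by
      rw [Fintype.card_subtype]
      have : (Finset.univ.filter fun i : Fin m => k < i) = Finset.Ioi k := by ext; simp
      rw [this, Fin.card_Ioi]
    rw [this]
    omega
  obtain ⟨c, hc, hc0⟩ := Submodule.exists_mem_ne_zero_of_ne_bot hker
  rw [LinearMap.mem_ker, LinearMap.prod_apply, Prod.mk_eq_zero] at hc
  have hc1 : ∀ i : Fin m, k < i → c i = 0 := fun i hi => congrFun hc.1 ⟨i, hi⟩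
  have hc2 : ∀ i : Fin n, (i : ℕ) < k → (N *ᵥ c) i = 0 := by
    intro i hi
    have := congrFun hc.2 ⟨i, hi⟩
    simpa using this
  have hnorm : (N *ᵥ c) ⬝ᵥ (N *ᵥ c) = c ⬝ᵥ c := by
    rw [dotProduct_mulVec_transpose, mulVec_mulVec, hNN, one_mulVec]
  have hquad : (N *ᵥ c) ⬝ᵥ (diagonal lam *ᵥ (N *ᵥ c)) = c ⬝ᵥ (diagonal σ *ᵥ c) := by
    rw [dotProduct_mulVec_transpose, mulVec_mulVec, mulVec_mulVec, hNK]
  have hcpos : 0 < c ⬝ᵥ c := by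
    have := quad_pos (PosDef.one (n := Fin m) (R := ℝ)) hc0
    simpa using this
  have hlow : σ k * (c ⬝ᵥ c) ≤ c ⬝ᵥ (diagonal σ *ᵥ c) := by
    simp only [dotProduct, mulVec_diagonal, Finset.mul_sum]
    refine Finset.sum_le_sum fun i _ => ?_
    by_cases hi : k < i
    · simp [hc1 i hi]
    · nlinarith [mul_self_nonneg (c i), hσ (not_lt.mp hi)]
  have hup : (N *ᵥ c) ⬝ᵥ (diagonal lam *ᵥ (N *ᵥ c)) ≤ B k * ((N *ᵥ c) ⬝ᵥ (N *ᵥ c)) := by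
    simp only [dotProduct, mulVec_diagonal, Finset.mul_sum]
    refine Finset.sum_le_sum fun i _ => ?_
    by_cases hi : (i : ℕ) < k
    · simp [hc2 i hi]
    · have h1 := hlam i
      have h2 := hB (not_lt.mp hi)
      nlinarith [mul_self_nonneg ((N *ᵥ c) i)]
  rw [hquad, hnorm] at hup
  exact le_of_mul_le_mul_right (hlow.trans hup) hcpos

/-- Generalized Pythagorean inequality for a minimizer over a slab. -/
theorem quad_projection_le {A : Matrix (Fin n) (Fin n) ℝ} (hA : A.PosDef) {U : ℝ}
    {φ w₀ w : Fin n → ℝ} (hw : |w ⬝ᵥ φ| ≤ U)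
    (hmin : ∀ v : Fin n → ℝ, |v ⬝ᵥ φ| ≤ U →
      (w - w₀) ⬝ᵥ (A *ᵥ (w - w₀)) ≤ (v - w₀) ⬝ᵥ (A *ᵥ (v - w₀)))
    {v : Fin n → ℝ} (hv : |v ⬝ᵥ φ| ≤ U) :
    (w - v) ⬝ᵥ (A *ᵥ (w - v)) ≤ (w₀ - v) ⬝ᵥ (A *ᵥ (w₀ - v)) := by
  have hs := transpose_eq_of_posDef hA
  -- First-order optimality of `w` along the segment to `v`. If it failed, the quadratic `2 s a + s²
  -- b` would be negative at `s = 1` or at its minimizer `s = -a / b`, whichever lies in the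
  -- segment.
  have key : 0 ≤ (w - w₀) ⬝ᵥ (A *ᵥ (v - w)) := by
    by_contra! hneg
    set a := (w - w₀) ⬝ᵥ (A *ᵥ (v - w)) with ha
    set b := (v - w) ⬝ᵥ (A *ᵥ (v - w)) with hb
    have hb0 : 0 ≤ b := quad_nonneg hA.posSemidef _
    have hseg : ∀ s : ℝ, 0 ≤ s → s ≤ 1 → 0 ≤ 2 * s * a + s ^ 2 * b := by
      intro s h0 h1
      have hfeas : |(w + s • (v - w)) ⬝ᵥ φ| ≤ U := by
        have : (w + s • (v - w)) ⬝ᵥ φ = (1 - s) * (w ⬝ᵥ φ) + s * (v ⬝ᵥ φ) := by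
          simp [add_dotProduct, sub_dotProduct, smul_dotProduct]; ring
        rw [this]
        rw [abs_le] at hw hv ⊢
        constructor <;> nlinarith
      have h := hmin _ hfeas
      have he : w + s • (v - w) - w₀ = (w - w₀) + s • (v - w) := by abel
      rw [he, mulVec_add, mulVec_smul, dotProduct_add, add_dotProduct, add_dotProduct,
        dotProduct_smul, dotProduct_smul, smul_dotProduct, smul_dotProduct,
        dotProduct_mulVec_comm hs (v - w) (w - w₀), ← ha, ← hb] at h
      simp only [smul_eq_mul] at h
      nlinarith
    by_cases hba : b ≤ -a
    · have := hseg 1 zero_le_one le_rfl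
      nlinarith
    · push Not at hba
      have hbp : 0 < b := by linarith
      have h1 := hseg (-a / b) (div_nonneg (by linarith) hb0) ((div_le_one hbp).mpr hba.le)
      have h2 : 2 * (-a / b) * a + (-a / b) ^ 2 * b = -(a ^ 2 / b) := by
        field_simp; ring
      rw [h2] at h1
      have : 0 < a ^ 2 / b := div_pos (by nlinarith) hbp
      linarith
  have he : w₀ - v = (w - v) - (w - w₀) := by abel
  have hk : (w - w₀) ⬝ᵥ (A *ᵥ (v - w)) = -((w - w₀) ⬝ᵥ (A *ᵥ (w - v))) := by
    rw [← neg_sub w v, mulVec_neg, dotProduct_neg]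
  rw [he, quad_sub hs (w - v) (w - w₀)]
  have := quad_nonneg hA.posSemidef (w - w₀)
  linarith

theorem dotProduct_sq_le (v w : Fin n → ℝ) : (v ⬝ᵥ w) ^ 2 ≤ (v ⬝ᵥ v) * (w ⬝ᵥ w) := by
  have := Finset.sum_mul_sq_le_sq_mul_sq Finset.univ v w
  simpa [dotProduct, sq] using this

theorem dotProduct_self_nonneg' (v : Fin n → ℝ) : 0 ≤ v ⬝ᵥ v :=
  Finset.sum_nonneg fun i _ => mul_self_nonneg (v i)

theorem abs_dotProduct_le {v w : Fin n → ℝ} {a b : ℝ} (ha : 0 ≤ a) (hb : 0 ≤ b)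
    (hv : v ⬝ᵥ v ≤ a ^ 2) (hw : w ⬝ᵥ w ≤ b ^ 2) : |v ⬝ᵥ w| ≤ a * b := by
  refine abs_le_of_sq_le_sq ?_ (mul_nonneg ha hb)
  calc (v ⬝ᵥ w) ^ 2 ≤ (v ⬝ᵥ v) * (w ⬝ᵥ w) := dotProduct_sq_le v w
    _ ≤ a ^ 2 * b ^ 2 := mul_le_mul hv hw (dotProduct_self_nonneg' w) (sq_nonneg a)
    _ = (a * b) ^ 2 := by ring

end LinearAlgebra

/-! ## Isometric lifts of covariance matrices -/

section Lift

variable {n N : ℕ}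

/-- The covariance matrix `μ I + G (A - μ I) Gᵀ`: it acts as `A` on the range of `G` and as `μ I` on
the orthogonal complement. -/
def liftCov (μ : ℝ) (G : Matrix (Fin N) (Fin n) ℝ) (A : Matrix (Fin n) (Fin n) ℝ) :
    Matrix (Fin N) (Fin N) ℝ :=
  μ • 1 + G * (A - μ • 1) * Gᵀ

variable {μ : ℝ} {G : Matrix (Fin N) (Fin n) ℝ} {A : Matrix (Fin n) (Fin n) ℝ}

theorem liftCov_of_empty (μ : ℝ) (G : Matrix (Fin N) (Fin 0) ℝ) (A : Matrix (Fin 0) (Fin 0) ℝ) :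
    liftCov μ G A = μ • 1 := by
  rw [liftCov, Subsingleton.elim (A - μ • 1) 0, Matrix.mul_zero, Matrix.zero_mul, add_zero]

theorem liftCov_mulVec_range (hG : Gᵀ * G = 1) (v : Fin n → ℝ) :
    liftCov μ G A *ᵥ (G *ᵥ v) = G *ᵥ (A *ᵥ v) := by
  rw [liftCov, add_mulVec, mulVec_mulVec _ (G * (A - μ • 1) * Gᵀ), Matrix.mul_assoc _ Gᵀ, hG,
    Matrix.mul_one, Matrix.mul_sub, sub_mulVec, smul_mulVec, one_mulVec, Matrix.mul_smul,
    Matrix.mul_one, smul_mulVec, mulVec_mulVec]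
  abel

theorem liftCov_mulVec_orthogonal {v : Fin N → ℝ} (hv : Gᵀ *ᵥ v = 0) :
    liftCov μ G A *ᵥ v = μ • v := by
  rw [liftCov, add_mulVec, ← mulVec_mulVec, hv, mulVec_zero, add_zero, smul_mulVec, one_mulVec]

theorem transpose_mulVec_sub_range (hG : Gᵀ * G = 1) (v : Fin N → ℝ) :
    Gᵀ *ᵥ (v - G *ᵥ (Gᵀ *ᵥ v)) = 0 := by
  rw [mulVec_sub, mulVec_mulVec, hG, one_mulVec, sub_self]

theorem dotProduct_range (hG : Gᵀ * G = 1) (v w : Fin n → ℝ) :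
    (G *ᵥ v) ⬝ᵥ (G *ᵥ w) = v ⬝ᵥ w := by
  rw [dotProduct_mulVec_transpose, mulVec_mulVec, hG, one_mulVec]

theorem dotProduct_sub_range_self (hG : Gᵀ * G = 1) (v : Fin N → ℝ) :
    (v - G *ᵥ (Gᵀ *ᵥ v)) ⬝ᵥ (v - G *ᵥ (Gᵀ *ᵥ v)) =
      v ⬝ᵥ v - (Gᵀ *ᵥ v) ⬝ᵥ (Gᵀ *ᵥ v) := by
  have h : (G *ᵥ (Gᵀ *ᵥ v)) ⬝ᵥ v = (Gᵀ *ᵥ v) ⬝ᵥ (Gᵀ *ᵥ v) := dotProduct_mulVec_transpose _ _ _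
  rw [dotProduct_sub, sub_dotProduct, sub_dotProduct, dotProduct_range hG, h,
    dotProduct_comm v (G *ᵥ _), h]
  ring

theorem dotProduct_transpose_mulVec_le (hG : Gᵀ * G = 1) (v : Fin N → ℝ) :
    (Gᵀ *ᵥ v) ⬝ᵥ (Gᵀ *ᵥ v) ≤ v ⬝ᵥ v := by
  have h := dotProduct_self_nonneg' (v - G *ᵥ (Gᵀ *ᵥ v))
  rw [dotProduct_sub_range_self hG] at h
  linarith

/-- The quadratic form of a lifted matrix splits along the range of `G`. -/
theorem liftCov_quad (hG : Gᵀ * G = 1) (a : Fin n → ℝ) (F : Fin N → ℝ) :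
    (G *ᵥ a - F) ⬝ᵥ (liftCov μ G A *ᵥ (G *ᵥ a - F)) =
      (a - Gᵀ *ᵥ F) ⬝ᵥ (A *ᵥ (a - Gᵀ *ᵥ F)) +
        μ * ((F - G *ᵥ (Gᵀ *ᵥ F)) ⬝ᵥ (F - G *ᵥ (Gᵀ *ᵥ F))) := by
  set E := F - G *ᵥ (Gᵀ *ᵥ F) with hE
  have hE0 : Gᵀ *ᵥ E = 0 := transpose_mulVec_sub_range hG F
  have hsplit : G *ᵥ a - F = G *ᵥ (a - Gᵀ *ᵥ F) - E := by
    rw [hE, mulVec_sub]; abel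
  clear_value E
  have h0 : ∀ v, (G *ᵥ v) ⬝ᵥ E = 0 := fun v => by
    rw [dotProduct_mulVec_transpose, hE0, dotProduct_zero]
  rw [hsplit, mulVec_sub (liftCov μ G A), liftCov_mulVec_range hG, liftCov_mulVec_orthogonal hE0, dotProduct_sub,
    sub_dotProduct, sub_dotProduct, dotProduct_range hG, dotProduct_smul, dotProduct_smul, h0,
    dotProduct_comm E, h0, smul_eq_mul, smul_eq_mul]
  ring

theorem liftCov_posDef (hG : Gᵀ * G = 1) (hA : A.PosDef) (hμ : 0 < μ) :
    (liftCov μ G A).PosDef := by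
  have hs := transpose_eq_of_posDef hA
  refine PosDef.of_dotProduct_mulVec_pos ?_ ?_
  · rw [IsHermitian, conjTranspose_eq_transpose_of_trivial, liftCov]
    simp [transpose_mul, hs, Matrix.mul_assoc]
  · intro v hv
    have hq := liftCov_quad (μ := μ) (A := A) hG 0 (-v)
    simp only [mulVec_zero, zero_sub, neg_neg, mulVec_neg] at hq
    simp only [star_trivial, hq]
    by_cases h : Gᵀ *ᵥ v = 0
    · have hp := quad_pos (PosDef.one (n := Fin N) (R := ℝ)) hv
      rw [one_mulVec] at hp
      simp only [h, mulVec_zero, dotProduct_zero, sub_zero, neg_zero, dotProduct_neg,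
        neg_dotProduct, neg_neg, zero_add]
      positivity
    · have := quad_pos hA h
      have h2 := mul_nonneg hμ.le (dotProduct_self_nonneg' (-v - -(G *ᵥ (Gᵀ *ᵥ v))))
      linarith

/-- Lifting is affine in `A`, so a Newton update in the feature space becomes one in `ℝᴺ`. -/
theorem liftCov_add_rankOne (η : ℝ) (g : Fin n → ℝ) :
    liftCov μ G (A + η • vecMulVec g g) =
      liftCov μ G A + η • vecMulVec (G *ᵥ g) (G *ᵥ g) := by
  have h : G * vecMulVec g g * Gᵀ = vecMulVec (G *ᵥ g) (G *ᵥ g) := by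
    rw [mul_vecMulVec, vecMulVec_mul, vecMul_transpose]
  rw [liftCov, liftCov, add_sub_right_comm, Matrix.mul_add, Matrix.add_mul, Matrix.mul_smul,
    Matrix.smul_mul, h]
  abel

/-- Only the deviation from `μ I` is conjugated, so lifts compose. The update of `A` at an extension
is itself a lift, hence invisible after lifting to `ℝᴺ`. -/
theorem liftCov_liftCov {m : ℕ} (G' : Matrix (Fin N) (Fin m) ℝ) (Q : Matrix (Fin m) (Fin n) ℝ) :
    liftCov μ G' (liftCov μ Q A) = liftCov μ (G' * Q) A := by
  rw [liftCov, liftCov, liftCov, add_sub_cancel_left, transpose_mul]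
  simp only [Matrix.mul_assoc]

/-- The part of `F` orthogonal to the range of `G` contributes equally to both sides. What remains
is the Pythagorean inequality for `Gᵀ F`, which is feasible because `(Gᵀ F) · φ = F · (G φ)`. -/
theorem liftCov_projection_le (hG : Gᵀ * G = 1) (hA : A.PosDef) {U : ℝ}
    {φ w₀ w : Fin n → ℝ} (hw : |w ⬝ᵥ φ| ≤ U)
    (hmin : ∀ v : Fin n → ℝ, |v ⬝ᵥ φ| ≤ U →
      (w - w₀) ⬝ᵥ (A *ᵥ (w - w₀)) ≤ (v - w₀) ⬝ᵥ (A *ᵥ (v - w₀)))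
    {F : Fin N → ℝ} (hF : |F ⬝ᵥ (G *ᵥ φ)| ≤ U) :
    (G *ᵥ w - F) ⬝ᵥ (liftCov μ G A *ᵥ (G *ᵥ w - F)) ≤
      (G *ᵥ w₀ - F) ⬝ᵥ (liftCov μ G A *ᵥ (G *ᵥ w₀ - F)) := by
  rw [liftCov_quad hG, liftCov_quad hG]
  refine add_le_add_left (quad_projection_le hA hw hmin ?_) _
  rwa [dotProduct_comm, ← dotProduct_mulVec_transpose, dotProduct_comm]

end Lift

/-! ## The embedding of a buffer -/

section HalfCoef

variable {n : ℕ} {K V : Matrix (Fin n) (Fin n) ℝ} {σ : Fin n → ℝ}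

theorem halfCoef_mul_mul_transpose (h : IsSVD K V σ) (hσ : ∀ i, 0 < σ i) :
    halfCoef V σ * K * (halfCoef V σ)ᵀ = 1 := by
  rw [halfCoef, transpose_mul, transpose_transpose, diagonal_transpose]
  calc diagonal (fun i => (Real.sqrt (σ i))⁻¹) * Vᵀ * K * (V * diagonal fun i => (Real.sqrt (σ i))⁻¹)
      = diagonal (fun i => (Real.sqrt (σ i))⁻¹) * (Vᵀ * K * V) *
          diagonal fun i => (Real.sqrt (σ i))⁻¹ := by simp only [Matrix.mul_assoc]
    _ = 1 := by
      rw [h.transpose_mul_mul, diagonal_mul_diagonal, diagonal_mul_diagonal, ← diagonal_one]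
      congr 1
      ext i
      have h1 := Real.sqrt_pos.mpr (hσ i)
      have h2 := Real.mul_self_sqrt (hσ i).le
      field_simp
      nlinarith

/-- Left inverses of square matrices are right inverses, so the factors of the preceding identity
may be rotated; the product of the two half factors is `K⁻¹ = V Σ⁻¹ Vᵀ`. -/
theorem transpose_halfCoef_mul_halfCoef_mul (h : IsSVD K V σ) (hσ : ∀ i, 0 < σ i) :
    (halfCoef V σ)ᵀ * halfCoef V σ * K = 1 := by
  have h1 := halfCoef_mul_mul_transpose h hσ
  rw [Matrix.mul_assoc] at h1
  have h2 := mul_eq_one_comm.mp h1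
  rw [Matrix.mul_assoc] at h2
  exact mul_eq_one_comm.mp h2

theorem mul_transpose_halfCoef_mul_halfCoef (h : IsSVD K V σ) (hσ : ∀ i, 0 < σ i) :
    K * ((halfCoef V σ)ᵀ * halfCoef V σ) = 1 :=
  mul_eq_one_comm.mp (transpose_halfCoef_mul_halfCoef_mul h hσ)

end HalfCoef

section Embedding

variable {d N : ℕ} (H : Type u) [NormedAddCommGroup H] [InnerProductSpace ℝ H] [CompleteSpace H]
  [RKHS ℝ H (Pt d) ℝ]

/-- On `X`, the kernel is the Euclidean inner product of the vectors `ψ z`. -/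
def Represents (ψ : Pt d → Fin N → ℝ) (X : Set (Pt d)) : Prop :=
  ∀ z ∈ X, ∀ z' ∈ X, ψ z ⬝ᵥ ψ z' = ker H z z'

/-- The isometry `ℝⁿ → ℝᴺ` that sends the explicit feature of an instance to the projection of its
representing vector onto the span of the buffer. -/
noncomputable def embed {n : ℕ} (ψ : Pt d → Fin N → ℝ) (b : Fin n → Pt d) (V : Matrix (Fin n) (Fin n) ℝ)
    (σ : Fin n → ℝ) : Matrix (Fin N) (Fin n) ℝ :=
  (halfCoef V σ * Matrix.of fun i => ψ (b i))ᵀ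

variable {H} {ψ : Pt d → Fin N → ℝ} {X : Set (Pt d)} (hψ : Represents H ψ X)

include hψ

theorem Represents.of_mul_transpose {m n : ℕ} {b' : Fin m → Pt d} {b : Fin n → Pt d}
    (hb' : ∀ i, b' i ∈ X) (hb : ∀ i, b i ∈ X) :
    (Matrix.of fun i => ψ (b' i)) * (Matrix.of fun i => ψ (b i))ᵀ =
      Matrix.of fun i j => ker H (b' i) (b j) := by
  ext i j
  rw [Matrix.of_apply, ← hψ _ (hb' i) _ (hb j)]
  rfl

variable {n : ℕ} {b : Fin n → Pt d} {V : Matrix (Fin n) (Fin n) ℝ} {σ : Fin n → ℝ}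
  (hb : ∀ i, b i ∈ X) (hsvd : IsSVD (kerMatrix H b) V σ) (hσ : ∀ i, 0 < σ i)

include hb

theorem Represents.embed_transpose_mulVec {x : Pt d} (hx : x ∈ X) :
    (embed ψ b V σ)ᵀ *ᵥ ψ x = halfCoef V σ *ᵥ fun i => ker H (b i) x := by
  rw [embed, transpose_transpose, ← mulVec_mulVec]
  congr 1
  ext i
  rw [← hψ _ (hb i) _ hx]
  rfl

theorem Represents.transfer_eq {m : ℕ} {b' : Fin m → Pt d} {V' : Matrix (Fin m) (Fin m) ℝ}
    {σ' : Fin m → ℝ} (hb' : ∀ i, b' i ∈ X) :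
    transfer H b' V' σ' b V σ = (embed ψ b' V' σ')ᵀ * embed ψ b V σ := by
  rw [transfer, ← hψ.of_mul_transpose hb' hb, embed, embed, transpose_transpose, transpose_mul]
  simp only [Matrix.mul_assoc]

include hsvd hσ

theorem Represents.embed_isometry : (embed ψ b V σ)ᵀ * embed ψ b V σ = 1 := by
  rw [← hψ.transfer_eq hb hb, transfer]
  exact halfCoef_mul_mul_transpose hsvd hσ

/-- With `R` the matrix of rows `ψ (b i)`, `G Gᵀ = Rᵀ K⁻¹ R` is the orthogonal projection onto the
row space of `R`, so it fixes `Rᵀ`. -/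
theorem Represents.embed_projection_buffer :
    embed ψ b V σ * ((embed ψ b V σ)ᵀ * (Matrix.of fun i => ψ (b i))ᵀ) =
      (Matrix.of fun i => ψ (b i))ᵀ := by
  set R : Matrix (Fin n) (Fin N) ℝ := Matrix.of fun i => ψ (b i) with hR
  have hK : R * Rᵀ = kerMatrix H b := hψ.of_mul_transpose hb hb
  rw [embed, transpose_transpose, ← hR, transpose_mul]
  calc Rᵀ * (halfCoef V σ)ᵀ * (halfCoef V σ * R * Rᵀ)
      = Rᵀ * ((halfCoef V σ)ᵀ * halfCoef V σ * (R * Rᵀ)) := by simp only [Matrix.mul_assoc]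
    _ = Rᵀ := by rw [hK, transpose_halfCoef_mul_halfCoef_mul hsvd hσ, Matrix.mul_one]

theorem Represents.embed_projection_point (i : Fin n) :
    embed ψ b V σ *ᵥ ((embed ψ b V σ)ᵀ *ᵥ ψ (b i)) = ψ (b i) := by
  have h := hψ.embed_projection_buffer hb hsvd hσ
  have hc : (Matrix.of fun i => ψ (b i))ᵀ *ᵥ Pi.single i 1 = ψ (b i) := by
    ext k; simp
  have := congrArg (fun M : Matrix (Fin N) (Fin n) ℝ => M *ᵥ Pi.single i 1) h
  simpa only [← mulVec_mulVec, hc] using this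

/-- The ranges of the embeddings grow with the buffer. -/
theorem Represents.embed_projection_embed {m : ℕ} {c : Fin m → Pt d} {W : Matrix (Fin m) (Fin m) ℝ}
    {τ : Fin m → ℝ} (hc : ∀ i, ∃ j, c i = b j) :
    embed ψ b V σ * ((embed ψ b V σ)ᵀ * embed ψ c W τ) = embed ψ c W τ := by
  have h : embed ψ b V σ * ((embed ψ b V σ)ᵀ * (Matrix.of fun i => ψ (c i))ᵀ) =
      (Matrix.of fun i => ψ (c i))ᵀ := by
    ext k i
    obtain ⟨j, hj⟩ := hc i
    have := congrFun (hψ.embed_projection_point hb hsvd hσ j) k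
    rw [← hj, mulVec_mulVec] at this
    rw [← Matrix.mul_assoc]
    exact this
  conv_lhs => rw [embed.eq_def ψ c, transpose_mul, ← Matrix.mul_assoc _ _ (halfCoef W τ)ᵀ,
    ← Matrix.mul_assoc, h]
  rw [embed.eq_def ψ c, transpose_mul]

end Embedding

/-! ## The projection error -/

section AldError

variable {d : ℕ} (H : Type u) [NormedAddCommGroup H] [InnerProductSpace ℝ H] [CompleteSpace H]
  [RKHS ℝ H (Pt d) ℝ]

theorem ker_comm (x z : Pt d) : ker H x z = ker H z x := by
  rw [ker_eq_inner, ker_eq_inner, real_inner_comm]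

variable {n : ℕ} (b : Fin n → Pt d)

theorem inner_sum_feat (β : Fin n → ℝ) (x : Pt d) :
    inner ℝ (∑ i, β i • feat H (b i)) (feat H x) = β ⬝ᵥ fun i => ker H (b i) x := by
  simp only [sum_inner, real_inner_smul_left, dotProduct, ker_eq_inner]
  exact Finset.sum_congr rfl fun i _ => by rw [real_inner_comm]

theorem norm_sum_feat_sq (β : Fin n → ℝ) :
    ‖∑ i, β i • feat H (b i)‖ ^ 2 = β ⬝ᵥ (kerMatrix H b *ᵥ β) := by
  rw [← real_inner_self_eq_norm_sq]
  simp only [inner_sum, real_inner_smul_right, inner_sum_feat]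
  rw [dotProduct_mulVec, dotProduct_comm]
  exact Finset.sum_congr rfl fun i _ => rfl

theorem kerMatrix_posSemidef : (kerMatrix H b).PosSemidef := by
  refine PosSemidef.of_dotProduct_mulVec_nonneg (kerMatrix_isHermitian H b) fun β => ?_
  rw [star_trivial, ← norm_sum_feat_sq]
  positivity

variable {H b} {V : Matrix (Fin n) (Fin n) ℝ} {σ : Fin n → ℝ}

/-- The projection error in terms of the explicit feature. -/
theorem aldError_eq (hsvd : IsSVD (kerMatrix H b) V σ) (hσ : ∀ i, 0 < σ i) (x : Pt d) :
    aldError H b x = ker H x x - (halfCoef V σ *ᵥ fun i => ker H (b i) x) ⬝ᵥ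
      (halfCoef V σ *ᵥ fun i => ker H (b i) x) := by
  set k : Fin n → ℝ := fun i => ker H (b i) x with hk
  -- The least-squares solution `K⁻¹ k`; `hexp` completes the square around it.
  set γ : Fin n → ℝ := ((halfCoef V σ)ᵀ * halfCoef V σ) *ᵥ k with hγ
  have hKγ : kerMatrix H b *ᵥ γ = k := by
    rw [hγ, mulVec_mulVec, mul_transpose_halfCoef_mul_halfCoef hsvd hσ, one_mulVec]
  have hφ : (halfCoef V σ *ᵥ k) ⬝ᵥ (halfCoef V σ *ᵥ k) = k ⬝ᵥ γ := by
    rw [dotProduct_mulVec_transpose, mulVec_mulVec]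
  have hKt : (kerMatrix H b)ᵀ = kerMatrix H b := by
    simpa [conjTranspose_eq_transpose_of_trivial] using (kerMatrix_isHermitian H b).eq
  have hexp : ∀ β : Fin n → ℝ, ‖(∑ i, β i • feat H (b i)) - feat H x‖ ^ 2 =
      (β - γ) ⬝ᵥ (kerMatrix H b *ᵥ (β - γ)) + (ker H x x - k ⬝ᵥ γ) := by
    intro β
    rw [norm_sub_sq_real, norm_sum_feat_sq, inner_sum_feat, ← real_inner_self_eq_norm_sq,
      ← ker_eq_inner, mulVec_sub, dotProduct_sub, sub_dotProduct, sub_dotProduct, hKγ,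
      dotProduct_mulVec_comm hKt γ β, hKγ, dotProduct_comm γ k]
    ring
  rw [hφ, aldError]
  refine le_antisymm ?_ ?_
  · refine ciInf_le_of_le ⟨0, ?_⟩ γ ?_
    · rintro _ ⟨β, rfl⟩
      positivity
    · rw [hexp, sub_self, zero_dotProduct, zero_add]
  · refine le_ciInf fun β => ?_
    rw [hexp]
    have := quad_nonneg (kerMatrix_posSemidef H b) (β - γ)
    linarith

@[simp] theorem extend_castSucc (b : Fin n → Pt d) (x : Pt d) (i : Fin n) :
    extend b x i.castSucc = b i := by simp [extend]

@[simp] theorem extend_last (b : Fin n → Pt d) (x : Pt d) :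
    extend b x (Fin.last n) = x := by simp [extend]

/-- The Schur complement of the old block is `κ(x, x) - kᵀ K⁻¹ k`, which is the projection error. -/
theorem det_kerMatrix_extend (hsvd : IsSVD (kerMatrix H b) V σ) (hσ : ∀ i, 0 < σ i) (x : Pt d) :
    (kerMatrix H (extend b x)).det = (kerMatrix H b).det * aldError H b x := by
  set k : Fin n → ℝ := fun i => ker H (b i) x with hk
  let e : Fin n ⊕ Fin 1 ≃ Fin (n + 1) := finSumFinEquiv
  have hblock : (kerMatrix H (extend b x)).submatrix e e =
      fromBlocks (kerMatrix H b) (replicateCol (Fin 1) k) (replicateRow (Fin 1) k)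
        (Matrix.of fun _ _ => ker H x x) := by
    have h1 : ∀ i : Fin n, e (Sum.inl i) = i.castSucc := fun i => rfl
    have h2 : ∀ i : Fin 1, e (Sum.inr i) = Fin.last n := fun i => by
      ext; simp [e]
    ext i j
    rcases i with i | i <;> rcases j with j | j <;>
      simp [h1, h2, kerMatrix, hk, ker_comm H x]
  let _ : Invertible (kerMatrix H b) :=
    ⟨(halfCoef V σ)ᵀ * halfCoef V σ, transpose_halfCoef_mul_halfCoef_mul hsvd hσ,
      mul_transpose_halfCoef_mul_halfCoef hsvd hσ⟩
  have hinv : ⅟(kerMatrix H b) = (halfCoef V σ)ᵀ * halfCoef V σ := rfl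
  rw [← det_submatrix_equiv_self e, hblock, det_fromBlocks₁₁, hinv, det_fin_one, aldError_eq hsvd hσ]
  congr 1
  rw [Matrix.sub_apply, Matrix.of_apply, dotProduct_mulVec_transpose, mulVec_mulVec,
    dotProduct_mulVec]
  rfl

end AldError

/-! ## Rounds of NONS-ALD as online Newton steps in a fixed Euclidean space -/

section Rounds

variable {d N : ℕ} (H : Type u) [NormedAddCommGroup H] [InnerProductSpace ℝ H] [CompleteSpace H]
  [RKHS ℝ H (Pt d) ℝ]

/-- The invariant of a learner: its SVD is one of its (nonsingular) kernel matrix, and its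
covariance matrix is positive definite. -/
structure Learner.Valid (L : Learner d) : Prop where
  svd : IsSVD (kerMatrix H L.basis) L.vec L.val
  val_pos : ∀ i, 0 < L.val i
  cov_posDef : L.cov.PosDef

/-- The isometry of a learner's feature space into `ℝᴺ`. -/
noncomputable def Learner.emb (L : Learner d) (ψ : Pt d → Fin N → ℝ) :
    Matrix (Fin N) (Fin L.size) ℝ :=
  embed ψ L.basis L.vec L.val

theorem Learner.valid_init : (Learner.init d).Valid H where
  svd := by
    refine ⟨?_, ?_⟩ <;> ext i <;> exact Fin.elim0 i
  val_pos := fun i => Fin.elim0 i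
  cov_posDef := PosDef.of_dotProduct_mulVec_pos (by ext i; exact Fin.elim0 i)
    fun v hv => absurd (funext fun i => Fin.elim0 i) hv

variable {H}

section

variable {ψ : Pt d → Fin N → ℝ} {X : Set (Pt d)} {P : Params} {L : Learner d}

theorem Learner.Valid.emb_isometry (hL : L.Valid H) (hψ : Represents H ψ X)
    (hb : ∀ i, L.basis i ∈ X) : (L.emb ψ)ᵀ * L.emb ψ = 1 :=
  hψ.embed_isometry hb hL.svd hL.val_pos

theorem Learner.emb_transpose_mulVec (hψ : Represents H ψ X)
    (hb : ∀ i, L.basis i ∈ X) {x : Pt d} (hx : x ∈ X) : (L.emb ψ)ᵀ *ᵥ ψ x = L.phi H x :=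
  hψ.embed_transpose_mulVec hb hx

theorem Learner.Valid.aldError_eq (hL : L.Valid H) (x : Pt d) :
    aldError H L.basis x = ker H x x - L.phi H x ⬝ᵥ L.phi H x :=
  OKR.aldError_eq hL.svd hL.val_pos x

theorem Learner.Valid.det_pos (hL : L.Valid H) : 0 < (kerMatrix H L.basis).det := by
  rw [hL.svd.det_eq]
  exact Finset.prod_pos fun i _ => hL.val_pos i

/-- Pythagoras for the projection `G Gᵀ`: both sides equal `‖ψ x‖² - ‖φ_j(x)‖²`. The ALD test thus
measures the distance from `ψ x` to the vector used in the gradient. -/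
theorem Learner.Valid.dist_projection (hL : L.Valid H) (hψ : Represents H ψ X)
    (hb : ∀ i, L.basis i ∈ X) {x : Pt d} (hx : x ∈ X) :
    (ψ x - L.emb ψ *ᵥ L.phi H x) ⬝ᵥ (ψ x - L.emb ψ *ᵥ L.phi H x) = aldError H L.basis x := by
  rw [← Learner.emb_transpose_mulVec hψ hb hx, dotProduct_sub_range_self (hL.emb_isometry hψ hb),
    hL.aldError_eq, Learner.emb_transpose_mulVec hψ hb hx, hψ x hx x hx]

/-- What an extension of the buffer does to a learner: in the embedding, nothing changes. -/
structure Learner.ExtendsTo (H : Type u) [NormedAddCommGroup H] [InnerProductSpace ℝ H]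
    [CompleteSpace H] [RKHS ℝ H (Pt d) ℝ] (P : Params) (L : Learner d) (ψ : Pt d → Fin N → ℝ)
    (w : Fin L.size → ℝ) (M : Learner d) : Prop where
  valid : M.Valid H
  cov : liftCov P.μ (M.emb ψ) M.cov = liftCov P.μ (L.emb ψ) L.cov
  wt : M.emb ψ *ᵥ M.wt = L.emb ψ *ᵥ w

/-- Here `Q = G'ᵀ G`, and `G' G'ᵀ` fixes the range of `G` because the buffer only grows; hence `Qᵀ Q
= Gᵀ G = 1`. -/
theorem transfer_isometry (hψ : Represents H ψ X) (hL : L.Valid H) (hb : ∀ i, L.basis i ∈ X)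
    {m : ℕ} {b : Fin m → Pt d} {V : Matrix (Fin m) (Fin m) ℝ} {σ : Fin m → ℝ}
    (hb' : ∀ i, b i ∈ X) (hsub : ∀ i, ∃ j, L.basis i = b j)
    (hsvd : IsSVD (kerMatrix H b) V σ) (hσ : ∀ i, 0 < σ i) :
    (transfer H b V σ L.basis L.vec L.val)ᵀ * transfer H b V σ L.basis L.vec L.val = 1 := by
  rw [hψ.transfer_eq hb hb', transpose_mul, transpose_transpose, Matrix.mul_assoc,
    hψ.embed_projection_embed hb' hsvd hσ hsub]
  exact hL.emb_isometry hψ hb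

theorem val_pos_of_extend (hL : L.Valid H) {x : Pt d}
    (hα : 0 < aldError H L.basis x) {V : Matrix (Fin (L.size + 1)) (Fin (L.size + 1)) ℝ}
    {σ : Fin (L.size + 1) → ℝ} (hsvd : IsSVD (kerMatrix H (extend L.basis x)) V σ) (i) :
    0 < σ i := by
  refine hsvd.pos (kerMatrix_posSemidef H _) ?_ i
  rw [det_kerMatrix_extend hL.svd hL.val_pos]
  exact (mul_pos hL.det_pos hα).ne'

theorem mem_of_extend (hb : ∀ i, L.basis i ∈ X) {x : Pt d} (hx : x ∈ X) (i) :
    extend L.basis x i ∈ X := by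
  refine Fin.lastCases ?_ (fun i => ?_) i
  · simpa using hx
  · simpa using hb i

/-- Everything rests on `G' Q = G`, whichever SVD of the new kernel matrix is taken. -/
theorem Learner.Valid.extendsTo (hL : L.Valid H) (hψ : Represents H ψ X)
    (hb : ∀ i, L.basis i ∈ X) (hμ : 0 < P.μ) {x : Pt d} (hx : x ∈ X)
    (hα : 0 < aldError H L.basis x) {w : Fin L.size → ℝ} {M : Learner d}
    (hM : IsExtension H P L x w M) : L.ExtendsTo H P ψ w M := by
  obtain ⟨V, σ, Q, hsvd, hQ, rfl⟩ := hM
  have hσ := val_pos_of_extend hL hα hsvd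
  have hb' := mem_of_extend hb hx
  have hsub : ∀ i, ∃ j, L.basis i = extend L.basis x j := fun i => ⟨i.castSucc, by simp⟩
  have hQQ : Qᵀ * Q = 1 := hQ ▸ transfer_isometry hψ hL hb hb' hsub hsvd hσ
  have hGQ : embed ψ (extend L.basis x) V σ * Q = L.emb ψ := by
    rw [hQ, hψ.transfer_eq hb hb', hψ.embed_projection_embed hb' hsvd hσ hsub]
    rfl
  refine ⟨⟨hsvd, hσ, liftCov_posDef hQQ hL.cov_posDef hμ⟩, ?_, ?_⟩
  · rw [← hGQ, ← liftCov_liftCov]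
    rfl
  · rw [← hGQ, ← mulVec_mulVec]
    rfl

/-- One step of the projected online Newton method in `ℝᴺ`. The prediction uses the vector `q`, a
projection of the instance `z`. -/
def NewtonRound (P : Params) (z : Fin N → ℝ) (y yhat : ℝ) (A A' : Matrix (Fin N) (Fin N) ℝ)
    (v v' : Fin N → ℝ) : Prop :=
  ∃ w q : Fin N → ℝ,
    (∀ F : Fin N → ℝ, F ⬝ᵥ F ≤ P.U ^ 2 →
      (w - F) ⬝ᵥ (A *ᵥ (w - F)) ≤ (v - F) ⬝ᵥ (A *ᵥ (v - F))) ∧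
    q ⬝ᵥ q ≤ 1 ∧ (z - q) ⬝ᵥ (z - q) ≤ P.α ∧ |yhat| ≤ P.U ∧ yhat = w ⬝ᵥ q ∧
    A' = A + P.η • vecMulVec ((2 * (yhat - y)) • q) ((2 * (yhat - y)) • q) ∧
    A' *ᵥ (w - v') = (2 * (yhat - y)) • q

theorem Learner.Valid.newton (hL : L.Valid H) (hη : 0 ≤ P.η) (x : Pt d) (y : ℝ) :
    (L.newton H P x y).Valid H :=
  ⟨hL.svd, hL.val_pos, posDef_add_rankOne hL.cov_posDef hη _⟩

/-- The step is recorded as `A' (w - w') = ∇` rather than with `A'⁻¹`: this form passes to `ℝᴺ`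
because the lift acts as `A'` on the range of `G`. -/
theorem Learner.Valid.newton_lift (hL : L.Valid H) (hψ : Represents H ψ X)
    (hb : ∀ i, L.basis i ∈ X) (hη : 0 ≤ P.η) (x : Pt d) (y : ℝ) :
    liftCov P.μ ((L.newton H P x y).emb ψ) (L.newton H P x y).cov =
      liftCov P.μ (L.emb ψ) L.cov +
        P.η • vecMulVec (L.emb ψ *ᵥ L.grad H x y) (L.emb ψ *ᵥ L.grad H x y) ∧
    liftCov P.μ ((L.newton H P x y).emb ψ) (L.newton H P x y).cov *ᵥ
      (L.emb ψ *ᵥ L.wt - (L.newton H P x y).emb ψ *ᵥ (L.newton H P x y).wt) =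
      L.emb ψ *ᵥ L.grad H x y := by
  have hG := hL.emb_isometry hψ hb
  refine ⟨liftCov_add_rankOne _ _, ?_⟩
  have hdet := (posDef_add_rankOne hL.cov_posDef hη (L.grad H x y)).det_pos
  change liftCov P.μ (L.emb ψ) (L.cov + P.η • vecMulVec (L.grad H x y) (L.grad H x y)) *ᵥ
    (L.emb ψ *ᵥ L.wt - L.emb ψ *ᵥ (L.wt -
      (L.cov + P.η • vecMulVec (L.grad H x y) (L.grad H x y))⁻¹ *ᵥ L.grad H x y)) = _
  rw [← mulVec_sub, sub_sub_cancel, liftCov_mulVec_range hG, mulVec_mulVec _ _ (_⁻¹),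
    mul_nonsing_inv _ (isUnit_iff_ne_zero.mpr hdet.ne'), one_mulVec]

theorem phi_dotProduct_self_le (hψ : Represents H ψ X) (hL : L.Valid H) (hb : ∀ i, L.basis i ∈ X)
    {x : Pt d} (hx : x ∈ X) (hone : ker H x x = 1) : L.phi H x ⬝ᵥ L.phi H x ≤ 1 := by
  rw [← Learner.emb_transpose_mulVec hψ hb hx, ← hone, ← hψ x hx x hx]
  exact dotProduct_transpose_mulVec_le (hL.emb_isometry hψ hb) _

/-- A learner with new weights. -/
theorem Learner.Valid.withWt (hL : L.Valid H) (w : Fin L.size → ℝ) :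
    Learner.Valid H { L with wt := w } := ⟨hL.svd, hL.val_pos, hL.cov_posDef⟩

theorem aldError_buffer_eq_zero (hψ : Represents H ψ X) {n : ℕ} {b : Fin n → Pt d}
    {V : Matrix (Fin n) (Fin n) ℝ} {σ : Fin n → ℝ} (hb : ∀ i, b i ∈ X)
    (hsvd : IsSVD (kerMatrix H b) V σ) (hσ : ∀ i, 0 < σ i) (i : Fin n) :
    aldError H b (b i) = 0 := by
  rw [aldError_eq hsvd hσ, ← hψ.embed_transpose_mulVec hb (hb i), ← hψ _ (hb i) _ (hb i),
    ← dotProduct_mulVec_transpose, hψ.embed_projection_point hb hsvd hσ, sub_self]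

/-- The reduction to a fixed space: neither the buffer nor the choice of SVD appears in
`NewtonRound`, so consecutive rounds fit together across extensions. -/
theorem IsRound.newtonRound {x : Pt d} {y yhat : ℝ} {L' : Learner d}
    (hr : IsRound H P L x y yhat L') (hL : L.Valid H) (hψ : Represents H ψ X)
    (hb : ∀ i, L.basis i ∈ X) (hx : x ∈ X) (hone : ker H x x = 1) (hμ : 0 < P.μ) (hα : 0 < P.α)
    (hU : 0 ≤ P.U) (hη : 0 ≤ P.η) :
    L'.Valid H ∧ (∀ i, L'.basis i ∈ X) ∧
      NewtonRound P (ψ x) y yhat (liftCov P.μ (L.emb ψ) L.cov) (liftCov P.μ (L'.emb ψ) L'.cov)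
        (L.emb ψ *ᵥ L.wt) (L'.emb ψ *ᵥ L'.wt) := by
  obtain ⟨w, M, ⟨hw, hmin⟩, hM, hyhat, rfl⟩ := hr
  have hG := hL.emb_isometry hψ hb
  have hproj : ∀ F : Fin N → ℝ, F ⬝ᵥ F ≤ P.U ^ 2 →
      (L.emb ψ *ᵥ w - F) ⬝ᵥ (liftCov P.μ (L.emb ψ) L.cov *ᵥ (L.emb ψ *ᵥ w - F)) ≤
      (L.emb ψ *ᵥ L.wt - F) ⬝ᵥ (liftCov P.μ (L.emb ψ) L.cov *ᵥ (L.emb ψ *ᵥ L.wt - F)) := by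
    intro F hF
    -- A competitor of norm at most `U` lies in the slab of every round, since explicit features
    -- have norm at most `1`.
    refine liftCov_projection_le hG hL.cov_posDef hw hmin ?_
    refine (abs_dotProduct_le hU zero_le_one hF ?_).trans (mul_one _).le
    rw [dotProduct_range hG, one_pow]
    exact phi_dotProduct_self_le hψ hL hb hx hone
  -- the buffer after the possible extension
  have hmid : M.Valid H ∧ (∀ i, M.basis i ∈ X) ∧
      liftCov P.μ (M.emb ψ) M.cov = liftCov P.μ (L.emb ψ) L.cov ∧
      M.emb ψ *ᵥ M.wt = L.emb ψ *ᵥ w ∧ aldError H M.basis x ≤ P.α ∧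
      M.wt ⬝ᵥ M.phi H x = w ⬝ᵥ L.phi H x := by
    rcases hM with ⟨hle, rfl⟩ | ⟨hlt, hext⟩
    · exact ⟨hL.withWt w, hb, rfl, rfl, hle, rfl⟩
    · have he := hL.extendsTo hψ hb hμ hx (hα.trans hlt) hext
      have hMb : ∀ i, M.basis i ∈ X := by
        obtain ⟨V, σ, Q, -, -, rfl⟩ := hext
        exact mem_of_extend hb hx
      have hlast : ∃ i, M.basis i = x := by
        obtain ⟨V, σ, Q, -, -, rfl⟩ := hext
        exact ⟨Fin.last _, extend_last _ _⟩
      refine ⟨he.valid, hMb, he.cov, he.wt, ?_, ?_⟩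
      · obtain ⟨i, hi⟩ := hlast
        have := aldError_buffer_eq_zero hψ hMb he.valid.svd he.valid.val_pos i
        rw [hi] at this
        rw [this]
        exact hα.le
      -- Both predictions are the inner product of `ψ x` with the same lifted weights. So the bound
      -- `U`, imposed with the old feature, survives the extension.
      · rw [← Learner.emb_transpose_mulVec hψ hMb hx, ← Learner.emb_transpose_mulVec hψ hb hx,
          ← dotProduct_mulVec_transpose, ← dotProduct_mulVec_transpose, he.wt]
  obtain ⟨hMv, hMb, hcov, hwt, herr, hpred⟩ := hmid
  have hGM := hMv.emb_isometry hψ hMb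
  obtain ⟨hA, hstep⟩ := hMv.newton_lift hψ hMb hη (P := P) x y
  have hgrad : M.emb ψ *ᵥ M.grad H x y = (2 * (yhat - y)) • (M.emb ψ *ᵥ M.phi H x) := by
    rw [Learner.grad, mulVec_smul, hyhat]
  refine ⟨hMv.newton hη x y, hMb, L.emb ψ *ᵥ w, M.emb ψ *ᵥ M.phi H x, hproj, ?_, ?_, ?_, ?_, ?_, ?_⟩
  · rw [dotProduct_range hGM]
    exact phi_dotProduct_self_le hψ hMv hMb hx hone
  · rw [hMv.dist_projection hψ hMb hx]
    exact herr
  · rw [hyhat, hpred]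
    exact hw
  · rw [hyhat, ← hwt, dotProduct_range hGM]
  · rw [hA, hcov, hgrad]
  · rw [← hwt, ← hgrad]
    exact hstep

end

end Rounds

/-! ## The regret of the projected online Newton method -/

section Newton

variable {N : ℕ} {P : Params}

theorem NewtonRound.posDef {z : Fin N → ℝ} {y yhat : ℝ} {A A' : Matrix (Fin N) (Fin N) ℝ}
    {v v' : Fin N → ℝ} (h : NewtonRound P z y yhat A A' v v') (hη : 0 ≤ P.η) (hA : A.PosDef) :
    A'.PosDef := by
  obtain ⟨w, q, -, -, -, -, -, rfl, -⟩ := h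
  exact posDef_add_rankOne hA hη _

theorem sq_sub_le_two_mul {U Y a y : ℝ} (ha : |a| ≤ U) (hy : |y| ≤ Y) :
    (a - y) ^ 2 ≤ 2 * (U ^ 2 + Y ^ 2) := by
  have h1 := sq_le_sq' (abs_le.mp ha).1 (abs_le.mp ha).2
  have h2 := sq_le_sq' (abs_le.mp hy).1 (abs_le.mp hy).2
  nlinarith [sq_nonneg (a + y)]

/-- The constant `4` is `2 · 2`: the choice of `η` gives `η (2 (ŷ - y))² ≤ 2`, and `q_i² ≤ 2 z_i² +
2 e_i²` for `e = z - q`. -/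
theorem NewtonRound.diag_le {z : Fin N → ℝ} {y yhat Y : ℝ} {A A' : Matrix (Fin N) (Fin N) ℝ}
    {v v' : Fin N → ℝ} (h : NewtonRound P z y yhat A A' v v') (hη : 0 ≤ P.η)
    (hηU : P.η * (4 * (P.U ^ 2 + Y ^ 2)) ≤ 1) (hy : |y| ≤ Y) :
    ∃ e : Fin N → ℝ, e ⬝ᵥ e ≤ P.α ∧ ∀ i, A' i i ≤ A i i + 4 * z i ^ 2 + 4 * e i ^ 2 := by
  obtain ⟨w, q, -, -, hzq, hyh, -, rfl, -⟩ := h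
  refine ⟨z - q, hzq, fun i => ?_⟩
  have h1 := sq_sub_le_two_mul hyh hy
  have h2 : P.η * (2 * (yhat - y)) ^ 2 ≤ 2 := by nlinarith
  have h3 : q i ^ 2 ≤ 2 * z i ^ 2 + 2 * (z - q) i ^ 2 := by
    simp only [Pi.sub_apply]
    nlinarith [sq_nonneg (2 * z i - q i)]
  have h4 := mul_le_mul_of_nonneg_right h2 (sq_nonneg (q i))
  simp only [Matrix.add_apply, Matrix.smul_apply, vecMulVec_apply, Pi.smul_apply, smul_eq_mul]
  nlinarith

/-- One round of the regret bound. -/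
theorem NewtonRound.regret_le {z : Fin N → ℝ} {y yhat Y : ℝ} {A A' : Matrix (Fin N) (Fin N) ℝ}
    {v v' : Fin N → ℝ} (h : NewtonRound P z y yhat A A' v v') (hA : A.PosDef) (hη : 0 < P.η)
    (hU : 0 ≤ P.U) (hηU : P.η * (4 * (P.U ^ 2 + Y ^ 2)) ≤ 1) (hy : |y| ≤ Y) (hα : 0 ≤ P.α)
    (hz : z ⬝ᵥ z = 1) {F : Fin N → ℝ} (hF : F ⬝ᵥ F ≤ P.U ^ 2) :
    2 * ((yhat - y) ^ 2 - (F ⬝ᵥ z - y) ^ 2) ≤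
      (v - F) ⬝ᵥ (A *ᵥ (v - F)) - (v' - F) ⬝ᵥ (A' *ᵥ (v' - F)) +
        (Real.log A'.det - Real.log A.det) / P.η +
        2 * (2 * P.U * (P.U + Y) * Real.sqrt P.α) := by
  have hA' := h.posDef hη.le hA
  obtain ⟨w, q, hproj, hq, hzq, hyh, hpred, hAA, hstep⟩ := h
  set g : Fin N → ℝ := (2 * (yhat - y)) • q with hg
  have hp := hproj F hF
  set a := w - F with ha
  have hlog : P.η * (g ⬝ᵥ (w - v')) ≤ Real.log A'.det - Real.log A.det := by
    rw [hAA] at hstep ⊢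
    exact quad_rankOne_le_log_det hA hη.le hstep
  have hs := transpose_eq_of_posDef hA'
  have h1 : (v' - F) ⬝ᵥ (A' *ᵥ (v' - F)) =
      a ⬝ᵥ (A' *ᵥ a) - 2 * (g ⬝ᵥ a) + g ⬝ᵥ (w - v') := by
    have : v' - F = a - (w - v') := by rw [ha]; abel
    rw [this, quad_sub hs, dotProduct_mulVec_comm hs (w - v') a, hstep, dotProduct_comm a g,
      dotProduct_comm (w - v') g]
  have h2 : a ⬝ᵥ (A' *ᵥ a) = a ⬝ᵥ (A *ᵥ a) + P.η * (g ⬝ᵥ a) ^ 2 := by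
    rw [hAA, add_mulVec, smul_mulVec, vecMulVec_mulVec', dotProduct_add, dotProduct_smul,
      dotProduct_smul, dotProduct_comm a g, smul_eq_mul, smul_eq_mul]
    ring
  have h3 : g ⬝ᵥ (w - v') ≤ (Real.log A'.det - Real.log A.det) / P.η := by
    rw [le_div_iff₀ hη]
    linarith
  have h4 : g ⬝ᵥ a = 2 * (yhat - y) * (yhat - F ⬝ᵥ q) := by
    rw [hg, smul_dotProduct, ha, dotProduct_sub, dotProduct_comm q w, ← hpred,
      dotProduct_comm q F, smul_eq_mul]
  -- The value of `η` enters here: the second-order term is at most twice the curvature gap `(ŷ - F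
  -- · q)²` of `h10`. This is why the bound is for twice the regret.
  have h5 : P.η * (g ⬝ᵥ a) ^ 2 ≤ 2 * (yhat - F ⬝ᵥ q) ^ 2 := by
    have h6 := sq_sub_le_two_mul hyh hy
    have h7 : P.η * (2 * (yhat - y)) ^ 2 ≤ 2 := by nlinarith
    have h8 := mul_le_mul_of_nonneg_right h7 (sq_nonneg (yhat - F ⬝ᵥ q))
    rw [h4]
    nlinarith
  have hsq : Real.sqrt P.α ^ 2 = P.α := Real.sq_sqrt hα
  have hdiff : |F ⬝ᵥ (z - q)| ≤ P.U * Real.sqrt P.α :=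
    abs_dotProduct_le hU (Real.sqrt_nonneg _) hF (hsq.symm ▸ hzq)
  have hFz : |F ⬝ᵥ z| ≤ P.U :=
    (abs_dotProduct_le hU zero_le_one hF (by rw [hz, one_pow])).trans (mul_one _).le
  have hFq : |F ⬝ᵥ q| ≤ P.U :=
    (abs_dotProduct_le hU zero_le_one hF (by rwa [one_pow])).trans (mul_one _).le
  -- The price of evaluating the competitor at `q` instead of `z`: the square loss is Lipschitz on
  -- bounded values.
  have h9 : (F ⬝ᵥ q - y) ^ 2 - (F ⬝ᵥ z - y) ^ 2 ≤ 2 * P.U * (P.U + Y) * Real.sqrt P.α := by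
    have e : (F ⬝ᵥ q - y) ^ 2 - (F ⬝ᵥ z - y) ^ 2 =
        -(F ⬝ᵥ (z - q)) * (F ⬝ᵥ q + F ⬝ᵥ z - 2 * y) := by
      rw [dotProduct_sub]; ring
    have hb : |F ⬝ᵥ q + F ⬝ᵥ z - 2 * y| ≤ 2 * (P.U + Y) := by
      rw [abs_le] at *
      constructor <;> linarith
    calc _ ≤ |-(F ⬝ᵥ (z - q)) * (F ⬝ᵥ q + F ⬝ᵥ z - 2 * y)| := e ▸ le_abs_self _
      _ = |F ⬝ᵥ (z - q)| * |F ⬝ᵥ q + F ⬝ᵥ z - 2 * y| := by rw [abs_mul, abs_neg]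
      _ ≤ (P.U * Real.sqrt P.α) * (2 * (P.U + Y)) :=
          mul_le_mul hdiff hb (abs_nonneg _) (mul_nonneg hU (Real.sqrt_nonneg _))
      _ = _ := by ring
  have h10 : (yhat - y) ^ 2 - (F ⬝ᵥ q - y) ^ 2 =
      g ⬝ᵥ a - (yhat - F ⬝ᵥ q) ^ 2 := by rw [h4]; ring
  linarith

theorem newton_regret_le {T : ℕ} {z : ℕ → Fin N → ℝ} {y yhat : ℕ → ℝ} {Y : ℝ}
    {A : ℕ → Matrix (Fin N) (Fin N) ℝ} {v : ℕ → Fin N → ℝ}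
    (hr : ∀ t < T, NewtonRound P (z t) (y t) (yhat t) (A t) (A (t + 1)) (v t) (v (t + 1)))
    (hA0 : A 0 = P.μ • 1) (hv0 : v 0 = 0) (hμ : 0 < P.μ) (hη : 0 < P.η) (hU : 0 ≤ P.U)
    (hηU : P.η * (4 * (P.U ^ 2 + Y ^ 2)) ≤ 1) (hy : ∀ t < T, |y t| ≤ Y) (hα : 0 ≤ P.α)
    (hz : ∀ t < T, z t ⬝ᵥ z t = 1) {lam : Fin N → ℝ}
    (hlam : ∀ i, ∑ t ∈ Finset.range T, z t i ^ 2 ≤ lam i)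
    {F : Fin N → ℝ} (hF : F ⬝ᵥ F ≤ P.U ^ 2) :
    2 * ∑ t ∈ Finset.range T, ((yhat t - y t) ^ 2 - (F ⬝ᵥ z t - y t) ^ 2) ≤
      P.μ * P.U ^ 2 + (∑ i, Real.log (1 + 4 * lam i / P.μ) + 4 * (T * P.α) / P.μ) / P.η +
        T * (2 * (2 * P.U * (P.U + Y) * Real.sqrt P.α)) := by
  have hpd0 : (A 0).PosDef := hA0 ▸ PosDef.smul PosDef.one hμ
  have hpd : ∀ t ≤ T, (A t).PosDef := by
    intro t ht
    induction t with
    | zero => exact hpd0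
    | succ t ih => exact (hr t ht).posDef hη.le (ih (by omega))
  have hsum : ∀ t ≤ T, 2 * ∑ s ∈ Finset.range t, ((yhat s - y s) ^ 2 - (F ⬝ᵥ z s - y s) ^ 2) ≤
      (v 0 - F) ⬝ᵥ (A 0 *ᵥ (v 0 - F)) - (v t - F) ⬝ᵥ (A t *ᵥ (v t - F)) +
        (Real.log (A t).det - Real.log (A 0).det) / P.η +
        t * (2 * (2 * P.U * (P.U + Y) * Real.sqrt P.α)) := by
    intro t ht
    induction t with
    | zero => simp
    | succ t ih =>
      have h1 := ih (by omega)
      have h2 := (hr t ht).regret_le (hpd t (by omega)) hη hU hηU (hy t ht) hα (hz t ht) hF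
      rw [Finset.sum_range_succ, mul_add]
      push_cast
      have h3 : (Real.log (A (t + 1)).det - Real.log (A 0).det) / P.η =
          (Real.log (A t).det - Real.log (A 0).det) / P.η +
            (Real.log (A (t + 1)).det - Real.log (A t).det) / P.η := by ring
      rw [h3]
      linarith
  have herr : ∃ e : ℕ → Fin N → ℝ, (∀ t < T, e t ⬝ᵥ e t ≤ P.α) ∧
      ∀ t < T, ∀ i, A (t + 1) i i ≤ A t i i + 4 * z t i ^ 2 + 4 * e t i ^ 2 := by
    have : ∀ t, ∃ e : Fin N → ℝ, t < T → e ⬝ᵥ e ≤ P.α ∧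
        ∀ i, A (t + 1) i i ≤ A t i i + 4 * z t i ^ 2 + 4 * e i ^ 2 := by
      intro t
      by_cases ht : t < T
      · obtain ⟨e, he⟩ := (hr t ht).diag_le hη.le hηU (hy t ht)
        exact ⟨e, fun _ => he⟩
      · exact ⟨0, fun h => absurd h ht⟩
    choose e he using this
    exact ⟨e, fun t ht => (he t ht).1, fun t ht => (he t ht).2⟩
  obtain ⟨e, he, hdiag⟩ := herr
  have hdiagT : ∀ i, A T i i ≤ P.μ + 4 * lam i + 4 * ∑ t ∈ Finset.range T, e t i ^ 2 := by
    intro i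
    have : ∀ t ≤ T, A t i i ≤ P.μ + 4 * (∑ s ∈ Finset.range t, z s i ^ 2) +
        4 * ∑ s ∈ Finset.range t, e s i ^ 2 := by
      intro t ht
      induction t with
      | zero => simp [hA0]
      | succ t ih =>
        have h1 := ih (by omega)
        have h2 := hdiag t ht i
        rw [Finset.sum_range_succ, Finset.sum_range_succ]
        linarith
    have h1 := this T le_rfl
    have h2 := hlam i
    linarith
  have hlam0 : ∀ i, 0 ≤ lam i := fun i =>
    (Finset.sum_nonneg fun t _ => sq_nonneg (z t i)).trans (hlam i)
  set ε : Fin N → ℝ := fun i => ∑ t ∈ Finset.range T, e t i ^ 2 with hε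
  have hε0 : ∀ i, 0 ≤ ε i := fun i => Finset.sum_nonneg fun t _ => sq_nonneg _
  have hεsum : ∑ i, ε i ≤ T * P.α := by
    rw [hε, Finset.sum_comm]
    calc ∑ t ∈ Finset.range T, ∑ i, e t i ^ 2 ≤ ∑ t ∈ Finset.range T, P.α :=
          Finset.sum_le_sum fun t ht => by
            have := he t (Finset.mem_range.mp ht)
            simpa [dotProduct, sq] using this
      _ = T * P.α := by simp
  have hlogA : ∀ i, Real.log (A T i i) ≤
      Real.log P.μ + (Real.log (1 + 4 * lam i / P.μ) + 4 * ε i / P.μ) := by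
    intro i
    have hx : 0 < 1 + 4 * lam i / P.μ := by
      have := hlam0 i
      positivity
    have hy' : 0 < 1 + 4 * ε i / P.μ := by
      have := hε0 i
      positivity
    -- The product separates the spectrum from the projection errors, whose logarithms are bounded
    -- linearly and sum to at most `4 T α / μ`.
    have hle : A T i i ≤ P.μ * ((1 + 4 * lam i / P.μ) * (1 + 4 * ε i / P.μ)) := by
      refine (hdiagT i).trans ?_
      have h1 : P.μ * ((1 + 4 * lam i / P.μ) * (1 + 4 * ε i / P.μ)) =
          P.μ + 4 * lam i + 4 * ε i + 16 * (lam i * ε i) / P.μ := by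
        field_simp; ring
      have h2 : 0 ≤ 16 * (lam i * ε i) / P.μ := by
        have := mul_nonneg (hlam0 i) (hε0 i)
        positivity
      rw [h1]
      linarith
    have h3 := Real.log_le_log (hpd T le_rfl).diag_pos hle
    rw [Real.log_mul hμ.ne' (mul_pos hx hy').ne', Real.log_mul hx.ne' hy'.ne'] at h3
    have h4 := Real.log_le_sub_one_of_pos hy'
    linarith
  have hdet0 : Real.log (A 0).det = N * Real.log P.μ := by
    rw [hA0, det_smul, det_one, mul_one, Fintype.card_fin, Real.log_pow]
  have hdetT : Real.log (A T).det - Real.log (A 0).det ≤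
      ∑ i, Real.log (1 + 4 * lam i / P.μ) + 4 * (T * P.α) / P.μ := by
    have h1 := (log_det_le_sum_log_diag (hpd T le_rfl)).trans
      (Finset.sum_le_sum fun i _ => hlogA i)
    rw [Finset.sum_add_distrib, Finset.sum_add_distrib, Finset.sum_const, Finset.card_univ,
      Fintype.card_fin, nsmul_eq_mul, ← Finset.sum_div, ← Finset.mul_sum] at h1
    have h2 : 4 * ∑ i, ε i ≤ 4 * (T * P.α) := by linarith
    have h3 := div_le_div_of_nonneg_right h2 hμ.le
    rw [hdet0]
    linarith
  have hstart : (v 0 - F) ⬝ᵥ (A 0 *ᵥ (v 0 - F)) ≤ P.μ * P.U ^ 2 := by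
    rw [hv0, hA0, zero_sub, smul_mulVec, one_mulVec, dotProduct_smul, neg_dotProduct,
      dotProduct_neg, neg_neg, smul_eq_mul]
    exact mul_le_mul_of_nonneg_left hF hμ.le
  have hend := quad_nonneg (hpd T le_rfl).posSemidef (v T - F)
  have hfin := hsum T le_rfl
  have hdiv := div_le_div_of_nonneg_right hdetT hη.le
  linarith

end Newton

/-! ## The spectral embedding of a sample -/

section Sample

variable {d T : ℕ} (H : Type u) [NormedAddCommGroup H] [InnerProductSpace ℝ H] [CompleteSpace H]
  [RKHS ℝ H (Pt d) ℝ]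

/-- Spectral embedding of the points `x_0, …, x_{T-1}`: the coordinates are orthogonal, and their
squared norms are the eigenvalues of the kernel matrix. -/
theorem exists_represents (x : ℕ → Pt d) {V : Matrix (Fin T) (Fin T) ℝ} {lam : Fin T → ℝ}
    (h : IsSVD (kerMatrix H fun i : Fin T => x i) V lam) :
    ∃ ψ : Pt d → Fin T → ℝ, Represents H ψ {z | ∃ t < T, z = x t} ∧
      ∀ i, ∑ t ∈ Finset.range T, ψ (x t) i ^ 2 = lam i := by
  have h0 := h.nonneg (kerMatrix_posSemidef H _)
  let D : Matrix (Fin T) (Fin T) ℝ := diagonal fun i => Real.sqrt (lam i)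
  have hDD : D * D = diagonal lam := by
    simp only [D, diagonal_mul_diagonal, Real.mul_self_sqrt (h0 _)]
  -- Sample points may repeat, so `ψ` must depend on the point and not on its index. On the sample
  -- it is row `t` of `V diag(√lam)`.
  let ψ : Pt d → Fin T → ℝ := fun z => halfCoef V lam *ᵥ fun i => ker H (x i) z
  have hψ : ∀ t : Fin T, ψ (x t) = (V * D) t := by
    intro t
    have hk : (fun i : Fin T => ker H (x i) (x t)) = (kerMatrix H fun i : Fin T => x i) *ᵥ
        Pi.single t 1 := by
      ext i; simp [kerMatrix]
    have hm : halfCoef V lam * (kerMatrix H fun i : Fin T => x i) = D * Vᵀ := by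
      conv_lhs => rw [h.2, halfCoef]
      rw [Matrix.mul_assoc, ← Matrix.mul_assoc Vᵀ, ← Matrix.mul_assoc Vᵀ, h.1, Matrix.one_mul,
        ← Matrix.mul_assoc, diagonal_mul_diagonal]
      congr 2
      ext i
      -- The full kernel matrix may be singular; the convention `0⁻¹ = 0` makes the coordinates of
      -- its null directions vanish.
      by_cases hi : lam i = 0
      · simp [hi]
      · have h1 := Real.sqrt_pos.mpr (lt_of_le_of_ne (h0 i) (Ne.symm hi))
        have h2 := Real.mul_self_sqrt (h0 i)
        field_simp
        nlinarith
    simp only [ψ]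
    rw [hk, mulVec_mulVec, hm]
    ext i
    simp [D, mul_comm]
  refine ⟨ψ, ?_, ?_⟩
  · rintro _ ⟨s, hs, rfl⟩ _ ⟨t, ht, rfl⟩
    have h1 := hψ ⟨s, hs⟩
    have h2 := hψ ⟨t, ht⟩
    simp only at h1 h2
    have h3 : (V * D) * (V * D)ᵀ = kerMatrix H fun i : Fin T => x i := by
      rw [transpose_mul, diagonal_transpose, Matrix.mul_assoc, ← Matrix.mul_assoc D, hDD,
        ← Matrix.mul_assoc, ← h.2]
    have h4 := congrFun (congrFun h3 ⟨s, hs⟩) ⟨t, ht⟩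
    rw [h1, h2]
    exact h4
  · intro i
    have h3 : (V * D)ᵀ * (V * D) = diagonal lam := by
      rw [transpose_mul, diagonal_transpose, Matrix.mul_assoc, ← Matrix.mul_assoc Vᵀ, h.1,
        Matrix.one_mul, hDD]
    have h4 := congrFun (congrFun h3 i) i
    rw [diagonal_apply_eq] at h4
    rw [← h4, Finset.sum_range]
    simp only [hψ]
    rw [mul_apply]
    exact Finset.sum_congr rfl fun t _ => by rw [transpose_apply, sq]

variable {H}

theorem inner_feat (f : H) (x : Pt d) : inner ℝ f (feat H x) = f x := by
  simp [feat]

/-- A function of the RKHS acts on the sample as a vector of no larger norm. -/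
theorem Represents.exists_vector {x : ℕ → Pt d} {N : ℕ} {ψ : Pt d → Fin N → ℝ}
    (hψ : Represents H ψ {z | ∃ t < T, z = x t}) (f : H) :
    ∃ F : Fin N → ℝ, F ⬝ᵥ F ≤ ‖f‖ ^ 2 ∧ ∀ t < T, F ⬝ᵥ ψ (x t) = f (x t) := by
  let b : Fin T → Pt d := fun i => x i
  let S : Submodule ℝ H := Submodule.span ℝ (Set.range fun i => feat H (b i))
  have hfin : FiniteDimensional ℝ S := FiniteDimensional.span_of_finite ℝ (Set.finite_range _)
  have hb : ∀ i, b i ∈ {z | ∃ t < T, z = x t} := fun i => ⟨i, i.2, rfl⟩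
  -- `β` expresses the projection of `f` onto the span of the sample features. This projection keeps
  -- the values of `f` on the sample and does not increase the norm.
  obtain ⟨β, hβ⟩ := (Submodule.mem_span_range_iff_exists_fun ℝ).mp
    (S.starProjection_apply_mem f)
  set R : Matrix (Fin T) (Fin N) ℝ := Matrix.of fun i => ψ (b i) with hR
  have hK : R * Rᵀ = kerMatrix H b := hψ.of_mul_transpose hb hb
  refine ⟨Rᵀ *ᵥ β, ?_, fun t ht => ?_⟩
  · rw [dotProduct_mulVec_transpose, transpose_transpose, mulVec_mulVec, hK, ← norm_sum_feat_sq, hβ]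
    have := S.norm_starProjection_apply_le f
    gcongr
  · have hx : x t = b ⟨t, ht⟩ := rfl
    rw [dotProduct_mulVec_transpose, transpose_transpose]
    have h1 : R *ᵥ ψ (x t) = fun i => ker H (b i) (x t) := by
      ext i
      exact hψ _ (hb i) _ ⟨t, ht, rfl⟩
    rw [h1, ← inner_sum_feat, hβ, ← inner_feat f, Submodule.inner_starProjection_left_eq_right,
      Submodule.starProjection_eq_self_iff.mpr]
    exact Submodule.subset_span ⟨⟨t, ht⟩, rfl⟩

end Sample

/-! ## Effective dimension under polynomial decay -/

/-- The balance behind the choice of `μ`: for `M = T^{1/(1+p)}`, the ratio `T i^{-p} / M = (M /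
i)^p` crosses `1` at `i = M`. -/
theorem rpow_one_div_one_add_eq {T p : ℝ} (hT : 0 < T) (hp : 1 ≤ p) :
    T / T ^ (1 / (1 + p)) = (T ^ (1 / (1 + p))) ^ p := by
  rw [← Real.rpow_mul hT.le]
  nth_rewrite 1 [← Real.rpow_one T]
  rw [← Real.rpow_sub hT]
  congr 1
  have : (1 + p) ≠ 0 := by linarith
  field_simp
  ring

/-- With `M` the power of `T` and `i` counted from `1`, `4 λ_i / M ≤ 4 c (M / i)^p`. At most `M`
indices have `i ≤ M`, each costing `O(log T)`. For `i > M`, `log (1 + s) ≤ s` and `(M / i)^p ≤ M /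
i` (as `p ≥ 1`) leave a harmonic sum. -/
theorem sum_log_polyDecay_le {p c R₀ : ℝ} (hp : 1 ≤ p) (hc : 0 < c) {T : ℕ} (hT : 1 ≤ T)
    (hR : R₀ ≤ c * T) {lam : Fin T → ℝ} (h0 : ∀ i, 0 ≤ lam i)
    (hlam : ∀ i : Fin T, lam i ≤ R₀ * ((i : ℕ) + 1 : ℝ) ^ (-p)) :
    ∑ i, Real.log (1 + 4 * lam i / (T : ℝ) ^ (1 / (1 + p))) ≤
      (T : ℝ) ^ (1 / (1 + p)) *
        (Real.log (1 + 4 * c) + Real.log T + 4 * c * (1 + Real.log T)) := by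
  have hT' : (1 : ℝ) ≤ T := by exact_mod_cast hT
  have hT0 : (0 : ℝ) < T := by linarith
  set M : ℝ := (T : ℝ) ^ (1 / (1 + p)) with hM
  have hM1 : 1 ≤ M := Real.one_le_rpow hT' (by positivity)
  have hM0 : 0 < M := by linarith
  have hTM : T / M = M ^ p := rpow_one_div_one_add_eq hT0 hp
  have hMpT : M ^ p ≤ T := by
    rw [← hTM]
    exact div_le_self hT0.le hM1
  set B : ℝ := Real.log (1 + 4 * c) + Real.log T with hB
  have hB0 : 0 ≤ B := add_nonneg (Real.log_nonneg (by linarith)) (Real.log_nonneg hT')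
  have hterm : ∀ i : Fin T, Real.log (1 + 4 * lam i / M) ≤
      (if ((i : ℕ) + 1 : ℝ) ≤ M then B else 0) + 4 * c * M * (((i : ℕ) + 1 : ℕ) : ℝ)⁻¹ := by
    intro i
    have hk : (0 : ℝ) < (i : ℕ) + 1 := by positivity
    have hk1 : (1 : ℝ) ≤ (i : ℕ) + 1 := by linarith [Nat.cast_nonneg (α := ℝ) (i : ℕ)]
    have hl0 : 0 ≤ 4 * lam i / M := by have := h0 i; positivity
    have h1 : 4 * lam i / M ≤ 4 * c * (M / ((i : ℕ) + 1)) ^ p := by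
      calc 4 * lam i / M ≤ 4 * (c * T * ((i : ℕ) + 1 : ℝ) ^ (-p)) / M := by
            have := (hlam i).trans (mul_le_mul_of_nonneg_right hR (Real.rpow_nonneg hk.le (-p)))
            gcongr
        _ = 4 * c * ((T / M) * ((i : ℕ) + 1 : ℝ) ^ (-p)) := by ring
        _ = 4 * c * (M / ((i : ℕ) + 1)) ^ p := by
            rw [hTM, Real.div_rpow hM0.le hk.le, Real.rpow_neg hk.le, div_eq_mul_inv]
    have hpos2 : 0 ≤ 4 * c * M * (((i : ℕ) + 1 : ℕ) : ℝ)⁻¹ := by positivity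
    split_ifs with hle
    · have h2 : (M / ((i : ℕ) + 1)) ^ p ≤ T :=
        (Real.rpow_le_rpow (by positivity) (div_le_self hM0.le hk1) (by linarith)).trans hMpT
      have h3 : 1 + 4 * lam i / M ≤ (1 + 4 * c) * T := by nlinarith
      have h4 := Real.log_le_log (by linarith) h3
      rw [Real.log_mul (by positivity) hT0.ne'] at h4
      linarith
    · push Not at hle
      have h2 : (M / ((i : ℕ) + 1)) ^ p ≤ M / ((i : ℕ) + 1) :=
        Real.rpow_le_self_of_le_one (by positivity) ((div_le_one hk).mpr hle.le) hp
      have h3 := Real.log_le_sub_one_of_pos (show 0 < 1 + 4 * lam i / M by linarith)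
      have h4 : 4 * c * M * (((i : ℕ) + 1 : ℕ) : ℝ)⁻¹ = 4 * c * (M / ((i : ℕ) + 1)) := by
        push_cast; ring
      rw [h4, zero_add]
      have := mul_le_mul_of_nonneg_left h2 (show 0 ≤ 4 * c by linarith)
      linarith
  have hcount : ∑ i : Fin T, (if ((i : ℕ) + 1 : ℝ) ≤ M then B else 0) ≤ M * B := by
    rw [← Finset.sum_filter, Finset.sum_const, nsmul_eq_mul]
    refine mul_le_mul_of_nonneg_right ?_ hB0
    have hcard : (Finset.univ.filter fun i : Fin T => ((i : ℕ) + 1 : ℝ) ≤ M).card ≤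
        (Finset.range ⌊M⌋₊).card := by
      refine Finset.card_le_card_of_injOn (fun i => (i : ℕ)) ?_ ?_
      · intro i hi
        rw [Finset.coe_filter, Set.mem_ofPred_eq] at hi
        rw [Finset.coe_range, Set.mem_Iio]
        exact Nat.le_floor (by push_cast; exact hi.2)
      · exact Fin.val_injective.injOn
    rw [Finset.card_range] at hcard
    exact (Nat.cast_le.mpr hcard).trans (Nat.floor_le hM0.le)
  have hharm : ∑ i : Fin T, (((i : ℕ) + 1 : ℕ) : ℝ)⁻¹ ≤ 1 + Real.log T := by
    have := harmonic_le_one_add_log T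
    rw [harmonic, Rat.cast_sum, Finset.sum_range] at this
    simpa using this
  calc ∑ i, Real.log (1 + 4 * lam i / M)
      ≤ ∑ i : Fin T, ((if ((i : ℕ) + 1 : ℝ) ≤ M then B else 0) +
          4 * c * M * (((i : ℕ) + 1 : ℕ) : ℝ)⁻¹) := Finset.sum_le_sum fun i _ => hterm i
    _ = ∑ i : Fin T, (if ((i : ℕ) + 1 : ℝ) ≤ M then B else 0) +
          4 * c * M * ∑ i : Fin T, (((i : ℕ) + 1 : ℕ) : ℝ)⁻¹ := by
        rw [Finset.sum_add_distrib, ← Finset.mul_sum]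
    _ ≤ M * B + 4 * c * M * (1 + Real.log T) := by
        have := mul_le_mul_of_nonneg_left hharm (show 0 ≤ 4 * c * M by positivity)
        linarith
    _ = _ := by rw [hB]; ring

/-! ## Runs of NONS-ALD -/

section Runs

variable {d T : ℕ} {H : Type u} [NormedAddCommGroup H] [InnerProductSpace ℝ H] [CompleteSpace H]
  [RKHS ℝ H (Pt d) ℝ] {P : Params} {x : ℕ → Pt d} {y yhat : ℕ → ℝ} {st : ℕ → Learner d}

/-- The buffer consists of distinct members of the first `t` examples, and each of them has
contributed a factor of at least `α` to the determinant of the kernel matrix. -/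
def Learner.BufferOf (H : Type u) [NormedAddCommGroup H] [InnerProductSpace ℝ H] [CompleteSpace H]
    [RKHS ℝ H (Pt d) ℝ] (α : ℝ) (x : ℕ → Pt d) (t : ℕ) (L : Learner d) : Prop :=
  (∃ idx : Fin L.size → ℕ, Function.Injective idx ∧ (∀ i, idx i < t) ∧
    ∀ i, L.basis i = x (idx i)) ∧ α ^ L.size ≤ (kerMatrix H L.basis).det

theorem Learner.bufferOf_init (α : ℝ) (x : ℕ → Pt d) :
    (Learner.init d).BufferOf H α x 0 := by
  refine ⟨⟨Fin.elim0, fun i => Fin.elim0 i, fun i => Fin.elim0 i, fun i => Fin.elim0 i⟩, ?_⟩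
  change α ^ 0 ≤ (kerMatrix H (n := 0) _).det
  rw [pow_zero, det_fin_zero]

/-- An instance is added only when its projection error, the new factor of the determinant, exceeds
`α`; its index `t` is larger than all earlier ones. -/
theorem IsRound.bufferOf {L L' : Learner d} {t : ℕ} {yt yhat : ℝ}
    (hr : IsRound H P L (x t) yt yhat L') (hL : L.Valid H) (hα : 0 < P.α)
    (hb : L.BufferOf H P.α x t) : L'.BufferOf H P.α x (t + 1) := by
  obtain ⟨w, M, -, hM, -, rfl⟩ := hr
  obtain ⟨⟨idx, hinj, hlt, hidx⟩, hdet⟩ := hb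
  rcases hM with ⟨-, rfl⟩ | ⟨hgt, V, σ, Q, -, -, rfl⟩
  · exact ⟨⟨idx, hinj, fun i => (hlt i).trans (Nat.lt_succ_self t), hidx⟩, hdet⟩
  · refine ⟨⟨Fin.snoc (α := fun _ => ℕ) idx t, ?_, ?_, ?_⟩, ?_⟩
    · refine (Fin.snoc_injective_iff).mpr ⟨hinj, ?_⟩
      rintro ⟨i, hi⟩
      exact (hlt i).ne hi
    · intro i
      refine Fin.lastCases ?_ (fun i => ?_) i
      · rw [Fin.snoc_last]; exact Nat.lt_succ_self t
      · rw [Fin.snoc_castSucc]; exact (hlt i).trans (Nat.lt_succ_self t)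
    · intro i
      refine Fin.lastCases ?_ (fun i => ?_) i
      · rw [Fin.snoc_last]; exact extend_last _ _
      · rw [Fin.snoc_castSucc, ← hidx]; exact extend_castSucc _ _ _
    · change P.α ^ (L.size + 1) ≤ (kerMatrix H (extend L.basis (x t))).det
      rw [det_kerMatrix_extend hL.svd hL.val_pos, pow_succ]
      exact mul_le_mul hdet hgt.le hα.le hL.det_pos.le

theorem IsNonsAld.invariant {N : ℕ} {ψ : Pt d → Fin N → ℝ} (h : IsNonsAld H P T x y st yhat)
    (hψ : Represents H ψ {z | ∃ t < T, z = x t}) (hone : ∀ z : Pt d, ker H z z = 1)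
    (hμ : 0 < P.μ) (hα : 0 < P.α) (hU : 0 ≤ P.U) (hη : 0 ≤ P.η) {t : ℕ} (ht : t ≤ T) :
    (st t).Valid H ∧ (∀ i, (st t).basis i ∈ {z | ∃ t < T, z = x t}) ∧
      (st t).BufferOf H P.α x t := by
  induction t with
  | zero =>
    rw [h.1]
    exact ⟨Learner.valid_init H, fun i => Fin.elim0 i, Learner.bufferOf_init _ _⟩
  | succ t ih =>
    obtain ⟨hv, hb, hbuf⟩ := ih (by omega)
    have hr := h.2 t ht
    obtain ⟨h1, h2, -⟩ := hr.newtonRound hv hψ hb ⟨t, ht, rfl⟩ (hone _) hμ hα hU hη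
    exact ⟨h1, h2, hr.bufferOf hv hα hbuf⟩

theorem PolyDecay.exists_isSVD {R₀ p : ℝ} (h : PolyDecay H (fun i : Fin T => x i) R₀ p) :
    ∃ (V : Matrix (Fin T) (Fin T) ℝ) (lam : Fin T → ℝ),
      IsSVD (kerMatrix H fun i : Fin T => x i) V lam ∧
      ∀ i : Fin T, lam i ≤ R₀ * ((i : ℕ) + 1 : ℝ) ^ (-p) := by
  obtain ⟨V, hV⟩ := exists_isSVD_eigenvalues₀ (kerMatrix_isHermitian H fun i : Fin T => x i)
  exact ⟨V, _, hV, fun i => h (Fin.cast (Fintype.card_fin T).symm i)⟩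

theorem log_two_le_log {T : ℕ} (hT : 2 ≤ T) : Real.log 2 ≤ Real.log T :=
  Real.log_le_log two_pos (by exact_mod_cast hT)

/-- The constant in the regret bound. -/
noncomputable def regretConst (U Y c : ℝ) : ℝ :=
  (U ^ 2 / 2 + 2 * (U ^ 2 + Y ^ 2) * (Real.log (1 + 4 * c) + 4 * c + 4) +
    2 * U * (U + Y)) / Real.log 2 + 2 * (U ^ 2 + Y ^ 2) * (1 + 4 * c)

/-- The reason for the choice of `α`: `√α = T^{-2p/(1+p)}`, and `2p/(1+p) ≥ 1` exactly when `p ≥ 1`.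
-/
theorem mul_rpow_alpha_le {p : ℝ} (hp : 1 ≤ p) {T : ℕ} (hT : 1 ≤ T) :
    T * Real.sqrt ((T : ℝ) ^ (-(4 * p) / (1 + p))) ≤ 1 ∧
      T * (T : ℝ) ^ (-(4 * p) / (1 + p)) ≤ 1 := by
  have hT' : (1 : ℝ) ≤ T := by exact_mod_cast hT
  have hT0 : (0 : ℝ) < T := by linarith
  have h1p : 0 < 1 + p := by linarith
  have key : ∀ s : ℝ, s ≤ -1 → T * (T : ℝ) ^ s ≤ 1 := by
    intro s hs
    calc T * (T : ℝ) ^ s ≤ T * (T : ℝ) ^ (-1 : ℝ) := by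
          have := Real.rpow_le_rpow_of_exponent_le hT' hs
          gcongr
      _ = 1 := by rw [Real.rpow_neg_one, mul_inv_cancel₀ hT0.ne']
  constructor
  · rw [Real.sqrt_eq_rpow, ← Real.rpow_mul hT0.le]
    apply key
    rw [div_mul_eq_mul_div, div_le_iff₀ h1p]
    linarith
  · apply key
    rw [div_le_iff₀ h1p]
    linarith

theorem IsNonsAld.regret_le {U Y p c R₀ : ℝ} (hp : 1 ≤ p) (hU : 0 < U) (hY : 0 ≤ Y) (hc : 0 < c)
    (hT : 2 ≤ T) (hone : ∀ z : Pt d, ker H z z = 1) (hy : ∀ t < T, |y t| ≤ Y) (hR : R₀ ≤ c * T)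
    (hdecay : PolyDecay H (fun i : Fin T => x i) R₀ p)
    (hP : P = { μ := (T : ℝ) ^ (1 / (1 + p))
                α := (T : ℝ) ^ (-(4 * p) / (1 + p))
                U := U
                η := 1 / (4 * (U ^ 2 + Y ^ 2)) })
    (h : IsNonsAld H P T x y st yhat) {f : H} (hf : ‖f‖ ≤ U) :
    regret H T x y yhat f ≤ regretConst U Y c * ((T : ℝ) ^ (1 / (1 + p)) * Real.log T) := by
  have hT' : (1 : ℝ) ≤ T := by exact_mod_cast (by omega : 1 ≤ T)
  have hT0 : (0 : ℝ) < T := by linarith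
  have hUY : 0 < U ^ 2 + Y ^ 2 := by positivity
  have hμ : 0 < P.μ := by rw [hP]; positivity
  have hα : 0 < P.α := by rw [hP]; positivity
  have hη : 0 < P.η := by rw [hP]; positivity
  have hPU : P.U = U := by rw [hP]
  have hU0 : 0 ≤ P.U := hPU ▸ hU.le
  have hηU : P.η * (4 * (P.U ^ 2 + Y ^ 2)) ≤ 1 := by
    rw [hP]
    exact (one_div_mul_cancel (by positivity)).le
  obtain ⟨V, lam, hsvd, hlam⟩ := hdecay.exists_isSVD
  obtain ⟨ψ, hψ, hψlam⟩ := exists_represents H x hsvd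
  obtain ⟨F, hF, hFf⟩ := hψ.exists_vector f
  have hF' : F ⬝ᵥ F ≤ P.U ^ 2 := hF.trans (by rw [hPU]; gcongr)
  have hinv := fun t (ht : t ≤ T) => h.invariant hψ hone hμ hα hU0 hη.le ht
  have hrounds : ∀ t < T, NewtonRound P (ψ (x t)) (y t) (yhat t)
      (liftCov P.μ ((st t).emb ψ) (st t).cov)
      (liftCov P.μ ((st (t + 1)).emb ψ) (st (t + 1)).cov)
      ((st t).emb ψ *ᵥ (st t).wt) ((st (t + 1)).emb ψ *ᵥ (st (t + 1)).wt) := by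
    intro t ht
    obtain ⟨hv, hb, -⟩ := hinv t ht.le
    exact ((h.2 t ht).newtonRound hv hψ hb ⟨t, ht, rfl⟩ (hone _) hμ hα hU0 hη.le).2.2
  have hstart : liftCov P.μ ((st 0).emb ψ) (st 0).cov = P.μ • 1 ∧
      (st 0).emb ψ *ᵥ (st 0).wt = 0 := by
    rw [h.1]
    constructor
    · exact liftCov_of_empty _ _ _
    · ext i
      simp [Learner.init, mulVec, dotProduct]
  have hreg := newton_regret_le (z := fun t => ψ (x t))
    (A := fun t => liftCov P.μ ((st t).emb ψ) (st t).cov)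
    (v := fun t => (st t).emb ψ *ᵥ (st t).wt) hrounds hstart.1 hstart.2 hμ hη hU0 hηU hy hα.le
    (fun t ht => (hψ _ ⟨t, ht, rfl⟩ _ ⟨t, ht, rfl⟩).trans (hone _)) (fun i => (hψlam i).le) hF'
  have hregret : regret H T x y yhat f =
      ∑ t ∈ Finset.range T, ((yhat t - y t) ^ 2 - (F ⬝ᵥ ψ (x t) - y t) ^ 2) :=
    Finset.sum_congr rfl fun t ht => by rw [hFf t (Finset.mem_range.mp ht)]
  rw [← hregret] at hreg
  have hlog := sum_log_polyDecay_le hp hc (by omega) hR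
    (fun i => hsvd.nonneg (kerMatrix_posSemidef H _) i) hlam
  obtain ⟨ha1, ha2⟩ := mul_rpow_alpha_le hp (by omega : 1 ≤ T)
  set M : ℝ := (T : ℝ) ^ (1 / (1 + p)) with hM
  have hM1 : 1 ≤ M := Real.one_le_rpow hT' (by positivity)
  have hPμ : P.μ = M := by rw [hP]
  have hPα : P.α = (T : ℝ) ^ (-(4 * p) / (1 + p)) := by rw [hP]
  have hPη : ∀ a : ℝ, a / P.η = 4 * (U ^ 2 + Y ^ 2) * a := fun a => by
    rw [hP]; field_simp
  rw [hPη, hPμ, hPα, hPU] at hreg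
  have h1 : 4 * (T * (T : ℝ) ^ (-(4 * p) / (1 + p))) / M ≤ 4 * M := by
    rw [div_le_iff₀ (by linarith)]
    nlinarith
  have h2 : T * (2 * (2 * U * (U + Y) * Real.sqrt ((T : ℝ) ^ (-(4 * p) / (1 + p))))) ≤
      4 * U * (U + Y) * M := by
    have : 0 ≤ 4 * U * (U + Y) := by positivity
    nlinarith [mul_le_mul_of_nonneg_left (ha1.trans hM1) this]
  set Λ := Real.log T with hΛ
  have h3 := mul_le_mul_of_nonneg_left (add_le_add hlog h1)
    (show 0 ≤ 4 * (U ^ 2 + Y ^ 2) by positivity)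
  have hl2 : 0 < Real.log 2 := Real.log_pos one_lt_two
  have hΛ2 : Real.log 2 ≤ Λ := log_two_le_log hT
  set a := U ^ 2 / 2 + 2 * (U ^ 2 + Y ^ 2) * (Real.log (1 + 4 * c) + 4 * c + 4) +
    2 * U * (U + Y) with haa
  have ha0 : 0 ≤ a := by
    have := Real.log_nonneg (show (1 : ℝ) ≤ 1 + 4 * c by linarith)
    positivity
  -- `T ≥ 2` lets the terms without a logarithm be absorbed into `log T`, which explains `log 2` in
  -- `regretConst`.
  have h4 : a ≤ a / Real.log 2 * Λ := by
    rw [div_mul_eq_mul_div, le_div_iff₀ hl2]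
    exact mul_le_mul_of_nonneg_left hΛ2 ha0
  calc regret H T x y yhat f ≤ M * (a + 2 * (U ^ 2 + Y ^ 2) * (1 + 4 * c) * Λ) := by
        rw [haa]; nlinarith
    _ ≤ M * (a / Real.log 2 * Λ + 2 * (U ^ 2 + Y ^ 2) * (1 + 4 * c) * Λ) := by gcongr
    _ = regretConst U Y c * (M * Λ) := by rw [regretConst, ← haa]; ring

/-! ## The size of the buffer -/

/-- The product is `R₀^J / (J!)^p`; inserting `J! ≥ (J/e)^J` and taking `J`-th, then `p`-th roots
solves for `J`. -/
theorem le_exp_mul_rpow_of_pow_le {p α R₀ : ℝ} (hp : 1 ≤ p) (hα : 0 < α) (hR : 0 < R₀) {J : ℕ}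
    (h : α ^ J ≤ ∏ i : Fin J, R₀ * ((i : ℕ) + 1 : ℝ) ^ (-p)) :
    (J : ℝ) ≤ Real.exp 1 * (R₀ / α) ^ (1 / p) := by
  rcases Nat.eq_zero_or_pos J with rfl | hJ
  · simpa using by positivity
  have hJ0 : (0 : ℝ) < J := by exact_mod_cast hJ
  have hfac : ∏ i : Fin J, ((i : ℕ) + 1 : ℝ) ^ (-p) = ((J.factorial : ℝ) ^ p)⁻¹ := by
    rw [Real.finsetProd_rpow _ _ (fun i _ => by positivity), Real.rpow_neg (by positivity)]
    congr 2
    rw [← Finset.prod_range_add_one_eq_factorial, Finset.prod_range]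
    push_cast
    rfl
  rw [Finset.prod_mul_distrib, Finset.prod_const, Finset.card_univ, Fintype.card_fin, hfac,
    ← div_eq_mul_inv, le_div_iff₀ (by positivity)] at h
  have hexp : (J / Real.exp 1) ^ J ≤ (J.factorial : ℝ) := by
    have := Real.pow_div_factorial_le_exp (J : ℝ) hJ0.le J
    rw [div_pow, ← Real.exp_nat_mul, mul_one]
    rw [div_le_iff₀ (by positivity)] at this ⊢
    linarith
  have h1 : ((J / Real.exp 1) ^ p) ^ J ≤ (R₀ / α) ^ J := by
    rw [div_pow R₀, le_div_iff₀ (by positivity), mul_comm]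
    refine le_trans ?_ h
    have h2 : ((J / Real.exp 1) ^ p) ^ J = ((J / Real.exp 1) ^ J) ^ p := by
      rw [← Real.rpow_natCast, ← Real.rpow_mul (by positivity), mul_comm,
        Real.rpow_mul (by positivity), Real.rpow_natCast]
    rw [h2]
    gcongr
  have h2 := (pow_le_pow_iff_left₀ (by positivity) (by positivity) hJ.ne').mp h1
  have h3 := Real.rpow_le_rpow (by positivity) h2 (show 0 ≤ 1 / p by positivity)
  rw [← Real.rpow_mul (by positivity), mul_one_div_cancel (by linarith), Real.rpow_one,
    div_le_iff₀ (Real.exp_pos 1)] at h3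
  linarith

theorem Learner.BufferOf.size_le {p α R₀ : ℝ} {L : Learner d} (hp : 1 ≤ p) (hα : 0 < α)
    (hR : 0 < R₀) (hdecay : PolyDecay H (fun i : Fin T => x i) R₀ p) {t : ℕ} (ht : t ≤ T)
    (h : L.BufferOf H α x t) : (L.size : ℝ) ≤ Real.exp 1 * (R₀ / α) ^ (1 / p) := by
  obtain ⟨⟨idx, hinj, hlt, hidx⟩, hdet⟩ := h
  obtain ⟨V, lam, hsvd, hlam⟩ := hdecay.exists_isSVD
  obtain ⟨W, σ, hW, hσ⟩ : ∃ (W : Matrix (Fin L.size) (Fin L.size) ℝ)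
      (σ : Fin L.size → ℝ), IsSVD (kerMatrix H L.basis) W σ ∧ Antitone σ := by
    obtain ⟨W, hW⟩ := exists_isSVD_eigenvalues₀ (kerMatrix_isHermitian H L.basis)
    refine ⟨W, _, hW, fun a b hab => ?_⟩
    apply (kerMatrix_isHermitian H L.basis).eigenvalues₀_antitone
    exact hab
  -- The selection matrix of the buffer. It has orthonormal columns because `idx` is injective, so
  -- the kernel matrix of the buffer is a compression of the full one.
  let E : Matrix (Fin T) (Fin L.size) ℝ := Matrix.of fun s i => if (s : ℕ) = idx i then 1 else 0
  have hi : ∀ i, idx i < T := fun i => (hlt i).trans_le ht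
  have hEsum : ∀ (i : Fin L.size) (g : Fin T → ℝ), ∑ s, E s i * g s = g ⟨idx i, hi i⟩ := by
    intro i g
    rw [Finset.sum_eq_single ⟨idx i, hi i⟩]
    · simp [E]
    · intro s _ hs
      have : (s : ℕ) ≠ idx i := fun h => hs (Fin.ext h)
      simp [E, this]
    · simp
  have hE : Eᵀ * E = 1 := by
    ext i j
    simp only [mul_apply, transpose_apply, hEsum]
    simp [E, one_apply, hinj.eq_iff]
  have hEK : Eᵀ * (kerMatrix H fun i : Fin T => x i) * E = kerMatrix H L.basis := by
    ext i j
    rw [Matrix.mul_assoc]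
    simp only [mul_apply, transpose_apply, hEsum]
    simp_rw [mul_comm _ (E _ j), hEsum]
    simp [kerMatrix, hidx]
  have hanti : Antitone fun k : ℕ => R₀ * ((k : ℝ) + 1) ^ (-p) := by
    intro a b hab
    refine mul_le_mul_of_nonneg_left ?_ hR.le
    refine Real.rpow_le_rpow_of_nonpos (by positivity) (by gcongr) (by linarith)
  refine le_exp_mul_rpow_of_pow_le hp hα hR (hdet.trans ?_)
  rw [hW.det_eq]
  refine Finset.prod_le_prod (fun i _ => hW.nonneg (kerMatrix_posSemidef H _) i) fun i _ => ?_
  exact eigenvalue_compression_le hsvd hE (hEK.symm ▸ hW) hσ hanti hlam i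

theorem IsNonsAld.size_le {U Y p c₁ c R₀ : ℝ} (hp : 1 ≤ p) (hU : 0 < U) (hc₁ : 0 < c₁)
    (hc : 0 < c) (hT : 1 ≤ T) (hone : ∀ z : Pt d, ker H z z = 1) (hR₁ : c₁ * T ≤ R₀)
    (hR : R₀ ≤ c * T) (hdecay : PolyDecay H (fun i : Fin T => x i) R₀ p)
    (hP : P = { μ := (T : ℝ) ^ (1 / (1 + p))
                α := (T : ℝ) ^ (-(4 * p) / (1 + p))
                U := U
                η := 1 / (4 * (U ^ 2 + Y ^ 2)) })
    (h : IsNonsAld H P T x y st yhat) {t : ℕ} (ht : t ≤ T) :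
    ((st t).size : ℝ) ≤
      Real.exp 1 * c ^ (1 / p) * (T : ℝ) ^ ((1 + 5 * p) / (p * (1 + p))) := by
  have hT0 : (0 : ℝ) < T := by exact_mod_cast hT
  have hR0 : 0 < R₀ := lt_of_lt_of_le (by positivity) hR₁
  have hα : 0 < P.α := by rw [hP]; positivity
  obtain ⟨V, lam, hsvd, hlam⟩ := hdecay.exists_isSVD
  obtain ⟨ψ, hψ, -⟩ := exists_represents H x hsvd
  have hbuf := (h.invariant hψ hone (by rw [hP]; positivity) hα (by rw [hP]; exact hU.le)
    (by rw [hP]; positivity) ht).2.2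
  refine (hbuf.size_le hp hα hR0 hdecay ht).trans ?_
  rw [mul_assoc]
  refine mul_le_mul_of_nonneg_left ?_ (Real.exp_pos 1).le
  -- The exponent is `1 + 4p/(1+p)`: one factor `T` from `R₀`, the rest from `1/α`.
  have h1 : R₀ / P.α ≤ c * (T : ℝ) ^ ((1 + 5 * p) / (1 + p)) := by
    rw [div_le_iff₀ hα, hP, mul_assoc, ← Real.rpow_add hT0]
    have : (1 + 5 * p) / (1 + p) + -(4 * p) / (1 + p) = 1 := by
      rw [← add_div, div_eq_one_iff_eq (by linarith)]; ring
    rw [this, Real.rpow_one]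
    exact hR
  refine (Real.rpow_le_rpow (by positivity) h1 (by positivity)).trans ?_
  rw [Real.mul_rpow hc.le (by positivity), ← Real.rpow_mul hT0.le]
  refine le_of_eq ?_
  congr 2
  field_simp

end Runs

/-! ## Correctness of the implementation -/

section Formulas

variable {n : ℕ}

/-- The amount `sign(z) max(|z| - U, 0)` by which `z` leaves `[-U, U]`. -/
noncomputable def excess (U z : ℝ) : ℝ := if z ≤ U then (if 0 ≤ z + U then 0 else z + U) else z - U

theorem overshoot_result (U z : ℝ) : (overshoot U z).result = excess U z := by
  simp only [overshoot, excess, Costed.ifLe]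
  split_ifs <;> first | rfl | skip
  all_goals
    change (if 0 ≤ z + U then _ else _ : Costed ℝ).result = _
    first | rw [if_pos ‹_›] | rw [if_neg ‹_›]
    rfl

theorem abs_sub_excess_le {U z : ℝ} (hU : 0 ≤ U) : |z - excess U z| ≤ U := by
  rw [excess, abs_le]
  split_ifs <;> constructor <;> linarith

/-- Any displacement bringing `z` back into `[-U, U]` must move it by at least the excess, against
the sign of the excess. -/
theorem excess_sq_le {U z δ : ℝ} (h : |z + δ| ≤ U) :
    excess U z ^ 2 ≤ -(excess U z * δ) := by
  rw [abs_le] at h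
  rw [excess]
  split_ifs with h1 h2
  · simp
  · nlinarith
  · nlinarith

/-- Closed form of the projection onto a slab. -/
theorem slab_projection {A B : Matrix (Fin n) (Fin n) ℝ} (hA : A.PosDef) (hAB : A * B = 1) {U : ℝ}
    (hU : 0 ≤ U) (w₀ φ : Fin n → ℝ) {w : Fin n → ℝ}
    (hw : w = w₀ - (excess U (w₀ ⬝ᵥ φ) / (φ ⬝ᵥ (B *ᵥ φ))) • (B *ᵥ φ)) :
    |w ⬝ᵥ φ| ≤ U ∧ ∀ v : Fin n → ℝ, |v ⬝ᵥ φ| ≤ U →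
      (w - w₀) ⬝ᵥ (A *ᵥ (w - w₀)) ≤ (v - w₀) ⬝ᵥ (A *ᵥ (v - w₀)) := by
  have hs := transpose_eq_of_posDef hA
  set e := excess U (w₀ ⬝ᵥ φ) with he
  set b := B *ᵥ φ with hb
  have hAb : A *ᵥ b = φ := by rw [hb, mulVec_mulVec, hAB, one_mulVec]
  -- Here the quotient in `w` has denominator `0`, but it multiplies the zero vector, and `w₀` is
  -- already feasible.
  by_cases hφ : φ = 0
  · have hb0 : b = 0 := by rw [hb, hφ, mulVec_zero]
    rw [hw, hb0, smul_zero, sub_zero, hφ, dotProduct_zero, abs_zero, sub_self, zero_dotProduct]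
    exact ⟨hU, fun v _ => quad_nonneg hA.posSemidef _⟩
  · have hb0 : b ≠ 0 := fun h => hφ (by rw [← hAb, h, mulVec_zero])
    have hq : 0 < φ ⬝ᵥ b := by
      have := quad_pos hA hb0
      rwa [hAb, dotProduct_comm] at this
    set q := φ ⬝ᵥ b with hqd
    have hww : w - w₀ = -((e / q) • b) := by rw [hw]; abel
    constructor
    · rw [hw, sub_dotProduct, smul_dotProduct, dotProduct_comm b φ, ← hqd, smul_eq_mul,
        div_mul_cancel₀ _ hq.ne']
      exact abs_sub_excess_le hU
    · intro v hv
      -- Expanded, this gives `‖v - w₀‖² ≥ 2 ⟨w - w₀, v - w₀⟩ - ‖w - w₀‖²` in the `A`-norm. The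
      -- inner product is at least `e² / q`, which is also `‖w - w₀‖²`.
      have h1 := quad_nonneg hA.posSemidef ((v - w₀) - (w - w₀))
      rw [quad_sub hs] at h1
      have h2 : (w - w₀) ⬝ᵥ (A *ᵥ (v - w₀)) = -(e / q * ((v - w₀) ⬝ᵥ φ)) := by
        rw [dotProduct_mulVec_comm hs, hww, mulVec_neg, mulVec_smul, hAb, dotProduct_neg,
          dotProduct_smul, smul_eq_mul]
      have h3 : (w - w₀) ⬝ᵥ (A *ᵥ (w - w₀)) = e ^ 2 / q := by
        rw [hww, mulVec_neg, mulVec_smul, hAb, neg_dotProduct, dotProduct_neg, neg_neg,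
          smul_dotProduct, dotProduct_smul, dotProduct_comm b φ, ← hqd, smul_eq_mul, smul_eq_mul]
        field_simp
      have h4 : e ^ 2 ≤ -(e * ((v - w₀) ⬝ᵥ φ)) := by
        refine excess_sq_le ?_
        rwa [sub_dotProduct, add_sub_cancel]
      have h5 : e ^ 2 / q ≤ -(e / q * ((v - w₀) ⬝ᵥ φ)) := by
        rw [div_le_iff₀ hq]
        have : -(e / q * ((v - w₀) ⬝ᵥ φ)) * q = -(e * ((v - w₀) ⬝ᵥ φ)) := by
          field_simp
        rwa [this]
      rw [h2, h3] at h1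
      rw [h3]
      linarith

/-- The **Sherman-Morrison formula** for a symmetric rank one update. -/
theorem rankOne_update_mul_inv {A B : Matrix (Fin n) (Fin n) ℝ} (hA : A.PosDef) (hAB : A * B = 1)
    {η : ℝ} (hη : 0 ≤ η) (v : Fin n → ℝ) :
    (A + η • vecMulVec v v) *
      (B - (η / (1 + η * (v ⬝ᵥ (B *ᵥ v)))) • vecMulVec (B *ᵥ v) (B *ᵥ v)) = 1 := by
  have hB : B.PosDef := by
    rw [← Matrix.inv_eq_right_inv hAB]
    exact hA.inv
  have hBt := transpose_eq_of_posDef hB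
  set u := B *ᵥ v with hu
  set s := v ⬝ᵥ u with hs
  have hAu : A *ᵥ u = v := by rw [hu, mulVec_mulVec, hAB, one_mulVec]
  have hvB : v ᵥ* B = u := by rw [← mulVec_transpose, hBt]
  have hs0 : 0 ≤ s := quad_nonneg hB.posSemidef v
  have h1 : 1 + η * s ≠ 0 := by positivity
  rw [Matrix.mul_sub, Matrix.add_mul, Matrix.add_mul, hAB, Matrix.mul_smul, Matrix.smul_mul,
    Matrix.smul_mul, vecMulVec_mul, hvB, Matrix.mul_smul, mul_vecMulVec, hAu,
    vecMulVec_mul_vecMulVec, ← hs, vecMulVec_smul]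
  ext i j
  simp only [Matrix.sub_apply, Matrix.add_apply, Matrix.smul_apply, smul_eq_mul]
  field_simp
  ring

/-- The inverse of a lifted covariance matrix. -/
theorem liftCov_mul_inv {N : ℕ} {A B : Matrix (Fin n) (Fin n) ℝ} (hAB : A * B = 1) {μ : ℝ}
    (hμ : μ ≠ 0) {Q : Matrix (Fin N) (Fin n) ℝ} (hQ : Qᵀ * Q = 1) :
    liftCov μ Q A * (μ⁻¹ • (1 - Q * Qᵀ) + Q * B * Qᵀ) = 1 := by
  have h1 : Qᵀ * (1 - Q * Qᵀ) = 0 := by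
    rw [Matrix.mul_sub, Matrix.mul_one, ← Matrix.mul_assoc, hQ, Matrix.one_mul, sub_self]
  have h2 : Qᵀ * (Q * B * Qᵀ) = B * Qᵀ := by
    rw [← Matrix.mul_assoc, ← Matrix.mul_assoc, hQ, Matrix.one_mul]
  have h3 : (A - μ • 1) * B = 1 - μ • B := by
    rw [Matrix.sub_mul, hAB, Matrix.smul_mul, Matrix.one_mul]
  have h4 : Q * (A - μ • 1) * (B * Qᵀ) = Q * Qᵀ - μ • (Q * B * Qᵀ) := by
    calc Q * (A - μ • 1) * (B * Qᵀ) = Q * ((A - μ • 1) * B) * Qᵀ := by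
          simp only [Matrix.mul_assoc]
      _ = _ := by
          rw [h3, Matrix.mul_sub, Matrix.sub_mul, Matrix.mul_one, Matrix.mul_smul, Matrix.smul_mul]
  rw [liftCov, Matrix.add_mul, Matrix.mul_assoc _ Qᵀ, Matrix.mul_add Qᵀ, Matrix.mul_smul Qᵀ, h1,
    smul_zero, zero_add, h2, Matrix.smul_mul, Matrix.one_mul, smul_add, smul_smul,
    mul_inv_cancel₀ hμ, one_smul, h4]
  abel

end Formulas

/-! ### The machine executes NONS-ALD -/

section Machine

variable {d N : ℕ} (H : Type u) [NormedAddCommGroup H] [InnerProductSpace ℝ H] [CompleteSpace H]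
  [RKHS ℝ H (Pt d) ℝ]

/-- The invariant of a machine: the cached matrices are what they should be. -/
structure Machine.Valid (m : Machine d) : Prop where
  learner : m.toLearner.Valid H
  gram : m.gram = kerMatrix H m.basis
  half : m.half = halfCoef m.vec m.val
  inv : m.cov * m.inv = 1

/-- The invariant of a machine that has made its prediction on `x`. -/
structure Pending.Valid (p : Pending d) (x : Pt d) : Prop where
  machine : p.toMachine.Valid H
  feature : p.feature = p.toLearner.phi H x
  pred : p.pred = p.wt ⬝ᵥ p.toLearner.phi H x

theorem Machine.valid_init : (Machine.init d).Valid H where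
  learner := Learner.valid_init H
  gram := by ext i; exact Fin.elim0 i
  half := by ext i; exact Fin.elim0 i
  inv := by ext i; exact Fin.elim0 i

variable {H} {P : Params}

theorem bind_result {α β : Type} (a : Costed α) (f : α → Costed β) :
    (a >>= f).result = (f a.result).result := rfl

theorem svd_result {n : ℕ} {K : Matrix (Fin n) (Fin n) ℝ} (hK : K.IsHermitian) :
    (Costed.svd K).result =
      ((hK.eigenvectorUnitary : Matrix (Fin n) (Fin n) ℝ), hK.eigenvalues) := by
  exact dif_pos hK

theorem border_result {n : ℕ} (b : Fin n → Pt d) (x : Pt d) :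
    (border (kerMatrix H b) (fun i => ker H (b i) x) (ker H x x)).result =
      kerMatrix H (extend b x) := by
  ext i j
  change Fin.snoc (α := fun _ => Fin (n + 1) → ℝ)
      (fun a => Fin.snoc (α := fun _ => ℝ) (kerMatrix H b a) (ker H (b a) x))
      (Fin.snoc (α := fun _ => ℝ) (fun i => ker H (b i) x) (ker H x x)) i j = _
  refine Fin.lastCases ?_ (fun i => ?_) i <;> refine Fin.lastCases ?_ (fun j => ?_) j <;>
    simp [kerMatrix, ker_comm H x]

theorem snoc_ker {n : ℕ} (b : Fin n → Pt d) (x : Pt d) :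
    Fin.snoc (α := fun _ => ℝ) (fun i => ker H (b i) x) (ker H x x) =
      fun i => ker H (extend b x i) x := by
  ext i
  refine Fin.lastCases ?_ (fun i => ?_) i <;> simp

/-- The covariance matrix as `grow` computes it. -/
theorem liftCov_eq_of {n m : ℕ} (μ : ℝ) (Q : Matrix (Fin n) (Fin m) ℝ)
    (A : Matrix (Fin m) (Fin m) ℝ) {D : Matrix (Fin m) (Fin m) ℝ}
    (hD : D = Matrix.of fun i j =>
      (if i = j then Costed.sub (A i j) μ else Costed.read (A i j)).result) :
    (Matrix.of fun i j => (if i = j then Costed.add μ ((Q * D * Qᵀ) i j)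
      else Costed.read ((Q * D * Qᵀ) i j)).result) = liftCov μ Q A := by
  have hD' : D = A - μ • 1 := by
    rw [hD]
    ext i j
    simp only [Matrix.of_apply, Matrix.sub_apply, Matrix.smul_apply, one_apply, smul_eq_mul]
    split_ifs <;> simp [Costed.sub, Costed.read]
  rw [hD', liftCov]
  ext i j
  simp only [Matrix.of_apply, Matrix.add_apply, Matrix.smul_apply, one_apply, smul_eq_mul]
  split_ifs <;> simp [Costed.add, Costed.read]

/-- The inverse covariance matrix as `grow` computes it. -/
theorem inv_eq_of {n m : ℕ} (μ : ℝ) (Q : Matrix (Fin n) (Fin m) ℝ)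
    (B : Matrix (Fin m) (Fin m) ℝ) :
    (Matrix.of fun i j => (if i = j
      then Costed.sub 1 ((Q * Qᵀ) i j) >>= fun e => Costed.div e μ >>= fun r =>
        Costed.add r ((Q * B * Qᵀ) i j)
      else Costed.sub 0 ((Q * Qᵀ) i j) >>= fun e => Costed.div e μ >>= fun r =>
        Costed.add r ((Q * B * Qᵀ) i j)).result) =
      μ⁻¹ • (1 - Q * Qᵀ) + Q * B * Qᵀ := by
  ext i j
  simp only [Matrix.of_apply, Matrix.add_apply, Matrix.smul_apply, Matrix.sub_apply, one_apply,
    smul_eq_mul]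
  split_ifs <;> simp [bind_result, Costed.sub, Costed.div, Costed.add, div_eq_inv_mul]

theorem half_eq_of {n : ℕ} (V : Matrix (Fin n) (Fin n) ℝ) (σ : Fin n → ℝ) :
    (Matrix.of fun i j => V j i / Real.sqrt (σ i)) = halfCoef V σ := by
  ext i j
  simp [halfCoef, diagonal_mul, div_eq_inv_mul]

theorem grow_result (m : Machine d) (hm : m.Valid H) (x : Pt d) (w : Fin m.size → ℝ)
    {V : Matrix (Fin (m.size + 1)) (Fin (m.size + 1)) ℝ} {σ : Fin (m.size + 1) → ℝ}
    (hV : V = (kerMatrix_isHermitian H (extend m.basis x)).eigenvectorUnitary)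
    (hσ : σ = (kerMatrix_isHermitian H (extend m.basis x)).eigenvalues)
    {Q : Matrix (Fin (m.size + 1)) (Fin m.size) ℝ}
    (hQ : Q = transfer H (extend m.basis x) V σ m.basis m.vec m.val) :
    (grow P m x (fun i => ker H (m.basis i) x) (ker H x x) w).result =
      { size := m.size + 1
        basis := extend m.basis x
        vec := V
        val := σ
        cov := liftCov P.μ Q m.cov
        wt := Q *ᵥ w
        gram := kerMatrix H (extend m.basis x)
        half := halfCoef V σ
        inv := P.μ⁻¹ • (1 - Q * Qᵀ) + Q * m.inv * Qᵀ
        feature := halfCoef V σ *ᵥ fun i => ker H (extend m.basis x i) x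
        pred := (Q *ᵥ w) ⬝ᵥ (halfCoef V σ *ᵥ fun i => ker H (extend m.basis x i) x) } := by
  set G := (border m.gram (fun i => ker H (m.basis i) x) (ker H x x)).result with hGd
  have hG : G = kerMatrix H (extend m.basis x) := by rw [hGd, hm.gram, border_result]
  set S := (Costed.svd G).result with hSd
  have hS : S = (V, σ) := by
    rw [hSd, hV, hσ]
    rw [hG]
    exact svd_result _
  set B : Matrix (Fin (m.size + 1)) (Fin (m.size + 1)) ℝ :=
    Matrix.of fun i j => S.1 j i / Real.sqrt (S.2 i) with hBd
  have hB : B = halfCoef V σ := by rw [hBd, half_eq_of, hS]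
  set Q' : Matrix (Fin (m.size + 1)) (Fin m.size) ℝ :=
    B * ((Matrix.of fun i (j : Fin m.size) => G i j.castSucc) * m.halfᵀ) with hQd
  have hQ' : Q' = Q := by
    rw [hQd, hQ, transfer, hB, hm.half, Matrix.mul_assoc, hG]
    congr 2
    ext i j
    simp [kerMatrix]
  set D : Matrix (Fin m.size) (Fin m.size) ℝ := Matrix.of fun i j =>
    (if i = j then Costed.sub (m.cov i j) P.μ else Costed.read (m.cov i j)).result with hDd
  have hA := liftCov_eq_of P.μ Q' m.cov hDd
  have hI := inv_eq_of P.μ Q' m.inv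
  have hk : Fin.snoc (α := fun _ => ℝ) (fun i => ker H (m.basis i) x) (ker H x x) =
      fun i => ker H (extend m.basis x i) x := snoc_ker m.basis x
  -- Unfolding alone expresses the output through the intermediate results; these are then replaced
  -- by the matrices they compute.
  have key : (grow P m x (fun i => ker H (m.basis i) x) (ker H x x) w).result =
      { size := m.size + 1
        basis := extend m.basis x
        vec := S.1
        val := S.2
        cov := Matrix.of fun i j => (if i = j then Costed.add P.μ ((Q' * D * Q'ᵀ) i j)
          else Costed.read ((Q' * D * Q'ᵀ) i j)).result
        wt := Q' *ᵥ w
        gram := G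
        half := B
        inv := Matrix.of fun i j => (if i = j
            then Costed.sub 1 ((Q' * Q'ᵀ) i j) >>= fun e => Costed.div e P.μ >>= fun r =>
              Costed.add r ((Q' * m.inv * Q'ᵀ) i j)
            else Costed.sub 0 ((Q' * Q'ᵀ) i j) >>= fun e => Costed.div e P.μ >>= fun r =>
              Costed.add r ((Q' * m.inv * Q'ᵀ) i j)).result
        feature := B *ᵥ fun i =>
          Fin.snoc (α := fun _ => ℝ) (fun i => ker H (m.basis i) x) (ker H x x) i
        pred := (Q' *ᵥ w) ⬝ᵥ (B *ᵥ fun i =>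
          Fin.snoc (α := fun _ => ℝ) (fun i => ker H (m.basis i) x) (ker H x x) i) } := by
    rfl
  rw [key, hA, hI, hQ', hB, hG, hk, hS]

/-- The projected weights as `observe` computes them. -/
noncomputable def Machine.projected (m : Machine d) (P : Params) (φ : Fin m.size → ℝ) :
    Fin m.size → ℝ :=
  m.wt - (excess P.U (m.wt ⬝ᵥ φ) / (φ ⬝ᵥ (m.inv *ᵥ φ))) • (m.inv *ᵥ φ)

theorem observe_eq_ifLe (m : Machine d) (hm : m.Valid H) (x : Pt d) :
    (observe (ker H) P m x).result =
      (Costed.ifLe (aldError H m.basis x) P.α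
        -- Only results are compared, so the costs here are arbitrary.
        (Costed.mk (time := 0) (cells := 0) { m with
          wt := m.projected P (m.toLearner.phi H x)
          feature := m.toLearner.phi H x
          pred := m.projected P (m.toLearner.phi H x) ⬝ᵥ m.toLearner.phi H x })
        (grow P m x (fun i => ker H (m.basis i) x) (ker H x x)
          (m.projected P (m.toLearner.phi H x)))).result := by
  set k : Fin m.size → ℝ := fun i => ker H (m.basis i) x with hk
  set φ : Fin m.size → ℝ := m.half *ᵥ k with hφd
  have hφ : φ = m.toLearner.phi H x := by rw [hφd, hm.half]; rfl
  set w : Fin m.size → ℝ := fun i => m.wt i -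
    (overshoot P.U (m.wt ⬝ᵥ φ)).result / (φ ⬝ᵥ (m.inv *ᵥ φ)) * (m.inv *ᵥ φ) i with hwd
  have hw : w = m.projected P φ := by
    rw [hwd, overshoot_result]; rfl
  have herr : ker H x x - k ⬝ᵥ (m.halfᵀ *ᵥ φ) = aldError H m.basis x := by
    rw [hm.learner.aldError_eq, ← dotProduct_mulVec_transpose, ← hφd, hφ]
  have key : (observe (ker H) P m x).result =
      (Costed.ifLe (ker H x x - k ⬝ᵥ (m.halfᵀ *ᵥ φ)) P.α
        (do
          let ŷ ← Costed.dot w φ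
          return { m with wt := w, feature := φ, pred := ŷ })
        (grow P m x k (ker H x x) w)).result := rfl
  rw [key, herr, hw, hφ, Costed.ifLe, Costed.ifLe]
  split_ifs <;> rfl

theorem isProjection_projected (m : Machine d) (hm : m.Valid H) (hU : 0 ≤ P.U) (x : Pt d) :
    IsProjection H P m.toLearner x (m.projected P (m.toLearner.phi H x)) :=
  slab_projection hm.learner.cov_posDef hm.inv hU _ _ rfl

/-- The first half of a round. -/
theorem observe_spec {ψ : Pt d → Fin N → ℝ} {X : Set (Pt d)} (hψ : Represents H ψ X)
    (m : Machine d) (hm : m.Valid H) (hb : ∀ i, m.basis i ∈ X) {x : Pt d} (hx : x ∈ X)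
    (hμ : 0 < P.μ) (hα : 0 < P.α) (hU : 0 ≤ P.U) :
    (observe (ker H) P m x).result.Valid H x ∧
      ∃ w, IsProjection H P m.toLearner x w ∧
        ((aldError H m.basis x ≤ P.α ∧
            (observe (ker H) P m x).result.toLearner = { m.toLearner with wt := w }) ∨
          (P.α < aldError H m.basis x ∧
            IsExtension H P m.toLearner x w (observe (ker H) P m x).result.toLearner)) := by
  have hobs := observe_eq_ifLe (P := P) m hm x
  have hproj := isProjection_projected (P := P) m hm hU x
  by_cases h : aldError H m.basis x ≤ P.α
  · rw [Costed.ifLe, if_pos h] at hobs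
    rw [hobs]
    exact ⟨⟨⟨hm.learner.withWt _, hm.gram, hm.half, hm.inv⟩, rfl, rfl⟩, _, hproj,
      Or.inl ⟨h, rfl⟩⟩
  · rw [Costed.ifLe, if_neg h] at hobs
    push Not at h
    simp only at hobs
    rw [grow_result m hm x _ rfl rfl rfl] at hobs
    rw [hobs]
    have hsvd := isSVD_eigenvalues (kerMatrix_isHermitian H (extend m.basis x))
    have hσ := val_pos_of_extend hm.learner (hα.trans h) hsvd
    have hQQ := transfer_isometry hψ hm.learner hb (mem_of_extend hb hx)
      (fun i => ⟨i.castSucc, by simp⟩) hsvd hσ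
    exact ⟨⟨⟨⟨hsvd, hσ, liftCov_posDef hQQ hm.learner.cov_posDef hμ⟩, rfl, rfl,
      liftCov_mul_inv hm.inv hμ.ne' hQQ⟩, rfl, rfl⟩, _, hproj,
      Or.inr ⟨h, _, _, _, hsvd, rfl, rfl⟩⟩

/-- The second half of a round. -/
theorem learn_spec {p : Pending d} {x : Pt d} (hp : p.Valid H x) (hη : 0 ≤ P.η) (y : ℝ) :
    (learn P p y).result.Valid H ∧
      (learn P p y).result.toLearner = p.toLearner.newton H P x y := by
  set v : Fin p.size → ℝ := fun i => 2 * (p.pred - y) * p.feature i with hvd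
  have hv : v = p.toLearner.grad H x y := by
    rw [hvd, hp.feature, hp.pred]; rfl
  set A : Matrix (Fin p.size) (Fin p.size) ℝ :=
    Matrix.of fun i j => p.cov i j + P.η * (v i * v j) with hAd
  have hA : A = p.cov + P.η • vecMulVec v v := rfl
  set I : Matrix (Fin p.size) (Fin p.size) ℝ := Matrix.of fun i j => p.inv i j -
    P.η * ((p.inv *ᵥ v) i * (p.inv *ᵥ v) j) / (1 + P.η * (v ⬝ᵥ (p.inv *ᵥ v))) with hId
  have hI : I = p.inv - (P.η / (1 + P.η * (v ⬝ᵥ (p.inv *ᵥ v)))) •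
      vecMulVec (p.inv *ᵥ v) (p.inv *ᵥ v) := by
    ext i j
    simp [hId, vecMulVec_apply]
    ring
  have hAI : A * I = 1 := by
    rw [hA, hI]
    exact rankOne_update_mul_inv hp.machine.learner.cov_posDef hp.machine.inv hη v
  have key : (learn P p y).result =
      { p.toMachine with cov := A, inv := I, wt := p.wt - I *ᵥ v } := rfl
  have hnewton : (learn P p y).result.toLearner = p.toLearner.newton H P x y := by
    rw [key, Learner.newton]
    simp only [← hv, ← hA, Matrix.inv_eq_right_inv hAI]
  refine ⟨⟨?_, ?_, ?_, ?_⟩, hnewton⟩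
  · rw [hnewton]
    exact hp.machine.learner.newton hη x y
  · exact hp.machine.gram
  · exact hp.machine.half
  · exact hAI

variable {T : ℕ} {x : ℕ → Pt d} {y : ℕ → ℝ}

/-- Validity and membership of the buffer in the sample are carried together: the cached inverse is
correct after an extension only because `Q` is an isometry, which is proved through `ψ`. -/
theorem machineAt_spec {ψ : Pt d → Fin N → ℝ} (hψ : Represents H ψ {z | ∃ t < T, z = x t})
    (hone : ∀ z : Pt d, ker H z z = 1) (hμ : 0 < P.μ) (hα : 0 < P.α) (hU : 0 ≤ P.U)
    (hη : 0 ≤ P.η) :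
    (∀ t ≤ T, (machineAt (ker H) P x y t).Valid H) ∧
      IsNonsAld H P T x y (fun t => (machineAt (ker H) P x y t).toLearner)
        (predictionAt (ker H) P x y) := by
  have step : ∀ t < T, (machineAt (ker H) P x y t).Valid H →
      (∀ i, (machineAt (ker H) P x y t).basis i ∈ {z | ∃ t < T, z = x t}) →
      (machineAt (ker H) P x y (t + 1)).Valid H ∧
      IsRound H P (machineAt (ker H) P x y t).toLearner (x t) (y t) (predictionAt (ker H) P x y t)
        (machineAt (ker H) P x y (t + 1)).toLearner := by
    intro t ht hm hb
    obtain ⟨hobs, w, hproj, hcase⟩ := observe_spec hψ _ hm hb ⟨t, ht, rfl⟩ hμ hα hU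
    obtain ⟨hl, hn⟩ := learn_spec hobs hη (y t)
    exact ⟨hl, w, _, hproj, hcase, hobs.pred, hn⟩
  have hinv : ∀ t ≤ T, (machineAt (ker H) P x y t).Valid H ∧
      ∀ i, (machineAt (ker H) P x y t).basis i ∈ {z | ∃ t < T, z = x t} := by
    intro t ht
    induction t with
    | zero => exact ⟨Machine.valid_init H, fun i => Fin.elim0 i⟩
    | succ t ih =>
      obtain ⟨hm, hb⟩ := ih (by omega)
      obtain ⟨hm', hr⟩ := step t ht hm hb
      exact ⟨hm', (hr.newtonRound hm.learner hψ hb ⟨t, ht, rfl⟩ (hone _) hμ hα hU hη).2.1⟩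
  exact ⟨fun t ht => (hinv t ht).1, rfl, fun t ht =>
    (step t ht (hinv t ht.le).1 (hinv t ht.le).2).2⟩

end Machine

/-! ## Cost of the implementation -/

namespace Costed

/-- `a` takes at most `t` steps and `c` memory cells. -/
structure Within {β : Type} (a : Costed β) (t c : ℕ) : Prop where
  time_le : a.time ≤ t
  cells_le : a.cells ≤ c

variable {α β : Type} {t t' c c' m n k d : ℕ}

theorem Within.mono {a : Costed β} (h : Within a t c) (ht : t ≤ t') (hc : c ≤ c') :
    Within a t' c' := ⟨h.1.trans ht, h.2.trans hc⟩

theorem Within.bind {a : Costed α} {f : α → Costed β} (ha : Within a t c)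
    (hf : ∀ r, Within (f r) t' c') : Within (a >>= f) (t + t') (c + c') :=
  ⟨add_le_add ha.1 (hf _).1, add_le_add ha.2 (hf _).2⟩

theorem Within.pure (a : β) : Within (pure a : Costed β) 0 0 := ⟨le_rfl, le_rfl⟩

theorem Within.ite {a b : Costed β} {P : Prop} [Decidable P] (ha : Within a t c)
    (hb : Within b t c) : Within (if P then a else b) t c := by
  split_ifs <;> assumption

theorem within_read (a : ℝ) : Within (read a) 1 1 := ⟨le_rfl, le_rfl⟩
theorem within_add (a b : ℝ) : Within (add a b) 1 1 := ⟨le_rfl, le_rfl⟩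
theorem within_sub (a b : ℝ) : Within (sub a b) 1 1 := ⟨le_rfl, le_rfl⟩
theorem within_mul (a b : ℝ) : Within (mul a b) 1 1 := ⟨le_rfl, le_rfl⟩
theorem within_div (a b : ℝ) : Within (div a b) 1 1 := ⟨le_rfl, le_rfl⟩
theorem within_sqrt (a : ℝ) : Within (sqrt a) 1 1 := ⟨le_rfl, le_rfl⟩

theorem within_kernel (κ : Pt d → Pt d → ℝ) (x x' : Pt d) :
    Within (kernel κ x x') (d + 1) (d + 1) := ⟨le_rfl, le_rfl⟩

theorem within_ifLe {a b : ℝ} {yes no : Costed β} (hy : Within yes t c) (hn : Within no t c) :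
    Within (ifLe a b yes no) (t + 1) c := by
  rw [ifLe]
  split_ifs
  · exact ⟨Nat.succ_le_succ hy.1, hy.2⟩
  · exact ⟨Nat.succ_le_succ hn.1, hn.2⟩

theorem within_sum {f : Fin n → Costed ℝ} (h : ∀ i, Within (f i) t c) :
    Within (sum f) (n * (t + 1)) (1 + c) := by
  refine ⟨?_, Nat.add_le_add_left (Finset.sup_le fun i _ => (h i).2) 1⟩
  change ∑ i, ((f i).time + 1) ≤ _
  refine (Finset.sum_le_card_nsmul _ _ (t + 1) fun i _ => Nat.succ_le_succ (h i).1).trans ?_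
  simp

theorem within_vector {f : Fin n → Costed ℝ} (h : ∀ i, Within (f i) t c) :
    Within (vector f) (n * (t + 1)) (n + c) := by
  refine ⟨?_, Nat.add_le_add_left (Finset.sup_le fun i _ => (h i).2) n⟩
  change ∑ i, ((f i).time + 1) ≤ _
  refine (Finset.sum_le_card_nsmul _ _ (t + 1) fun i _ => Nat.succ_le_succ (h i).1).trans ?_
  simp

theorem within_matrix {f : Fin m → Fin n → Costed ℝ} (h : ∀ i j, Within (f i j) t c) :
    Within (matrix f) (m * (n * (t + 1))) (m * n + c) := by
  refine ⟨?_, Nat.add_le_add_left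
    (Finset.sup_le fun i _ => Finset.sup_le fun j _ => (h i j).2) (m * n)⟩
  change ∑ i, ∑ j, ((f i j).time + 1) ≤ _
  refine (Finset.sum_le_card_nsmul _ _ (n * (t + 1)) fun i _ =>
    (Finset.sum_le_card_nsmul _ _ (t + 1) fun j _ => Nat.succ_le_succ (h i j).1).trans ?_).trans ?_
  · simp
  · simp

theorem within_dot (a b : Fin n → ℝ) : Within (dot a b) (n * 2) 2 :=
  within_sum fun _ => within_mul _ _

theorem within_mulVec (M : Matrix (Fin m) (Fin n) ℝ) (v : Fin n → ℝ) :
    Within (mulVec M v) (m * (n * 2 + 1)) (m + 2) :=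
  within_vector fun _ => within_dot _ _

theorem within_matMul (M : Matrix (Fin m) (Fin n) ℝ) (N : Matrix (Fin n) (Fin k) ℝ) :
    Within (matMul M N) (m * (k * (n * 2 + 1))) (m * k + 2) :=
  within_matrix fun _ _ => within_dot _ _

theorem within_svd (K : Matrix (Fin n) (Fin n) ℝ) : Within (svd K) (n ^ 3) (2 * n ^ 2 + n) :=
  ⟨le_rfl, le_rfl⟩

/-- The cost of producing a prediction from a buffer of size `n`: at most `t` steps if the buffer is
kept, at most `t + g` if it grows, and at most `c` memory cells. -/
def Meets (a : Costed (Pending d)) (n t c g : ℕ) : Prop :=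
  a.cells ≤ c ∧
    ((a.time ≤ t ∧ a.result.size = n) ∨ (a.time ≤ t + g ∧ a.result.size = n + 1))

theorem Meets.bind {a : Costed α} {f : α → Costed (Pending d)} {g : ℕ} (ha : Within a t c)
    (hf : ∀ r, Meets (f r) n t' c' g) : Meets (a >>= f) n (t + t') (c + c') g := by
  obtain ⟨h1, h2⟩ := hf a.result
  refine ⟨add_le_add ha.2 h1, ?_⟩
  rcases h2 with ⟨h2, h3⟩ | ⟨h2, h3⟩
  · exact Or.inl ⟨add_le_add ha.1 h2, h3⟩
  · exact Or.inr ⟨(add_le_add ha.1 h2).trans (by omega), h3⟩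

theorem Meets.mono {a : Costed (Pending d)} {g : ℕ} (h : Meets a n t c g) (ht : t ≤ t')
    (hc : c ≤ c') : Meets a n t' c' g := by
  obtain ⟨h1, h2⟩ := h
  refine ⟨h1.trans hc, ?_⟩
  rcases h2 with ⟨h2, h3⟩ | ⟨h2, h3⟩
  · exact Or.inl ⟨h2.trans ht, h3⟩
  · exact Or.inr ⟨h2.trans (by omega), h3⟩

theorem meets_ifLe {a b : ℝ} {yes no : Costed (Pending d)} {g : ℕ} (hy : Within yes t c)
    (hys : yes.result.size = n) (hn : Within no g c) (hns : no.result.size = n + 1) :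
    Meets (ifLe a b yes no) n (t + 1) c g := by
  rw [ifLe]
  split_ifs
  · exact ⟨hy.2, Or.inl ⟨Nat.succ_le_succ hy.1, hys⟩⟩
  · exact ⟨hn.2, Or.inr ⟨by have := hn.1; simp only; omega, hns⟩⟩

end Costed

open Costed

/-! ### Cost of a round and of a whole run -/

section Cost

variable {d : ℕ} (κ : Pt d → Pt d → ℝ) (P : Params)

theorem within_overshoot (U z : ℝ) : Within (overshoot U z) 4 2 :=
  within_ifLe ((within_add _ _).bind fun _ => within_ifLe (within_read _) (within_read _))
    ((within_sub _ _).mono (by norm_num) (by norm_num))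

theorem within_border {n : ℕ} (G : Matrix (Fin n) (Fin n) ℝ) (k : Fin n → ℝ) (c : ℝ) :
    Within (border G k c) ((n + 1) * ((n + 1) * 2)) ((n + 1) * (n + 1) + 1) :=
  within_matrix fun _ _ => within_read _

/-- The SVD and the matrix products are cubic in time but every stored object is at most quadratic;
the numerical constants are generous. -/
theorem within_grow (m : Machine d) (x : Pt d) (k : Fin m.size → ℝ) (c : ℝ) (w : Fin m.size → ℝ) :
    Within (grow P m x k c w) (100 * (m.size + 1) ^ 3) (50 * (m.size + 1) ^ 2) := by
  refine Within.mono (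
    (within_border _ _ _).bind fun G => (within_svd _).bind fun S =>
    (within_matrix fun i j => (within_sqrt _).bind fun r => within_div _ _).bind fun B =>
    (within_matMul _ _).bind fun X => (within_matMul _ _).bind fun Q =>
    (within_matrix fun i j => (within_sub _ _).ite (within_read _)).bind fun D =>
    (within_matMul _ _).bind fun QD => (within_matMul _ _).bind fun QDQ =>
    (within_matrix fun i j => (within_add _ _).ite (within_read _)).bind fun A =>
    (within_matMul _ _).bind fun QI => (within_matMul _ _).bind fun QIQ =>
    (within_matMul _ _).bind fun QQ =>
    (within_matrix fun i j =>
      ((within_sub _ _).bind fun e => (within_div _ _).bind fun r => within_add _ _).ite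
      ((within_sub _ _).bind fun e => (within_div _ _).bind fun r => within_add _ _)).bind fun I =>
    (within_mulVec _ _).bind fun w' => (within_vector fun i => within_read _).bind fun k' =>
    (within_mulVec _ _).bind fun φ => (within_dot _ _).bind fun ŷ => Within.pure _) ?_ ?_
  · generalize m.size = n
    ring_nf
    nlinarith [Nat.zero_le n, Nat.zero_le (n ^ 2), Nat.zero_le (n ^ 3)]
  · generalize m.size = n
    ring_nf
    nlinarith [Nat.zero_le n, Nat.zero_le (n ^ 2)]

theorem meets_observe (m : Machine d) (x : Pt d) :
    Meets (observe κ P m x) m.size (30 * (m.size + 1) ^ 2 + 4 * ((m.size + 1) * (d + 1)))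
      (80 * (m.size + 1) ^ 2 + 2 * (d + 1)) (100 * (m.size + 1) ^ 3) := by
  have hpos : 1 ≤ (m.size + 1) ^ 2 := Nat.one_le_pow 2 (m.size + 1) (by omega)
  refine Meets.mono (
    Meets.bind (within_vector fun i => within_kernel _ _ _) fun k =>
    Meets.bind (within_mulVec _ _) fun φ => Meets.bind (within_mulVec _ _) fun u =>
    Meets.bind (within_dot _ _) fun z => Meets.bind (within_dot _ _) fun q =>
    Meets.bind (within_overshoot _ _) fun e => Meets.bind (within_div _ _) fun s =>
    Meets.bind (within_vector fun i => (within_mul _ _).bind fun a => within_sub _ _) fun w =>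
    Meets.bind (within_mulVec _ _) fun β => Meets.bind (within_kernel _ _ _) fun c =>
    Meets.bind (within_dot _ _) fun b => Meets.bind (within_sub _ _) fun err =>
    meets_ifLe (t := m.size * 2) (c := 50 * (m.size + 1) ^ 2)
      (((within_dot _ _).bind fun ŷ => Within.pure _).mono (by omega) (by omega)) rfl
      (within_grow P m x k c w) rfl) ?_ ?_
  · generalize m.size = n
    ring_nf
    nlinarith [Nat.zero_le n, Nat.zero_le (n ^ 2), Nat.zero_le (n * d)]
  · generalize m.size = n
    ring_nf
    nlinarith [Nat.zero_le n, Nat.zero_le (n ^ 2)]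

theorem within_learn (p : Pending d) (y : ℝ) :
    Within (learn P p y) (30 * (p.size + 1) ^ 2) (30 * (p.size + 1) ^ 2) := by
  refine Within.mono (
    (within_sub _ _).bind fun r => (within_mul _ _).bind fun g =>
    (within_vector fun i => within_mul _ _).bind fun v =>
    (within_matrix fun i j => (within_mul _ _).bind fun a => (within_mul _ _).bind fun b =>
      within_add _ _).bind fun A =>
    (within_mulVec _ _).bind fun u => (within_dot _ _).bind fun s =>
    (within_mul _ _).bind fun s' => (within_add _ _).bind fun den =>
    (within_matrix fun i j => (within_mul _ _).bind fun a => (within_mul _ _).bind fun b =>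
      (within_div _ _).bind fun c => within_sub _ _).bind fun I =>
    (within_mulVec _ _).bind fun h => (within_vector fun i => within_sub _ _).bind fun w =>
    Within.pure _) ?_ ?_
  · generalize p.size = n
    ring_nf
    nlinarith [Nat.zero_le n, Nat.zero_le (n ^ 2)]
  · generalize p.size = n
    ring_nf
    nlinarith [Nat.zero_le n, Nat.zero_le (n ^ 2)]

variable {κ P} {x : ℕ → Pt d} {y : ℕ → ℝ}

theorem size_machineAt_succ (t : ℕ) :
    (machineAt κ P x y (t + 1)).size = (observeAt κ P x y t).result.size := rfl

/-- The time of a round, up to the cost of enlarging the buffer. -/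
theorem round_time_le {J : ℕ} {t : ℕ} (h0 : (machineAt κ P x y t).size ≤ J)
    (h1 : (machineAt κ P x y (t + 1)).size ≤ J) :
    (machineAt κ P x y t).size ≤ (machineAt κ P x y (t + 1)).size ∧
    (observeAt κ P x y t).time + (learnAt κ P x y t).time ≤
      60 * (J + 1) ^ 2 + 4 * ((J + 1) * (d + 1)) +
        100 * J ^ 3 * ((machineAt κ P x y (t + 1)).size - (machineAt κ P x y t).size) := by
  have hl := (within_learn P (observeAt κ P x y t).result (y t)).time_le
  obtain ⟨-, ho⟩ := meets_observe κ P (machineAt κ P x y t) (x t)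
  rw [← size_machineAt_succ] at hl
  change (learnAt κ P x y t).time ≤ _ at hl
  change ((observeAt κ P x y t).time ≤ _ ∧ (machineAt κ P x y (t + 1)).size = _) ∨
    ((observeAt κ P x y t).time ≤ _ ∧ (machineAt κ P x y (t + 1)).size = _) at ho
  generalize (machineAt κ P x y (t + 1)).size = n' at *
  generalize (machineAt κ P x y t).size = n at *
  have e1 : (n + 1) ^ 2 ≤ (J + 1) ^ 2 := Nat.pow_le_pow_left (by omega) 2
  have e2 : (n' + 1) ^ 2 ≤ (J + 1) ^ 2 := Nat.pow_le_pow_left (by omega) 2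
  have e3 : (n + 1) * (d + 1) ≤ (J + 1) * (d + 1) := Nat.mul_le_mul_right _ (by omega)
  rcases ho with ⟨ht, hs⟩ | ⟨ht, hs⟩
  · refine ⟨hs.ge, ?_⟩
    rw [hs, Nat.sub_self, mul_zero]
    rw [hs] at hl
    omega
  · have e4 : (n + 1) ^ 3 ≤ J ^ 3 := Nat.pow_le_pow_left (by omega) 3
    refine ⟨by omega, ?_⟩
    rw [hs, Nat.add_sub_cancel_left, mul_one]
    rw [hs] at hl e2
    omega

/-- Amortization: the cubic cost of a round is weighted by the growth of the buffer, `0` or `1`, and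
these weights telescope to at most `J`. -/
theorem total_time_le {J T : ℕ} (h : ∀ t ≤ T, (machineAt κ P x y t).size ≤ J) :
    ∑ t ∈ Finset.range T, ((observeAt κ P x y t).time + (learnAt κ P x y t).time) ≤
      T * (60 * (J + 1) ^ 2 + 4 * ((J + 1) * (d + 1))) + 100 * J ^ 4 := by
  have key : ∀ s ≤ T,
      ∑ t ∈ Finset.range s, ((observeAt κ P x y t).time + (learnAt κ P x y t).time) ≤
      s * (60 * (J + 1) ^ 2 + 4 * ((J + 1) * (d + 1))) +
        100 * J ^ 3 * (machineAt κ P x y s).size := by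
    intro s hs
    induction s with
    | zero => simp
    | succ s ih =>
      obtain ⟨h1, h2⟩ := round_time_le (h s (by omega)) (h (s + 1) hs)
      have h3 := ih (by omega)
      obtain ⟨r, hr⟩ := Nat.exists_eq_add_of_le h1
      rw [hr, Nat.add_sub_cancel_left] at h2
      rw [Finset.sum_range_succ, hr, Nat.mul_add (100 * J ^ 3), Nat.succ_mul]
      omega
  refine (key T le_rfl).trans (Nat.add_le_add_left ?_ _)
  rw [pow_succ J 3, ← mul_assoc]
  exact Nat.mul_le_mul_left _ (h T le_rfl)

theorem space_le {J T : ℕ} (h : ∀ t ≤ T, (machineAt κ P x y t).size ≤ J) :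
    space κ P x y T ≤ 130 * (J + 1) ^ 2 + 4 * ((J + 1) * (d + 1)) := by
  refine Finset.sup_le fun t ht => ?_
  have ht' : t < T := Finset.mem_range.mp ht
  have h0 := h t ht'.le
  have h1 := h (t + 1) ht'
  have hl := (within_learn P (observeAt κ P x y t).result (y t)).cells_le
  have ho := (meets_observe κ P (machineAt κ P x y t) (x t)).1
  rw [← size_machineAt_succ] at hl
  change (learnAt κ P x y t).cells ≤ _ at hl
  change (observeAt κ P x y t).cells ≤ _ at ho
  rw [Machine.storage]
  generalize (machineAt κ P x y (t + 1)).size = n' at *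
  generalize (machineAt κ P x y t).size = n at *
  have e1 : (n + 1) ^ 2 ≤ (J + 1) ^ 2 := Nat.pow_le_pow_left (by omega) 2
  have e2 : (n' + 1) ^ 2 ≤ (J + 1) ^ 2 := Nat.pow_le_pow_left (by omega) 2
  have e3 : n * d ≤ J * d := Nat.mul_le_mul_right _ h0
  nlinarith [Nat.zero_le (J * d)]

end Cost

/-! ## Complexity in terms of the number of examples -/

section Complexity

/-- Equivalent to `p² - 9p - 2 > 0`, whose positive root is about `9.2`; hence the threshold `10`.
-/
theorem two_mul_exponent_lt_one {p : ℝ} (hp : 10 ≤ p) :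
    2 * (1 + 5 * p) / (p * (1 + p)) < 1 := by
  rw [div_lt_one (by positivity)]
  nlinarith

theorem cost_le {a b D K X T j τ : ℝ} (hK : 1 ≤ K) (hX : 1 ≤ X) (hT : 0 < T) (hD : 0 ≤ D)
    (hj0 : 0 ≤ j) (hj : j + 1 ≤ K * X) (ha : 0 ≤ a) (hb : 0 ≤ b)
    (h : τ ≤ a * (j + 1) ^ 2 + 4 * ((j + 1) * (D + 1)) + b * j ^ 4 / T) :
    τ ≤ (a + b + 4) * K ^ 4 * (X ^ 2 + X ^ 4 / T + D * X) := by
  have hKX : 0 ≤ K * X := by positivity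
  have h1 : (j + 1) ^ 2 ≤ K ^ 4 * X ^ 2 := by
    calc (j + 1) ^ 2 ≤ (K * X) ^ 2 := by gcongr
      _ = K ^ 2 * X ^ 2 := by ring
      _ ≤ K ^ 4 * X ^ 2 := by
        have : K ^ 2 ≤ K ^ 4 := pow_le_pow_right₀ hK (by norm_num)
        gcongr
  have h2 : (j + 1) * (D + 1) ≤ K ^ 4 * (X ^ 2 + D * X) := by
    calc (j + 1) * (D + 1) ≤ (K * X) * (D + 1) := by gcongr
      _ = K * (X + D * X) := by ring
      _ ≤ K ^ 4 * (X ^ 2 + D * X) := by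
        gcongr
        · exact le_self_pow₀ hK (by norm_num)
        · exact le_self_pow₀ hX (by norm_num)
  have h3 : j ^ 4 / T ≤ K ^ 4 * (X ^ 4 / T) := by
    rw [← mul_div_assoc, ← mul_pow]
    gcongr
    linarith
  have hW : 0 ≤ X ^ 4 / T := by positivity
  have hV : 0 ≤ D * X := by positivity
  have hK4 : 0 ≤ K ^ 4 := by positivity
  have h4 := mul_le_mul_of_nonneg_left h1 ha
  have h5 : b * j ^ 4 / T ≤ b * (K ^ 4 * (X ^ 4 / T)) := by
    rw [mul_div_assoc]
    exact mul_le_mul_of_nonneg_left h3 hb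
  have e1 : 0 ≤ K ^ 4 * (X ^ 4 / T) := by positivity
  have e2 : 0 ≤ K ^ 4 * X ^ 2 := by positivity
  have e3 : 0 ≤ K ^ 4 * (D * X) := by positivity
  have e4 : 0 ≤ b * (K ^ 4 * X ^ 2) := by positivity
  have e5 : 0 ≤ a * (K ^ 4 * (X ^ 4 / T)) := by positivity
  have e6 : 0 ≤ (a + b) * (K ^ 4 * (D * X)) := by positivity
  linarith

variable {d T : ℕ} {κ : Pt d → Pt d → ℝ} {P : Params} {x : ℕ → Pt d} {y : ℕ → ℝ}

theorem avgTime_le {J : ℕ} (hT : 0 < T) (h : ∀ t ≤ T, (machineAt κ P x y t).size ≤ J) :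
    avgTime κ P x y T ≤ 60 * ((J : ℝ) + 1) ^ 2 + 4 * (((J : ℝ) + 1) * (d + 1)) +
      100 * (J : ℝ) ^ 4 / T := by
  have hT0 : (0 : ℝ) < T := by exact_mod_cast hT
  have h1 : ((∑ t ∈ Finset.range T, ((observeAt κ P x y t).time + (learnAt κ P x y t).time) : ℕ)
      : ℝ) ≤ T * (60 * ((J : ℝ) + 1) ^ 2 + 4 * (((J : ℝ) + 1) * (d + 1))) + 100 * (J : ℝ) ^ 4 := by
    exact_mod_cast total_time_le h
  rw [avgTime, div_le_iff₀ hT0]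
  refine h1.trans (le_of_eq ?_)
  field_simp

/-- Space and time in terms of a bound `X` on the size of the buffer. -/
theorem complexity_le {K e : ℝ} (hT : 1 ≤ T) (he : 0 ≤ e) (hK : 0 ≤ K)
    (h : ∀ t ≤ T, ((machineAt κ P x y t).size : ℝ) ≤ K * (T : ℝ) ^ e) :
    (space κ P x y T : ℝ) ≤
      400 * (K + 1) ^ 4 * ((T : ℝ) ^ (2 * e) + d * (T : ℝ) ^ e) ∧
    avgTime κ P x y T ≤
      400 * (K + 1) ^ 4 * ((T : ℝ) ^ (2 * e) + (T : ℝ) ^ (4 * e - 1) + d * (T : ℝ) ^ e) ∧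
    (2 * e ≤ 1 → avgTime κ P x y T ≤
      400 * (K + 1) ^ 4 * ((T : ℝ) ^ (2 * e) + d * (T : ℝ) ^ e)) := by
  have hT' : (1 : ℝ) ≤ T := by exact_mod_cast hT
  have hT0 : (0 : ℝ) < T := by linarith
  set X : ℝ := (T : ℝ) ^ e with hX
  have hX1 : 1 ≤ X := Real.one_le_rpow hT' he
  have hX2 : (T : ℝ) ^ (2 * e) = X ^ 2 := by
    rw [hX, ← Real.rpow_natCast, ← Real.rpow_mul hT0.le, mul_comm]; norm_num
  have hX4 : (T : ℝ) ^ (4 * e - 1) = X ^ 4 / T := by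
    rw [hX, ← Real.rpow_natCast, ← Real.rpow_mul hT0.le, Real.rpow_sub_one hT0.ne', mul_comm]
    norm_num
  set J := ⌊K * X⌋₊ with hJ
  have hKX : 0 ≤ K * X := by positivity
  have hJX : (J : ℝ) ≤ K * X := Nat.floor_le hKX
  have hsize : ∀ t ≤ T, (machineAt κ P x y t).size ≤ J := fun t ht => Nat.le_floor (h t ht)
  have hJ1 : (J : ℝ) + 1 ≤ (K + 1) * X := by nlinarith
  have hJ0 : (0 : ℝ) ≤ J := Nat.cast_nonneg J
  have hD : (0 : ℝ) ≤ d := Nat.cast_nonneg d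
  have hK1 : 1 ≤ K + 1 := by linarith
  have hsp : (space κ P x y T : ℝ) ≤ 130 * ((J : ℝ) + 1) ^ 2 + 4 * (((J : ℝ) + 1) * (d + 1)) := by
    exact_mod_cast space_le hsize
  -- Space has no amortized term, so `b = 0`. The instance `T := X ^ 4` turns the superfluous `X ^ 4
  -- / T` into `1`, which `X ^ 2 ≥ 1` absorbs.
  have hsp' := cost_le (T := X ^ 4) (a := 130) (b := 0) hK1 hX1 (by positivity) hD hJ0 hJ1 (by norm_num) le_rfl
    (hsp.trans (by simp))
  have htm' := cost_le hK1 hX1 hT0 hD hJ0 hJ1 (by norm_num) (by norm_num) (avgTime_le hT hsize)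
  have hK4 : 0 ≤ (K + 1) ^ 4 := by positivity
  have hXX : 1 ≤ X ^ 2 := one_le_pow₀ hX1
  have hDX : 0 ≤ (d : ℝ) * X := by positivity
  have hW : 0 ≤ X ^ 4 / T := by positivity
  rw [hX2, hX4]
  refine ⟨?_, ?_, fun h2e => ?_⟩
  · rw [div_self (by positivity)] at hsp'
    refine hsp'.trans ?_
    rw [mul_right_comm, mul_right_comm 400]
    refine mul_le_mul_of_nonneg_right ?_ hK4
    nlinarith
  · refine htm'.trans ?_
    gcongr
    norm_num
  · refine htm'.trans ?_
    have hXT : X ^ 2 ≤ T := by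
      -- For `2 e ≤ 1` the square of the buffer bound is at most `T`, so the amortized cost `X ^ 4 /
      -- T` is dominated by `X ^ 2`.
      rw [← hX2]
      calc (T : ℝ) ^ (2 * e) ≤ (T : ℝ) ^ (1 : ℝ) := Real.rpow_le_rpow_of_exponent_le hT' h2e
        _ = T := Real.rpow_one _
    have hW2 : X ^ 4 / T ≤ X ^ 2 := by
      rw [div_le_iff₀ hT0]
      calc X ^ 4 = X ^ 2 * X ^ 2 := by ring
        _ ≤ X ^ 2 * T := by gcongr
    rw [mul_right_comm, mul_right_comm 400]
    refine mul_le_mul_of_nonneg_right ?_ hK4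
    nlinarith

theorem sublinear_cost {p : ℝ} (hp : 10 ≤ p) (d : ℕ) :
    (fun T : ℕ => (T : ℝ) ^ (2 * (1 + 5 * p) / (p * (1 + p))) +
        d * (T : ℝ) ^ ((1 + 5 * p) / (p * (1 + p)))) =o[atTop] (fun T : ℕ => (T : ℝ)) := by
  have key : ∀ s : ℝ, s < 1 → (fun T : ℕ => (T : ℝ) ^ s) =o[atTop] (fun T : ℕ => (T : ℝ)) := by
    intro s hs
    refine isLittleO_of_tendsto' ?_ ?_
    · filter_upwards [eventually_gt_atTop 0] with T hT h0
      exact absurd h0 (Nat.cast_ne_zero.mpr hT.ne')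
    · have h := (tendsto_rpow_neg_atTop (sub_pos.mpr hs)).comp
        (tendsto_natCast_atTop_atTop (R := ℝ))
      refine h.congr' ?_
      filter_upwards [eventually_gt_atTop 0] with T hT
      rw [Function.comp_apply, neg_sub, Real.rpow_sub_one (Nat.cast_ne_zero.mpr hT.ne')]
  have h2 := two_mul_exponent_lt_one hp
  have h1 : (1 + 5 * p) / (p * (1 + p)) < 1 := by
    refine lt_of_le_of_lt ?_ h2
    gcongr
    linarith
  exact (key _ h2).add ((key _ h1).const_mul_left _)

end Complexity

end OKR

/-! ### Regret, space and time of NONS-ALD under polynomial decay -/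

theorem mainTheorem2 (p U Y c₁ c₂ : ℝ) (hp : 1 ≤ p) (hU : 0 < U) (hY : 0 ≤ Y) (hYU : Y ≤ U)
    (hc₁ : 0 < c₁) (hc : c₁ ≤ c₂) :
    (∃ C : ℝ, 0 < C ∧
      ∀ (T : ℕ), 2 ≤ T → ∀ (d : ℕ)
        (H : Type u) [NormedAddCommGroup H] [InnerProductSpace ℝ H] [CompleteSpace H]
        [RKHS ℝ H (OKR.Pt d) ℝ],
        (∀ z : OKR.Pt d, OKR.ker H z z = 1) →
      ∀ (x : ℕ → OKR.Pt d) (y : ℕ → ℝ), (∀ t < T, |y t| ≤ Y) →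
      ∀ (R₀ : ℝ), c₁ * T ≤ R₀ → R₀ ≤ c₂ * T →
        OKR.PolyDecay H (fun i : Fin T => x i) R₀ p →
      ∀ (P : OKR.Params),
        P = { μ := (T : ℝ) ^ (1 / (1 + p))
              α := (T : ℝ) ^ (-(4 * p) / (1 + p))
              U := U
              η := 1 / (4 * (U ^ 2 + Y ^ 2)) } →
        -- the regret of NONS-ALD
        (∀ (st : ℕ → OKR.Learner d) (yhat : ℕ → ℝ), OKR.IsNonsAld H P T x y st yhat →
          ∀ f : H, ‖f‖ ≤ U →
            OKR.regret H T x y yhat f ≤ C * ((T : ℝ) ^ (1 / (1 + p)) * Real.log T)) ∧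
        -- the implementation executes NONS-ALD
        OKR.IsNonsAld H P T x y
          (fun t => (OKR.machineAt (OKR.ker H) P x y t).toLearner)
          (OKR.predictionAt (OKR.ker H) P x y) ∧
        -- its space complexity
        (OKR.space (OKR.ker H) P x y T : ℝ) ≤
          C * ((T : ℝ) ^ (2 * (1 + 5 * p) / (p * (1 + p))) +
            d * (T : ℝ) ^ ((1 + 5 * p) / (p * (1 + p)))) ∧
        -- its average per-round time complexity
        OKR.avgTime (OKR.ker H) P x y T ≤
          C * ((T : ℝ) ^ (2 * (1 + 5 * p) / (p * (1 + p))) +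
            (T : ℝ) ^ (4 * (1 + 5 * p) / (p * (1 + p)) - 1) +
            d * (T : ℝ) ^ ((1 + 5 * p) / (p * (1 + p)))) ∧
        (10 ≤ p →
          OKR.avgTime (OKR.ker H) P x y T ≤
            C * ((T : ℝ) ^ (2 * (1 + 5 * p) / (p * (1 + p))) +
              d * (T : ℝ) ^ ((1 + 5 * p) / (p * (1 + p)))))) ∧
    -- for `p ≥ 10` these complexities are sublinear
    (10 ≤ p → ∀ d : ℕ,
      (fun T : ℕ => (T : ℝ) ^ (2 * (1 + 5 * p) / (p * (1 + p))) +
          d * (T : ℝ) ^ ((1 + 5 * p) / (p * (1 + p))))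
        =o[atTop] (fun T : ℕ => (T : ℝ))) := by
  have hc₂ : 0 < c₂ := hc₁.trans_le hc
  -- The factor in the buffer bound `IsNonsAld.size_le`; neither `K` nor `C` depends on `T`, `d`,
  -- the kernel or the examples.
  set K : ℝ := Real.exp 1 * c₂ ^ (1 / p) with hK
  have hK0 : 0 ≤ K := by positivity
  set C : ℝ := max (OKR.regretConst U Y c₂) (400 * (K + 1) ^ 4) with hC
  have hC2 : 400 * (K + 1) ^ 4 ≤ C := le_max_right _ _
  refine ⟨⟨C, lt_of_lt_of_le (by positivity) hC2, ?_⟩, fun hp10 => OKR.sublinear_cost hp10⟩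
  intro T hT d H _ _ _ _ hone x y hy R₀ hR₁ hR₂ hdecay P hP
  have hT1 : 1 ≤ T := by omega
  have hT' : (1 : ℝ) ≤ T := by exact_mod_cast hT1
  have hT0 : (0 : ℝ) < T := by linarith
  obtain ⟨V, lam, hsvd, -⟩ := hdecay.exists_isSVD
  obtain ⟨ψ, hψ, -⟩ := OKR.exists_represents H x hsvd
  have hrun : OKR.IsNonsAld H P T x y
      (fun t => (OKR.machineAt (OKR.ker H) P x y t).toLearner)
      (OKR.predictionAt (OKR.ker H) P x y) :=
    (OKR.machineAt_spec hψ hone (by rw [hP]; positivity) (by rw [hP]; positivity)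
      (by rw [hP]; exact hU.le) (by rw [hP]; positivity)).2
  -- The buffer bound holds for every run of NONS-ALD, and the machine performs one.
  have hsize : ∀ t ≤ T, ((OKR.machineAt (OKR.ker H) P x y t).size : ℝ) ≤
      K * (T : ℝ) ^ ((1 + 5 * p) / (p * (1 + p))) := fun t ht =>
    hrun.size_le hp hU hc₁ hc₂ hT1 hone hR₁ hR₂ hdecay hP ht
  obtain ⟨hsp, htm, htm10⟩ := OKR.complexity_le hT1 (by positivity) hK0 hsize
  have e2 : 2 * (1 + 5 * p) / (p * (1 + p)) = 2 * ((1 + 5 * p) / (p * (1 + p))) := by ring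
  have e4 : 4 * (1 + 5 * p) / (p * (1 + p)) = 4 * ((1 + 5 * p) / (p * (1 + p))) := by ring
  rw [e2, e4]
  refine ⟨fun st yhat h f hf => ?_, hrun, hsp.trans ?_, htm.trans ?_, fun hp10 => ?_⟩
  · refine (h.regret_le hp hU hY hc₂ hT hone hy hR₂ hdecay hP hf).trans ?_
    refine mul_le_mul_of_nonneg_right (le_max_left _ _) ?_
    have := Real.log_nonneg hT'
    positivity
  · gcongr
  · gcongr
  · have h2e := (OKR.two_mul_exponent_lt_one hp10).le
    rw [e2] at h2e
    refine (htm10 h2e).trans ?_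
    gcongr
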